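/- Manifolds are smooth, finite dimensional, Hausdorff and second countable. Let $G$ be a Lie group such that $\operatorname{Aut}(G)$ is a Lie group for which $\operatorname{Ad}\colon G\to\operatorname{Aut}(G)$ and the action of $\operatorname{Aut}(G)$ on $G$ are smooth, and let $[G\to\operatorname{Aut}(G)]$ be the associated Lie 2-group: its 1-arrows are the $\varphi\in\operatorname{Aut}(G)$, its 2-arrows are the pairs $(g,\varphi)\colon\varphi\Rightarrow\operatorname{Ad}_g\circ\varphi$, and the horizontal composition is that of $G\rtimes\operatorname{Aut}(G)$. **Conventions.** Products in groupoids are read from right to left. A Morita morphism of Lie groupoids is a morphism that is a surjective submersion on objects and identifies its domain with the pullback of its target along the map on objects. A Morita morphism of Lie 2-groupoids $\Delta\to\Gamma$ is a strict morphism such that $\Delta_0\to\Gamma_0$ and $\Delta_1\to\Gamma_1[\Delta_0]$ are surjective submersions and $(\Delta_2\rightrightarrows\Delta_1)\to(\Gamma_2[\Delta_0]\rightrightarrows\Gamma_1[\Delta_0])$ is a Morita morphism of Lie groupoids, where $\Gamma_i[\Delta_0]$ denotes the pullback along $\Delta_0\to\Gamma_0$. A generalized morphism of Lie 2-groupoids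 is a zigzag of strict morphisms whose backward arrows are Morita morphisms. Equivalence of generalized morphisms is the smallest equivalence relation that identifies strict morphisms related by a natural 2-transformation, makes each Morita morphism and the same arrow read backwards inverse to each other, identifies consecutive forward arrows with their composite and identity arrows with the empty zigzag, and is preserved by concatenation on either side. A $[G\to\operatorname{Aut}(G)]$-bundle over a Lie groupoid $\Gamma\rightrightarrows\Gamma_0$ is a generalized morphism from $\Gamma$ (as a 2-groupoid with only identity 2-arrows) to $[G\to\operatorname{Aut}(G)]$. Bundles $P$ over $\Gamma$ and $P'$ over $\Gamma'$ are Morita equivalent if there is a zigzag $E$ of Morita morphisms of Lie 2-groupoids from $\Gamma'$ to $\Gamma$ such that $P\circ E$ and $P'$ are equivalent generalized morphisms $\Gamma'\rightsquigarrow[G\to\operatorname{Aut}(G)]$. A Lie groupoid $G$-extension is a short exact sequence $1\to M\times G\xrightarrow{i}\tilde H\to H\to1$ of Lie groupoids over the identity of $M$, with $M\times G$ the trivial bundle of groups. A homomorphism of $G$-extensions is a pair of groupoid morphisms $\tilde H\to\tilde K$, $H\to K$ over the same map of objects and compatible with the projections (it need not be the identity on $G$). It is a Morita morphism if both are Morita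 morphisms. Morita equivalence of $G$-extensions is the equivalence relation generated by the Morita morphisms. **Proposition.** (a) Every $[G\to\operatorname{Aut}(G)]$-bundle over a Lie groupoid $\Gamma\rightrightarrows\Gamma_0$ is equivalent to a generalized morphism $\Gamma\xleftarrow{\phi}\Delta\xrightarrow{f}[G\to\operatorname{Aut}(G)]$ with $\phi$ a Morita morphism. For every such diagram representing the bundle, let $L=\{l\in\Delta_2 : l \text{ is a 2-arrow from a unit } 1_m \text{ to a 1-arrow } j(l)\}$ and write $f(l)\in G$ for the $G$-component of $f_2(l)\in G\rtimes\operatorname{Aut}(G)$. Let $\Delta_1\times G\to\Delta_1\rightrightarrows\Delta_0$ be the trivial extension, where $(a,g)\cdot(b,h)=(ab,\,f_1(b)^{-1}(g)\,h)$. Then there is a Lie groupoid $G$-extension $\tilde H\to H\rightrightarrows\Delta_0$ with a homomorphism from the trivial extension onto it that is the identity on $\Delta_0$ and on $\Delta_0\times G$, is a surjective submersion on $\Delta_1\times G\to\tilde H$ and on $\Delta_1\to H$, and whose fibres are exactly the classes $(a\,j(l),g)\sim(a,f(l)g)$ and $a\,j(l)\sim a$, with $l\in L$ over the source of $a$. In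 other words, $\tilde H=(\Delta_1\times G)/L$ and $H=\Delta_1/j(L)$. Moreover $\phi$ induces a Morita morphism of Lie groupoids from $H\rightrightarrows\Delta_0$ to $\Gamma\rightrightarrows\Gamma_0$. Such an extension is said to be induced by the bundle. (b) If a $[G\to\operatorname{Aut}(G)]$-bundle over $\Gamma$ and a $[G\to\operatorname{Aut}(G)]$-bundle over $\Gamma'$ are Morita equivalent, then any $G$-extension induced by the first (through any representing diagram as in (a)) is Morita equivalent to any $G$-extension induced by the second. -/

import Mathlib

open scoped Manifold ContDiff

universe u

namespace TwoBundle

noncomputable section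

/-! ## Smooth manifolds -/

/-- A smooth manifold: finite dimensional, without boundary, Hausdorff and second countable. -/
structure Mfd : Type (u + 1) where
  carrier : Type u
  model : Type
  [normed : NormedAddCommGroup model]
  [space : NormedSpace ℝ model]
  [finDim : FiniteDimensional ℝ model]
  [top : TopologicalSpace carrier]
  [charted : ChartedSpace model carrier]
  [isManifold : IsManifold 𝓘(ℝ, model) ∞ carrier]
  [t2 : T2Space carrier]
  [secondCountable : SecondCountableTopology carrier]

namespace Mfd

instance : CoeSort Mfd.{u} (Type u) := ⟨Mfd.carrier⟩

attribute [instance] normed space finDim top charted isManifold t2 secondCountable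

/-- Smooth maps. -/
abbrev Smooth {M N : Mfd.{u}} (f : M → N) : Prop :=
  ContMDiff 𝓘(ℝ, M.model) 𝓘(ℝ, N.model) ∞ f

/-- Smoothness on a subset `S`. If `S` is an embedded submanifold (in this file, always a fibre
product of smooth maps one of which is a submersion), this is smoothness of `f` restricted
to `S`. -/
abbrev SmoothOn {M N : Mfd.{u}} (f : M → N) (S : Set M) : Prop :=
  ContMDiffOn 𝓘(ℝ, M.model) 𝓘(ℝ, N.model) ∞ f S

/-- Surjective submersions. -/
def SurjSubmersion {M N : Mfd.{u}} (f : M → N) : Prop :=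
  Function.Surjective f ∧ Manifold.IsSubmersion 𝓘(ℝ, M.model) 𝓘(ℝ, N.model) ∞ f

/-- `f` is a diffeomorphism from `M` onto the embedded submanifold `S` of `N`. -/
def DiffeoOnto {M N : Mfd.{u}} (f : M → N) (S : Set N) : Prop :=
  Smooth f ∧ (∀ x, f x ∈ S) ∧
    ∃ g : N → M, SmoothOn g S ∧ (∀ x, g (f x) = x) ∧ ∀ y ∈ S, f (g y) = y

/-- `f` is a surjective submersion from `M` onto the embedded submanifold `S` of `N`; here `P` is
the submanifold `S`, seen as a manifold in its own right. -/
def SurjSubmersionOnto {M N : Mfd.{u}} (f : M → N) (S : Set N) : Prop :=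
  ∃ (P : Mfd.{u}) (ι : P → N) (q : M → P),
    DiffeoOnto ι S ∧ SurjSubmersion q ∧ ∀ x, ι (q x) = f x

theorem isManifold_prod (M N : Mfd.{u}) :
    @IsManifold ℝ _ (M.model × N.model) _ _ (M.model × N.model) _ 𝓘(ℝ, M.model × N.model) ∞
      (M.carrier × N.carrier) _ (prodChartedSpace M.model M N.model N) := by
  rw [modelWithCornersSelf_prod]
  exact IsManifold.prod M.carrier N.carrier

/-- The product manifold. -/
def prod (M N : Mfd.{u}) : Mfd.{u} :=
  letI : ChartedSpace (M.model × N.model) (M.carrier × N.carrier) :=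
    prodChartedSpace M.model M N.model N
  haveI := isManifold_prod M N
  { carrier := M.carrier × N.carrier
    model := M.model × N.model }

/-- The one-point manifold. -/
def point : Mfd.{u} :=
  letI : ChartedSpace PUnit.{1} PUnit.{u + 1} := ChartedSpace.ofDiscreteTopology
  haveI : IsManifold 𝓘(ℝ, PUnit.{1}) ∞ PUnit.{u + 1} := IsManifold.of_discreteTopology _
  { carrier := PUnit.{u + 1}
    model := PUnit.{1} }

instance : Unique point.{u}.carrier := inferInstanceAs (Unique PUnit)
instance : Unique point.{u}.model := inferInstanceAs (Unique PUnit)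
instance : DiscreteTopology point.{u}.carrier := inferInstanceAs (DiscreteTopology PUnit)


section Lemmas
variable {M N P : Mfd.{u}}

theorem smoothOn_prod_dom {f : M × N → P} {S : Set (M × N)} :
    SmoothOn (M := M.prod N) f S ↔
      ContMDiffOn (𝓘(ℝ, M.model).prod 𝓘(ℝ, N.model)) 𝓘(ℝ, P.model) ∞ f S := by
  rw [← modelWithCornersSelf_prod]; exact Iff.rfl

theorem smoothOn_prod_cod {f : P → M × N} {S : Set P} :
    SmoothOn (N := M.prod N) f S ↔
      ContMDiffOn 𝓘(ℝ, P.model) (𝓘(ℝ, M.model).prod 𝓘(ℝ, N.model)) ∞ f S := by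
  rw [← modelWithCornersSelf_prod]; exact Iff.rfl

theorem smoothOn_fst {S : Set (M.prod N)} : SmoothOn (M := M.prod N) (N := M) Prod.fst S :=
  smoothOn_prod_dom.2 contMDiffOn_fst

theorem smoothOn_snd {S : Set (M.prod N)} : SmoothOn (M := M.prod N) (N := N) Prod.snd S :=
  smoothOn_prod_dom.2 contMDiffOn_snd

theorem smooth_fst : Smooth (M := M.prod N) (N := M) Prod.fst :=
  contMDiffOn_univ.1 smoothOn_fst

theorem smooth_snd : Smooth (M := M.prod N) (N := N) Prod.snd :=
  contMDiffOn_univ.1 smoothOn_snd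

theorem SmoothOn.pair {f : P → M} {g : P → N} {S : Set P} (hf : SmoothOn f S)
    (hg : SmoothOn g S) : SmoothOn (N := M.prod N) (fun x => (f x, g x)) S :=
  smoothOn_prod_cod.2 (ContMDiffOn.prodMk hf hg)

theorem Smooth.pair {f : P → M} {g : P → N} (hf : Smooth f)
    (hg : Smooth g) : Smooth (N := M.prod N) (fun x => (f x, g x)) :=
  contMDiffOn_univ.1 (SmoothOn.pair (contMDiffOn_univ.2 hf) (contMDiffOn_univ.2 hg))

theorem submersion_comp_fst {f : M → N}
    (hf : Manifold.IsSubmersion 𝓘(ℝ, M.model) 𝓘(ℝ, N.model) ∞ f) :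
    Manifold.IsSubmersion 𝓘(ℝ, (M.prod P).model) 𝓘(ℝ, N.model) ∞
      (fun x : M.prod P => f x.1) := by
  have key : Manifold.IsSubmersion (𝓘(ℝ, M.model).prod 𝓘(ℝ, P.model)) 𝓘(ℝ, N.model) ∞
      (fun x : M × P => f x.1) := by
    have h := hf.isSubmersionOfComplement_complement
    refine Manifold.IsSubmersionOfComplement.isSubmersion (F := hf.complement × P.model) ?_
    rintro ⟨x, y⟩
    have hx := h x
    refine Manifold.IsSubmersionAtOfComplement.mk_of_continuousAt
      ((hf.contMDiff.continuous.comp continuous_fst).continuousAt)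
      ((hx.equiv.prodCongr (ContinuousLinearEquiv.refl ℝ P.model)).trans
        (ContinuousLinearEquiv.prodAssoc ℝ _ _ _))
      (hx.domChart.prod (chartAt P.model y)) hx.codChart
      ⟨hx.mem_domChart_source, mem_chart_source _ _⟩ hx.mem_codChart_source
      (IsManifold.mem_maximalAtlas_prod hx.domChart_mem_maximalAtlas
        (IsManifold.chart_mem_maximalAtlas y)) hx.codChart_mem_maximalAtlas ?_
    rintro ⟨a, b⟩ hab
    rw [OpenPartialHomeomorph.extend_prod] at hab
    exact hx.writtenInCharts hab.1
  rw [← modelWithCornersSelf_prod] at key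
  exact key

theorem submersion_snd :
    Manifold.IsSubmersion 𝓘(ℝ, (P.prod M).model) 𝓘(ℝ, M.model) ∞
      (fun x : P.prod M => x.2) := by
  have key : Manifold.IsSubmersion (𝓘(ℝ, P.model).prod 𝓘(ℝ, M.model)) 𝓘(ℝ, M.model) ∞
      (fun x : P × M => x.2) := by
    refine Manifold.IsSubmersionOfComplement.isSubmersion (F := P.model) ?_
    rintro ⟨x, y⟩
    refine Manifold.IsSubmersionAtOfComplement.mk_of_continuousAt
      continuous_snd.continuousAt (ContinuousLinearEquiv.prodComm ℝ _ _)
      ((chartAt P.model x).prod (chartAt M.model y)) (chartAt M.model y)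
      ⟨mem_chart_source _ _, mem_chart_source _ _⟩ (mem_chart_source _ _)
      (IsManifold.mem_maximalAtlas_prod (IsManifold.chart_mem_maximalAtlas x)
        (IsManifold.chart_mem_maximalAtlas y)) (IsManifold.chart_mem_maximalAtlas y) ?_
    rintro ⟨a, b⟩ hab
    rw [OpenPartialHomeomorph.extend_prod] at hab
    exact ((chartAt M.model y).extend 𝓘(ℝ, M.model)).right_inv hab.2
  rw [← modelWithCornersSelf_prod] at key
  exact key

theorem submersion_comp_diffeo {f : M → N} {d e : M → M}
    (hf : Manifold.IsSubmersion 𝓘(ℝ, M.model) 𝓘(ℝ, N.model) ∞ f)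
    (hd : Smooth d) (he : Smooth e) (hed : ∀ x, e (d x) = x) (hde : ∀ x, d (e x) = x) :
    Manifold.IsSubmersion 𝓘(ℝ, M.model) 𝓘(ℝ, N.model) ∞ (fun x => f (d x)) := by
  have h := hf.isSubmersionOfComplement_complement
  refine Manifold.IsSubmersionOfComplement.isSubmersion (F := hf.complement) fun x => ?_
  have hx := h (d x)
  let D : M ≃ₜ M :=
    { toFun := d, invFun := e, left_inv := hed, right_inv := hde
      continuous_toFun := hd.continuous, continuous_invFun := he.continuous }
  refine Manifold.IsSubmersionAtOfComplement.mk_of_continuousAt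
    ((hf.contMDiff.continuous.comp hd.continuous).continuousAt) hx.equiv
    (D.toOpenPartialHomeomorph.trans hx.domChart) hx.codChart ?_ hx.mem_codChart_source
    ?_ hx.codChart_mem_maximalAtlas ?_
  · simpa [D] using hx.mem_domChart_source
  · rw [IsManifold.mem_maximalAtlas_iff_contMDiffOn]
    constructor
    · exact (contMDiffOn_of_mem_maximalAtlas hx.domChart_mem_maximalAtlas).comp
        hd.contMDiffOn (fun y hy => by simpa [D] using hy)
    · exact he.comp_contMDiffOn
        ((contMDiffOn_symm_of_mem_maximalAtlas hx.domChart_mem_maximalAtlas).mono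
          (fun y hy => by simpa [D] using hy))
  · intro y hy
    have h1 : y ∈ (hx.domChart.extend 𝓘(ℝ, M.model)).target := by simpa [D] using hy
    have h2 := hx.writtenInCharts h1
    simp only [Function.comp_apply] at h2 ⊢
    rw [← h2]
    congr 1
    exact congrArg f (hde _)

theorem submersion_point (f : M → point.{u}) :
    Manifold.IsSubmersion 𝓘(ℝ, M.model) 𝓘(ℝ, point.{u}.model) ∞ f := by
  refine Manifold.IsSubmersionOfComplement.isSubmersion (F := M.model) ?_
  intro x
  refine Manifold.IsSubmersionAtOfComplement.mk_of_continuousAt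
    (continuous_of_const (fun _ _ => Subsingleton.elim _ _)).continuousAt
    (ContinuousLinearEquiv.uniqueProd ℝ _ _).symm
    (chartAt M.model x) (chartAt _ (f x)) (mem_chart_source _ _) (mem_chart_source _ _)
    (IsManifold.chart_mem_maximalAtlas x) (IsManifold.chart_mem_maximalAtlas _) ?_
  intro y _
  exact Subsingleton.elim _ _

end Lemmas

end Mfd
open Mfd

/-! ## Lie groupoids -/

/-- A Lie groupoid with manifold of objects `M` and manifold of arrows `A`. The product `mul a b`
is the composite "first `b`, then `a`"; it is meaningful when `src a = tgt b`, and its values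
on other pairs play no role. -/
structure LieGroupoid (M A : Mfd.{u}) where
  src : A → M
  tgt : A → M
  unit : M → A
  mul : A → A → A
  inv : A → A
  src_submersion : SurjSubmersion src
  tgt_submersion : SurjSubmersion tgt
  unit_smooth : Smooth unit
  inv_smooth : Smooth inv
  mul_smooth : SmoothOn (M := A.prod A) (fun p : A × A => mul p.1 p.2)
    {p : A × A | src p.1 = tgt p.2}
  src_unit : ∀ m, src (unit m) = m
  tgt_unit : ∀ m, tgt (unit m) = m
  src_mul : ∀ a b, src a = tgt b → src (mul a b) = src b
  tgt_mul : ∀ a b, src a = tgt b → tgt (mul a b) = tgt a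
  mul_assoc : ∀ a b c, src a = tgt b → src b = tgt c → mul (mul a b) c = mul a (mul b c)
  unit_mul : ∀ a, mul (unit (tgt a)) a = a
  mul_unit : ∀ a, mul a (unit (src a)) = a
  src_inv : ∀ a, src (inv a) = tgt a
  tgt_inv : ∀ a, tgt (inv a) = src a
  inv_mul : ∀ a, mul (inv a) a = unit (src a)
  mul_inv : ∀ a, mul a (inv a) = unit (tgt a)

namespace LieGroupoid

variable {M A N B : Mfd.{u}}

/-- `(f₀, f₁)` is a morphism of Lie groupoids, that is, a smooth functor. -/
structure IsHom (X : LieGroupoid M A) (Y : LieGroupoid N B) (f₀ : M → N) (f₁ : A → B) :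
    Prop where
  smooth₀ : Smooth f₀
  smooth₁ : Smooth f₁
  src : ∀ a, Y.src (f₁ a) = f₀ (X.src a)
  tgt : ∀ a, Y.tgt (f₁ a) = f₀ (X.tgt a)
  unit : ∀ m, f₁ (X.unit m) = Y.unit (f₀ m)
  mul : ∀ a b, X.src a = X.tgt b → f₁ (X.mul a b) = Y.mul (f₁ a) (f₁ b)

theorem IsHom.comp {P C : Mfd.{u}} {X : LieGroupoid M A}
    {Y : LieGroupoid N B} {Z : LieGroupoid P C} {g₀ : N → P} {g₁ : B → C} {f₀ : M → N}
    {f₁ : A → B} (hg : IsHom Y Z g₀ g₁) (hf : IsHom X Y f₀ f₁) :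
    IsHom X Z (g₀ ∘ f₀) (g₁ ∘ f₁) where
  smooth₀ := hg.smooth₀.comp hf.smooth₀
  smooth₁ := hg.smooth₁.comp hf.smooth₁
  src a := by simp [hg.src, hf.src]
  tgt a := by simp [hg.tgt, hf.tgt]
  unit m := by simp [hg.unit, hf.unit]
  mul a b h := by
    simp only [Function.comp_apply]
    rw [hf.mul a b h, hg.mul _ _ (by rw [hf.src, hf.tgt, h])]

/-- The arrows `(m, b, n)` of the pullback groupoid of `Y` along `f₀ : M → N`, with target `m` and
source `n`. -/
def pullbackArrows (Y : LieGroupoid N B) (f₀ : M → N) : Set (M.prod (B.prod M)) :=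
  {p : M × B × M | Y.tgt p.2.1 = f₀ p.1 ∧ Y.src p.2.1 = f₀ p.2.2}

/-- Morita morphisms of Lie groupoids: `f₀` is a surjective submersion and `f₁` identifies `X`
with the pullback of `Y` along `f₀`. -/
structure IsMorita (X : LieGroupoid M A) (Y : LieGroupoid N B) (f₀ : M → N) (f₁ : A → B) :
    Prop where
  isHom : IsHom X Y f₀ f₁
  base : SurjSubmersion f₀
  arrows : DiffeoOnto (M := A) (N := M.prod (B.prod M))
    (fun a => ((X.tgt a, f₁ a, X.src a) : M × B × M)) (pullbackArrows Y f₀)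

/-- The groupoid `A ⇉ A` with only identity arrows. -/
def discrete (A : Mfd.{u}) : LieGroupoid A A where
  src := id
  tgt := id
  unit := id
  mul a _ := a
  inv := id
  src_submersion := ⟨Function.surjective_id, .id⟩
  tgt_submersion := ⟨Function.surjective_id, .id⟩
  unit_smooth := contMDiff_id
  inv_smooth := contMDiff_id
  mul_smooth := smoothOn_fst
  src_unit _ := rfl
  tgt_unit _ := rfl
  src_mul _ _ h := h
  tgt_mul _ _ _ := rfl
  mul_assoc _ _ _ _ _ := rfl
  unit_mul _ := rfl
  mul_unit _ := rfl
  src_inv _ := rfl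
  tgt_inv _ := rfl
  inv_mul _ := rfl
  mul_inv _ := rfl

end LieGroupoid

/-! ## Lie 2-groupoids -/

/-- A Lie 2-groupoid: objects `X₀`, 1-arrows `X₁` and 2-arrows `X₂`. The vertical composition
of 2-arrows is that of `ver`, and `ver.src`, `ver.tgt` are the 1-arrows `l`, `u` between which a
2-arrow goes; the horizontal composition is that of `hor`. -/
structure Lie2Groupoid where
  X₀ : Mfd.{u}
  X₁ : Mfd.{u}
  X₂ : Mfd.{u}
  one : LieGroupoid X₀ X₁
  ver : LieGroupoid X₁ X₂
  hor : LieGroupoid X₀ X₂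
  src_hom : LieGroupoid.IsHom hor one id ver.src
  tgt_hom : LieGroupoid.IsHom hor one id ver.tgt
  unit_hom : LieGroupoid.IsHom one hor id ver.unit
  interchange : ∀ a b c d, ver.src a = ver.tgt b → ver.src c = ver.tgt d →
    hor.src a = hor.tgt c →
    hor.mul (ver.mul a b) (ver.mul c d) = ver.mul (hor.mul a c) (hor.mul b d)

namespace Lie2Groupoid

/-- A Lie groupoid, seen as a Lie 2-groupoid with only identity 2-arrows. -/
def ofGroupoid {M A : Mfd.{u}} (X : LieGroupoid M A) : Lie2Groupoid.{u} where
  X₀ := M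
  X₁ := A
  X₂ := A
  one := X
  ver := .discrete A
  hor := X
  src_hom := ⟨contMDiff_id, contMDiff_id, fun _ => rfl, fun _ => rfl, fun _ => rfl,
    fun _ _ _ => rfl⟩
  tgt_hom := ⟨contMDiff_id, contMDiff_id, fun _ => rfl, fun _ => rfl, fun _ => rfl,
    fun _ _ _ => rfl⟩
  unit_hom := ⟨contMDiff_id, contMDiff_id, fun _ => rfl, fun _ => rfl, fun _ => rfl,
    fun _ _ _ => rfl⟩
  interchange _ _ _ _ _ _ _ := rfl

/-- Strict morphisms of Lie 2-groupoids. -/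
@[ext]
structure Hom (X Y : Lie2Groupoid.{u}) where
  f₀ : X.X₀ → Y.X₀
  f₁ : X.X₁ → Y.X₁
  f₂ : X.X₂ → Y.X₂
  one : LieGroupoid.IsHom X.one Y.one f₀ f₁
  ver : LieGroupoid.IsHom X.ver Y.ver f₁ f₂
  hor : LieGroupoid.IsHom X.hor Y.hor f₀ f₂

namespace Hom

variable {X Y Z : Lie2Groupoid.{u}}

/-- The identity morphism. -/
def id (X : Lie2Groupoid.{u}) : Hom X X where
  f₀ := _root_.id
  f₁ := _root_.id
  f₂ := _root_.id
  one := ⟨contMDiff_id, contMDiff_id, fun _ => rfl, fun _ => rfl, fun _ => rfl, fun _ _ _ => rfl⟩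
  ver := ⟨contMDiff_id, contMDiff_id, fun _ => rfl, fun _ => rfl, fun _ => rfl, fun _ _ _ => rfl⟩
  hor := ⟨contMDiff_id, contMDiff_id, fun _ => rfl, fun _ => rfl, fun _ => rfl, fun _ _ _ => rfl⟩

/-- The composite "first `f`, then `g`". -/
def comp (g : Hom Y Z) (f : Hom X Y) : Hom X Z where
  f₀ := g.f₀ ∘ f.f₀
  f₁ := g.f₁ ∘ f.f₁
  f₂ := g.f₂ ∘ f.f₂
  one := g.one.comp f.one
  ver := g.ver.comp f.ver
  hor := g.hor.comp f.hor

/-- Morita morphisms of Lie 2-groupoids `f : X → Y`. With `Y[X₀]` the pullback of `Y` along `f₀`,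
they are those for which `f₀` and `X₁ → Y₁[X₀]` are surjective submersions and
`(X₂ ⇉ X₁) → (Y₂[X₀] ⇉ Y₁[X₀])` is a Morita morphism of Lie groupoids, that is, `X₂` is identified
with the manifold of triples `(a, y, b)`, where `a` and `b` are 1-arrows of `X` with the same
source and the same target and `y` is a 2-arrow of `Y` from `f₁ b` to `f₁ a`. -/
structure IsMorita (f : Hom X Y) : Prop where
  base : SurjSubmersion f.f₀
  arrows : SurjSubmersionOnto (M := X.X₁) (N := X.X₀.prod (Y.X₁.prod X.X₀))
    (fun a => ((X.one.tgt a, f.f₁ a, X.one.src a) : X.X₀ × Y.X₁ × X.X₀))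
    (LieGroupoid.pullbackArrows Y.one f.f₀)
  cells : DiffeoOnto (M := X.X₂) (N := X.X₁.prod (Y.X₂.prod X.X₁))
    (fun x => ((X.ver.tgt x, f.f₂ x, X.ver.src x) : X.X₁ × Y.X₂ × X.X₁))
    {p : X.X₁ × Y.X₂ × X.X₁ | Y.ver.tgt p.2.1 = f.f₁ p.1 ∧ Y.ver.src p.2.1 = f.f₁ p.2.2 ∧
      X.one.tgt p.1 = X.one.tgt p.2.2 ∧ X.one.src p.1 = X.one.src p.2.2}

/-- A natural 2-transformation from `f` to `g`: 1-arrows `φ m : f₀ m → g₀ m` and 2-arrows `ψ j`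
from `φ (tgt j) * f₁ j` to `g₁ j * φ (src j)`, depending smoothly on `m` and `j`. -/
structure NatTrans (f g : Hom X Y) where
  φ : X.X₀ → Y.X₁
  ψ : X.X₁ → Y.X₂
  smooth_φ : Smooth φ
  smooth_ψ : Smooth ψ
  src_φ : ∀ m, Y.one.src (φ m) = f.f₀ m
  tgt_φ : ∀ m, Y.one.tgt (φ m) = g.f₀ m
  src_ψ : ∀ j, Y.ver.src (ψ j) = Y.one.mul (φ (X.one.tgt j)) (f.f₁ j)
  tgt_ψ : ∀ j, Y.ver.tgt (ψ j) = Y.one.mul (g.f₁ j) (φ (X.one.src j))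
  naturality : ∀ x,
    Y.ver.mul (Y.hor.mul (g.f₂ x) (Y.ver.unit (φ (X.hor.src x)))) (ψ (X.ver.src x)) =
      Y.ver.mul (ψ (X.ver.tgt x)) (Y.hor.mul (Y.ver.unit (φ (X.hor.tgt x))) (f.f₂ x))
  map_mul : ∀ j i, X.one.src j = X.one.tgt i →
    ψ (X.one.mul j i) = Y.ver.mul (Y.hor.mul (Y.ver.unit (g.f₁ j)) (ψ i))
      (Y.hor.mul (ψ j) (Y.ver.unit (f.f₁ i)))

end Hom

/-! ## Generalized morphisms -/

/-- A generalized morphism from `X` to `Y`: a finite zigzag of morphisms of Lie 2-groupoids, read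
from `X` to `Y`, in which every arrow pointing backwards is a Morita morphism. -/
inductive GenMor : Lie2Groupoid.{u} → Lie2Groupoid.{u} → Type (u + 1)
  | nil (X : Lie2Groupoid.{u}) : GenMor X X
  | fwd {X Y Z : Lie2Groupoid.{u}} (F : GenMor X Y) (f : Hom Y Z) : GenMor X Z
  | bwd {X Y Z : Lie2Groupoid.{u}} (F : GenMor X Y) (f : Hom Z Y) (hf : f.IsMorita) : GenMor X Z

namespace GenMor

/-- Concatenation of zigzags: first `F`, then `K`. -/
def comp {X Y : Lie2Groupoid.{u}} (F : GenMor X Y) : {Z : Lie2Groupoid.{u}} → GenMor Y Z →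
    GenMor X Z
  | _, nil _ => F
  | _, fwd K f => (comp F K).fwd f
  | _, bwd K f hf => (comp F K).bwd f hf

/-- The zigzag `X → Y` with one arrow. -/
abbrev of {X Y : Lie2Groupoid.{u}} (f : Hom X Y) : GenMor X Y := (nil X).fwd f

/-- The zigzag `X ← E → Y`, where `E → X` is a Morita morphism. -/
abbrev span {X E Y : Lie2Groupoid.{u}} (φ : Hom E X) (hφ : φ.IsMorita) (f : Hom E Y) :
    GenMor X Y := ((nil X).bwd φ hφ).fwd f

/-- All the arrows of a zigzag are Morita morphisms: a Morita equivalence. -/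
def AllMorita : {X Y : Lie2Groupoid.{u}} → GenMor X Y → Prop
  | _, _, nil _ => True
  | _, _, fwd F f => AllMorita F ∧ f.IsMorita
  | _, _, bwd F _ _ => AllMorita F

/-- Equivalence of generalized morphisms: the smallest equivalence relation for which morphisms
related by a natural 2-transformation are equivalent, a Morita morphism and the same arrow read
backwards are inverse to each other, two consecutive forward arrows are equivalent to their
composite (and the empty zigzag to the identity morphism), and which is compatible with
concatenation on both sides. -/
inductive Equiv : {X Y : Lie2Groupoid.{u}} → GenMor X Y → GenMor X Y → Prop
  | refl {X Y : Lie2Groupoid.{u}} (F : GenMor X Y) : Equiv F F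
  | symm {X Y : Lie2Groupoid.{u}} {F F' : GenMor X Y} : Equiv F F' → Equiv F' F
  | trans {X Y : Lie2Groupoid.{u}} {F F' F'' : GenMor X Y} :
      Equiv F F' → Equiv F' F'' → Equiv F F''
  | natTrans {X Y : Lie2Groupoid.{u}} {f g : Hom X Y} (α : Hom.NatTrans f g) :
      Equiv (of f) (of g)
  | bwd_fwd {X Y : Lie2Groupoid.{u}} (φ : Hom X Y) (hφ : φ.IsMorita) :
      Equiv (((nil Y).bwd φ hφ).fwd φ) (nil Y)
  | fwd_bwd {X Y : Lie2Groupoid.{u}} (φ : Hom X Y) (hφ : φ.IsMorita) :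
      Equiv (((nil X).fwd φ).bwd φ hφ) (nil X)
  | id (X : Lie2Groupoid.{u}) : Equiv (of (Hom.id X)) (nil X)
  | fwd_fwd {X Y Z : Lie2Groupoid.{u}} (f : Hom X Y) (g : Hom Y Z) :
      Equiv ((of f).fwd g) (of (g.comp f))
  | comp_left {X Y Z : Lie2Groupoid.{u}} (K : GenMor X Y) {F F' : GenMor Y Z} :
      Equiv F F' → Equiv (K.comp F) (K.comp F')
  | comp_right {X Y Z : Lie2Groupoid.{u}} {F F' : GenMor X Y} (K : GenMor Y Z) :
      Equiv F F' → Equiv (F.comp K) (F'.comp K)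

end GenMor

end Lie2Groupoid

/-! ## Lie groups and the 2-group `[G → Aut(G)]` -/

/-- A Lie group. -/
structure LieGrp extends Mfd.{u} where
  [group : Group carrier]
  [lieGroup : LieGroup 𝓘(ℝ, model) ∞ carrier]

namespace LieGrp

instance : CoeSort LieGrp.{u} (Type u) := ⟨fun G => G.carrier⟩

attribute [instance] group lieGroup

variable {G : LieGrp.{u}}

theorem smoothOn_mul {M : Mfd.{u}} {f g : M → G} {S : Set M} (hf : SmoothOn (N := G.toMfd) f S)
    (hg : SmoothOn (N := G.toMfd) g S) : SmoothOn (N := G.toMfd) (fun x => f x * g x) S :=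
  ContMDiffOn.mul hf hg

theorem smoothOn_inv {M : Mfd.{u}} {f : M → G} {S : Set M} (hf : SmoothOn (N := G.toMfd) f S) :
    SmoothOn (N := G.toMfd) (fun x => (f x)⁻¹) S :=
  ContMDiffOn.inv hf

variable (G) in
/-- The group `Aut(G)` of automorphisms of the Lie group `G`. -/
def smoothAut : Subgroup (MulAut G) where
  carrier := {φ | Smooth (M := G.toMfd) (N := G.toMfd) φ ∧
    Smooth (M := G.toMfd) (N := G.toMfd) φ.symm}
  mul_mem' ha hb := ⟨ha.1.comp hb.1, hb.2.comp ha.2⟩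
  one_mem' := ⟨contMDiff_id, contMDiff_id⟩
  inv_mem' ha := ⟨ha.2, ha.1⟩

variable (G) in
/-- The adjoint map `G → Aut(G)`, which sends `g` to the conjugation `x ↦ g x g⁻¹`. -/
def Ad : G →* smoothAut G :=
  MulAut.conj.codRestrict (smoothAut G) fun g => by
    refine ⟨?_, ?_⟩
    · exact (contMDiff_const.mul contMDiff_id).mul contMDiff_const
    · exact (contMDiff_const.mul contMDiff_id).mul contMDiff_const

/-- A structure of Lie group on `Aut(G)`, that is, a Lie group `A` identified with the group
`Aut(G)`, for which the adjoint map `G → Aut(G)` and the action of `Aut(G)` on `G` are smooth: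
this says that `G → Aut(G)` is a crossed module of Lie groups. -/
structure AutLieGroup (G : LieGrp.{u}) where
  A : LieGrp.{u}
  equiv : A ≃* smoothAut G
  smooth_act : Smooth (M := A.toMfd.prod G.toMfd) (N := G.toMfd)
    (fun p : A × G => (equiv p.1 : MulAut G) p.2)
  smooth_Ad : Smooth (M := G.toMfd) (N := A.toMfd) (fun g => equiv.symm (Ad G g))

namespace AutLieGroup

variable (𝒜 : AutLieGroup G)

/-- The action of `Aut(G)` on `G`. -/
def act (a : 𝒜.A) (g : G) : G := (𝒜.equiv a : MulAut G) g

/-- The adjoint map `G → Aut(G)`. -/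
def ad (g : G) : 𝒜.A := 𝒜.equiv.symm (Ad G g)

theorem Ad_apply (g x : G) : (Ad G g : MulAut G) x = g * x * g⁻¹ := rfl

theorem act_one (a : 𝒜.A) : 𝒜.act a 1 = 1 := map_one _
theorem act_mul (a : 𝒜.A) (g h : G) : 𝒜.act a (g * h) = 𝒜.act a g * 𝒜.act a h := map_mul _ _ _
theorem act_inv (a : 𝒜.A) (g : G) : 𝒜.act a g⁻¹ = (𝒜.act a g)⁻¹ := map_inv _ _
theorem one_act (g : G) : 𝒜.act 1 g = g := by simp [act]
theorem mul_act (a b : 𝒜.A) (g : G) : 𝒜.act (a * b) g = 𝒜.act a (𝒜.act b g) := by simp [act]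
theorem inv_act_act (a : 𝒜.A) (g : G) : 𝒜.act a⁻¹ (𝒜.act a g) = g := by
  rw [← mul_act, inv_mul_cancel, one_act]
theorem act_inv_act (a : 𝒜.A) (g : G) : 𝒜.act a (𝒜.act a⁻¹ g) = g := by
  rw [← mul_act, mul_inv_cancel, one_act]
theorem ad_one : 𝒜.ad 1 = 1 := by simp [ad]
theorem ad_mul (g h : G) : 𝒜.ad (g * h) = 𝒜.ad g * 𝒜.ad h := by simp [ad]
theorem ad_inv (g : G) : 𝒜.ad g⁻¹ = (𝒜.ad g)⁻¹ := by simp [ad]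
theorem ad_act (a : 𝒜.A) (g : G) : 𝒜.ad (𝒜.act a g) = a * 𝒜.ad g * a⁻¹ := by
  apply 𝒜.equiv.injective
  apply Subtype.ext
  apply MulEquiv.ext
  intro x
  simp [ad, act, Ad_apply]

theorem smoothOn_act {M : Mfd.{u}} {f : M → 𝒜.A} {g : M → G} {S : Set M}
    (hf : SmoothOn (N := 𝒜.A.toMfd) f S) (hg : SmoothOn (N := G.toMfd) g S) :
    SmoothOn (N := G.toMfd) (fun x => 𝒜.act (f x) (g x)) S :=
  𝒜.smooth_act.comp_contMDiffOn (SmoothOn.pair hf hg)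

theorem smoothOn_ad {M : Mfd.{u}} {g : M → G} {S : Set M} (hg : SmoothOn (N := G.toMfd) g S) :
    SmoothOn (N := 𝒜.A.toMfd) (fun x => 𝒜.ad (g x)) S :=
  𝒜.smooth_Ad.comp_contMDiffOn hg

end AutLieGroup

/-- A Lie group, seen as a Lie groupoid with one object. -/
def toGroupoid (G : LieGrp.{u}) : LieGroupoid point G.toMfd where
  src _ := default
  tgt _ := default
  unit _ := (1 : G)
  mul a b := (a * b : G)
  inv a := (a⁻¹ : G)
  src_submersion := ⟨fun _ => ⟨(1 : G), Subsingleton.elim _ _⟩, submersion_point _⟩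
  tgt_submersion := ⟨fun _ => ⟨(1 : G), Subsingleton.elim _ _⟩, submersion_point _⟩
  unit_smooth := contMDiff_const
  inv_smooth := contMDiff_inv _ _
  mul_smooth := smoothOn_mul smoothOn_fst smoothOn_snd
  src_unit _ := Subsingleton.elim _ _
  tgt_unit _ := Subsingleton.elim _ _
  src_mul _ _ _ := rfl
  tgt_mul _ _ _ := rfl
  mul_assoc _ _ _ _ _ := _root_.mul_assoc _ _ _
  unit_mul _ := one_mul _
  mul_unit _ := mul_one _
  src_inv _ := rfl
  tgt_inv _ := rfl
  inv_mul _ := inv_mul_cancel _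
  mul_inv _ := mul_inv_cancel _

namespace AutLieGroup

variable (𝒜 : AutLieGroup G)

/-- The vertical composition of the 2-group `[G → Aut(G)]`: `(g, φ)` is a 2-arrow from `φ` to
`Ad_g ∘ φ`. -/
def verGroupoid : LieGroupoid 𝒜.A.toMfd (G.toMfd.prod 𝒜.A.toMfd) where
  src := fun p : G × 𝒜.A => p.2
  tgt := fun p : G × 𝒜.A => 𝒜.ad p.1 * p.2
  unit a := ((1, a) : G × 𝒜.A)
  mul := fun p q : G × 𝒜.A => ((p.1 * q.1, q.2) : G × 𝒜.A)
  inv := fun p : G × 𝒜.A => ((p.1⁻¹, 𝒜.ad p.1 * p.2) : G × 𝒜.A)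
  src_submersion := ⟨fun a => ⟨((1, a) : G × 𝒜.A), rfl⟩, submersion_snd⟩
  tgt_submersion := ⟨fun a => ⟨((1, a) : G × 𝒜.A), by simp [ad_one]⟩, by
    have h : Smooth (M := G.toMfd.prod 𝒜.A.toMfd) (N := G.toMfd.prod 𝒜.A.toMfd)
        (fun p : G × 𝒜.A => ((p.1⁻¹, 𝒜.ad p.1 * p.2) : G × 𝒜.A)) :=
      contMDiffOn_univ.1 (SmoothOn.pair (smoothOn_inv smoothOn_fst)
        (smoothOn_mul (𝒜.smoothOn_ad smoothOn_fst) smoothOn_snd))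
    exact submersion_comp_diffeo submersion_snd h h
      (fun x => Prod.ext (by simp) (by simp [ad_inv]))
      (fun x => Prod.ext (by simp) (by simp [ad_inv]))⟩
  unit_smooth := Smooth.pair contMDiff_const contMDiff_id
  inv_smooth := contMDiffOn_univ.1 (SmoothOn.pair (smoothOn_inv smoothOn_fst)
        (smoothOn_mul (𝒜.smoothOn_ad smoothOn_fst) smoothOn_snd))
  mul_smooth := SmoothOn.pair
    (smoothOn_mul (smooth_fst.comp_contMDiffOn smoothOn_fst)
      (smooth_fst.comp_contMDiffOn smoothOn_snd))
    (smooth_snd.comp_contMDiffOn smoothOn_snd)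
  src_unit _ := rfl
  tgt_unit a := by simp [ad_one]
  src_mul _ _ _ := rfl
  tgt_mul a b h := by
    change a.2 = 𝒜.ad b.1 * b.2 at h
    simp [ad_mul, h, _root_.mul_assoc]
  mul_assoc a b c _ _ := by simp [_root_.mul_assoc]; rfl
  unit_mul _ := by simp; rfl
  mul_unit _ := by simp; rfl
  src_inv _ := rfl
  tgt_inv _ := by simp [ad_inv]
  inv_mul _ := by simp; rfl
  mul_inv _ := by simp; rfl

/-- The horizontal composition of the 2-group `[G → Aut(G)]`: the semidirect product group
`G ⋊ Aut(G)`. -/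
def horGroupoid : LieGroupoid point (G.toMfd.prod 𝒜.A.toMfd) where
  src _ := default
  tgt _ := default
  unit _ := ((1, 1) : G × 𝒜.A)
  mul := fun p q : G × 𝒜.A => ((p.1 * 𝒜.act p.2 q.1, p.2 * q.2) : G × 𝒜.A)
  inv := fun p : G × 𝒜.A => ((𝒜.act p.2⁻¹ p.1⁻¹, p.2⁻¹) : G × 𝒜.A)
  src_submersion := ⟨fun _ => ⟨((1, 1) : G × 𝒜.A), Subsingleton.elim _ _⟩, submersion_point _⟩
  tgt_submersion := ⟨fun _ => ⟨((1, 1) : G × 𝒜.A), Subsingleton.elim _ _⟩, submersion_point _⟩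
  unit_smooth := contMDiff_const
  inv_smooth := contMDiffOn_univ.1 (SmoothOn.pair
    (𝒜.smoothOn_act (smoothOn_inv smoothOn_snd) (smoothOn_inv smoothOn_fst))
    (smoothOn_inv smoothOn_snd))
  mul_smooth := SmoothOn.pair
    (smoothOn_mul (smooth_fst.comp_contMDiffOn smoothOn_fst)
      (𝒜.smoothOn_act (smooth_snd.comp_contMDiffOn smoothOn_fst)
        (smooth_fst.comp_contMDiffOn smoothOn_snd)))
    (smoothOn_mul (smooth_snd.comp_contMDiffOn smoothOn_fst)
      (smooth_snd.comp_contMDiffOn smoothOn_snd))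
  src_unit _ := Subsingleton.elim _ _
  tgt_unit _ := Subsingleton.elim _ _
  src_mul _ _ _ := rfl
  tgt_mul _ _ _ := rfl
  mul_assoc a b c _ _ := by simp [_root_.mul_assoc, act_mul, mul_act]; rfl
  unit_mul a := by simp [one_act]; rfl
  mul_unit a := by simp [act_one]; rfl
  src_inv _ := rfl
  tgt_inv _ := rfl
  inv_mul a := by simp [act_inv]; rfl
  mul_inv a := by simp [act_inv_act]; rfl

/-- The Lie 2-group `[G → Aut(G)]`. -/
def twoGroup : Lie2Groupoid.{u} where
  X₀ := point
  X₁ := 𝒜.A.toMfd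
  X₂ := G.toMfd.prod 𝒜.A.toMfd
  one := 𝒜.A.toGroupoid
  ver := 𝒜.verGroupoid
  hor := 𝒜.horGroupoid
  src_hom := ⟨contMDiff_id, smooth_snd, fun _ => rfl, fun _ => rfl, fun _ => rfl,
    fun _ _ _ => rfl⟩
  tgt_hom := ⟨contMDiff_id, 𝒜.verGroupoid.tgt_submersion.2.contMDiff, fun _ => rfl, fun _ => rfl,
    fun _ => by simp [verGroupoid, horGroupoid, toGroupoid, ad_one],
    fun a b _ => by
      simp [verGroupoid, horGroupoid, toGroupoid, ad_mul, ad_act, _root_.mul_assoc]⟩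
  unit_hom := ⟨contMDiff_id, 𝒜.verGroupoid.unit_smooth, fun _ => rfl, fun _ => rfl, fun _ => rfl,
    fun a b _ => by simp [verGroupoid, horGroupoid, toGroupoid, act_one]; rfl⟩
  interchange a b c d h h' _ := by
    change a.2 = 𝒜.ad b.1 * b.2 at h
    have e : ∀ x g, 𝒜.act (𝒜.ad x) g = x * g * x⁻¹ := fun x g => by simp [act, ad, Ad_apply]
    simp [verGroupoid, horGroupoid, h, mul_act, act_mul, e, _root_.mul_assoc]
    rfl

end AutLieGroup

end LieGrp

/-! ## Groupoid extensions -/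

namespace LieGroupoid

variable {M A : Mfd.{u}} {G : LieGrp.{u}}

/-- The trivial bundle of groups `M × G ⇉ M`. -/
def groupBundle (M : Mfd.{u}) (G : LieGrp.{u}) : LieGroupoid M (M.prod G.toMfd) where
  src := fun p : M × G => p.1
  tgt := fun p : M × G => p.1
  unit m := ((m, 1) : M × G)
  mul := fun p q : M × G => ((p.1, p.2 * q.2) : M × G)
  inv := fun p : M × G => ((p.1, p.2⁻¹) : M × G)
  src_submersion := ⟨fun m => ⟨((m, 1) : M × G), rfl⟩, submersion_comp_fst .id⟩
  tgt_submersion := ⟨fun m => ⟨((m, 1) : M × G), rfl⟩, submersion_comp_fst .id⟩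
  unit_smooth := Smooth.pair contMDiff_id contMDiff_const
  inv_smooth := contMDiffOn_univ.1
    (SmoothOn.pair smoothOn_fst (LieGrp.smoothOn_inv smoothOn_snd))
  mul_smooth := SmoothOn.pair (smooth_fst.comp_contMDiffOn smoothOn_fst)
    (LieGrp.smoothOn_mul (smooth_snd.comp_contMDiffOn smoothOn_fst)
      (smooth_snd.comp_contMDiffOn smoothOn_snd))
  src_unit _ := rfl
  tgt_unit _ := rfl
  src_mul _ _ h := h
  tgt_mul _ _ _ := rfl
  mul_assoc _ _ _ _ _ := Prod.ext rfl (_root_.mul_assoc _ _ _)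
  unit_mul _ := Prod.ext rfl (one_mul _)
  mul_unit _ := Prod.ext rfl (mul_one _)
  src_inv _ := rfl
  tgt_inv _ := rfl
  inv_mul _ := Prod.ext rfl (inv_mul_cancel _)
  mul_inv _ := Prod.ext rfl (mul_inv_cancel _)

section Semidirect

variable (X : LieGroupoid M A) (𝒜 : G.AutLieGroup) {f₀ : M → point.{u}} {ρ : A → 𝒜.A}

theorem IsHom.inv_act {X : LieGroupoid M A} {𝒜 : G.AutLieGroup} {ρ : A → 𝒜.A}
    (hρ : IsHom X 𝒜.A.toGroupoid f₀ ρ) (a : A) (g : G) : 𝒜.act (ρ (X.inv a))⁻¹ g = 𝒜.act (ρ a) g := by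
  have h1 : ρ (X.mul (X.inv a) a) = ρ (X.inv a) * ρ a := hρ.mul _ _ (X.src_inv a)
  rw [X.inv_mul, hρ.unit] at h1
  rw [eq_inv_of_mul_eq_one_left h1.symm, inv_inv]

/-- The semidirect product of a Lie groupoid `X` with `G`, where `X` acts on `G` through a
morphism `ρ : X → Aut(G)`. The arrow `(a, g)` stands for `a` preceded by the element `g` of the
group `G` at the source of `a`, and `a g a⁻¹ = ρ(a)(g)`. -/
def semidirect (hρ : IsHom X 𝒜.A.toGroupoid f₀ ρ) : LieGroupoid M (A.prod G.toMfd) where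
  src := fun p : A × G => X.src p.1
  tgt := fun p : A × G => X.tgt p.1
  unit m := ((X.unit m, 1) : A × G)
  mul := fun p q : A × G => ((X.mul p.1 q.1, 𝒜.act (ρ q.1)⁻¹ p.2 * q.2) : A × G)
  inv := fun p : A × G => ((X.inv p.1, 𝒜.act (ρ p.1) p.2⁻¹) : A × G)
  src_submersion := ⟨fun m => ⟨((X.unit m, 1) : A × G), X.src_unit m⟩,
    submersion_comp_fst X.src_submersion.2⟩
  tgt_submersion := ⟨fun m => ⟨((X.unit m, 1) : A × G), X.tgt_unit m⟩,
    submersion_comp_fst X.tgt_submersion.2⟩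
  unit_smooth := Smooth.pair X.unit_smooth contMDiff_const
  inv_smooth := contMDiffOn_univ.1
    (SmoothOn.pair (X.inv_smooth.comp_contMDiffOn smoothOn_fst)
      (𝒜.smoothOn_act (hρ.smooth₁.comp_contMDiffOn smoothOn_fst)
        (LieGrp.smoothOn_inv smoothOn_snd)))
  mul_smooth := by
    have h : SmoothOn (M := (A.prod G.toMfd).prod (A.prod G.toMfd)) (N := A.prod A)
        (fun p : (A × G) × (A × G) => ((p.1.1, p.2.1) : A × A))
        {p : (A × G) × (A × G) | X.src p.1.1 = X.tgt p.2.1} :=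
      SmoothOn.pair (smooth_fst.comp_contMDiffOn smoothOn_fst)
        (smooth_fst.comp_contMDiffOn smoothOn_snd)
    refine SmoothOn.pair (X.mul_smooth.comp h fun _ hp => hp) ?_
    exact LieGrp.smoothOn_mul
      (𝒜.smoothOn_act
        (LieGrp.smoothOn_inv (hρ.smooth₁.comp_contMDiffOn
          (smooth_fst.comp_contMDiffOn smoothOn_snd)))
        (smooth_snd.comp_contMDiffOn smoothOn_fst))
      (smooth_snd.comp_contMDiffOn smoothOn_snd)
  src_unit _ := X.src_unit _
  tgt_unit _ := X.tgt_unit _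
  src_mul _ _ h := X.src_mul _ _ h
  tgt_mul _ _ h := X.tgt_mul _ _ h
  mul_assoc a b c h h' := by
    refine Prod.ext (X.mul_assoc _ _ _ h h') ?_
    have e : ρ (X.mul b.1 c.1) = ρ b.1 * ρ c.1 := hρ.mul _ _ h'
    simp [e, 𝒜.act_mul, 𝒜.mul_act, _root_.mul_assoc]
  unit_mul a := Prod.ext (X.unit_mul _) (by simp [𝒜.act_one])
  mul_unit a := by
    have e : ρ (X.unit (X.src a.1)) = 1 := hρ.unit _
    exact Prod.ext (X.mul_unit _) (by simp [e, 𝒜.one_act])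
  src_inv _ := X.src_inv _
  tgt_inv _ := X.tgt_inv _
  inv_mul a := Prod.ext (X.inv_mul _) (by simp [𝒜.inv_act_act])
  mul_inv a := Prod.ext (X.mul_inv _) (by
    simp only [hρ.inv_act, ← 𝒜.act_mul]
    simp [𝒜.act_one])

end Semidirect

end LieGroupoid

/-- A Lie groupoid `G`-extension `1 → M × G → Γ̃ → Γ → 1` over the manifold `M`: a short exact
sequence of Lie groupoids over the identity of `M`. Here `tot` is `Γ̃` and `quo` is `Γ`. (The
kernel of a surjective submersion is embedded and manifolds are second countable, so `incl` is
automatically an embedding.) -/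
structure GExtension (G : LieGrp.{u}) (M : Mfd.{u}) where
  totArr : Mfd.{u}
  quoArr : Mfd.{u}
  tot : LieGroupoid M totArr
  quo : LieGroupoid M quoArr
  incl : M.prod G.toMfd → totArr
  proj : totArr → quoArr
  incl_hom : LieGroupoid.IsHom (LieGroupoid.groupBundle M G) tot id incl
  proj_hom : LieGroupoid.IsHom tot quo id proj
  incl_injective : Function.Injective incl
  proj_submersion : SurjSubmersion proj
  exact : ∀ x, (∃ m, proj x = quo.unit m) ↔ ∃ p, incl p = x

namespace GExtension

variable {G : LieGrp.{u}} {M N : Mfd.{u}}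

/-- Homomorphisms of Lie groupoid `G`-extensions: morphisms of Lie groupoids `Γ̃ → Δ̃` and `Γ → Δ`
over the same map of objects, compatible with the projections. -/
structure Hom (X : GExtension G M) (Y : GExtension G N) where
  f₀ : M → N
  tot : X.totArr → Y.totArr
  quo : X.quoArr → Y.quoArr
  tot_hom : LieGroupoid.IsHom X.tot Y.tot f₀ tot
  quo_hom : LieGroupoid.IsHom X.quo Y.quo f₀ quo
  comm : ∀ x, Y.proj (tot x) = quo (X.proj x)

/-- Morita morphisms of Lie groupoid `G`-extensions. -/
def Hom.IsMorita {X : GExtension G M} {Y : GExtension G N} (F : Hom X Y) : Prop :=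
  SurjSubmersion F.f₀ ∧ LieGroupoid.IsMorita X.quo Y.quo F.f₀ F.quo ∧
    LieGroupoid.IsMorita X.tot Y.tot F.f₀ F.tot

/-- Morita equivalence of Lie groupoid `G`-extensions: the equivalence relation generated by the
Morita morphisms. -/
def MoritaEquiv (X : GExtension G M) (Y : GExtension G N) : Prop :=
  Relation.EqvGen
    (fun X Y : Σ M : Mfd.{u}, GExtension G M => ∃ F : Hom X.2 Y.2, F.IsMorita) ⟨M, X⟩ ⟨N, Y⟩

end GExtension

/-! ## Principal `[G → Aut(G)]`-bundles -/

section Bundles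

variable {G : LieGrp.{u}} (𝒜 : G.AutLieGroup)

/-- A principal `[G → Aut(G)]`-bundle over a Lie groupoid `Γ`. -/
abbrev Bundle {M A : Mfd.{u}} (Γ : LieGroupoid M A) : Type (u + 1) :=
  Lie2Groupoid.GenMor (.ofGroupoid Γ) 𝒜.twoGroup

variable {𝒜}

/-- Morita equivalence of principal `[G → Aut(G)]`-bundles, for the fixed structure 2-group: the
bases are related by a Morita equivalence `E` for which the composite of `E` and `P` is equivalent
to the second bundle. -/
def Bundle.MoritaEquiv {M A M' A' : Mfd.{u}} {Γ : LieGroupoid M A} {Γ' : LieGroupoid M' A'}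
    (P : Bundle 𝒜 Γ) (P' : Bundle 𝒜 Γ') : Prop :=
  ∃ E : Lie2Groupoid.GenMor (.ofGroupoid Γ') (.ofGroupoid Γ),
    E.AllMorita ∧ Lie2Groupoid.GenMor.Equiv (E.comp P) P'

/-- A presentation of a bundle `P` over `Γ` by a diagram `Γ ← Δ → [G → Aut(G)]`, in which `φ` is a
Morita morphism. -/
structure Presentation {M A : Mfd.{u}} {Γ : LieGroupoid M A} (P : Bundle 𝒜 Γ) where
  Δ : Lie2Groupoid.{u}
  φ : Lie2Groupoid.Hom Δ (.ofGroupoid Γ)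
  isMorita : φ.IsMorita
  f : Lie2Groupoid.Hom Δ 𝒜.twoGroup
  equiv : Lie2Groupoid.GenMor.Equiv P (.span φ isMorita f)

variable {Δ : Lie2Groupoid.{u}} (f : Lie2Groupoid.Hom Δ 𝒜.twoGroup)

/-- The trivial `G`-extension `Δ₁ × G → Δ₁ ⇉ Δ₀` defined by a morphism `Δ → [G → Aut(G)]`, where
`Δ₁` acts on `G` through `Δ₁ → Aut(G)`. -/
def trivialExtension : GExtension G Δ.X₀ where
  totArr := Δ.X₁.prod G.toMfd
  quoArr := Δ.X₁
  tot := Δ.one.semidirect 𝒜 f.one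
  quo := Δ.one
  incl := fun p : Δ.X₀ × G => ((Δ.one.unit p.1, p.2) : Δ.X₁ × G)
  proj := fun p : Δ.X₁ × G => p.1
  incl_hom :=
    { smooth₀ := contMDiff_id
      smooth₁ := Smooth.pair (Δ.one.unit_smooth.comp smooth_fst) smooth_snd
      src := fun _ => Δ.one.src_unit _
      tgt := fun _ => Δ.one.tgt_unit _
      unit := fun _ => rfl
      mul := fun p q h => by
        change p.1 = q.1 at h
        have e : f.f₁ (Δ.one.unit q.1) = (1 : 𝒜.A) := f.one.unit q.1
        have e' := Δ.one.mul_unit (Δ.one.unit q.1)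
        rw [Δ.one.src_unit] at e'
        refine Prod.ext ?_ ?_
        · simp [LieGroupoid.semidirect, LieGroupoid.groupBundle, h, e']
        · simp [LieGroupoid.semidirect, LieGroupoid.groupBundle, e, 𝒜.one_act] }
  proj_hom := ⟨contMDiff_id, smooth_fst, fun _ => rfl, fun _ => rfl, fun _ => rfl,
    fun _ _ _ => rfl⟩
  incl_injective p q h := by
    have h1 : Δ.one.unit p.1 = Δ.one.unit q.1 := congrArg (fun x : Δ.X₁ × G => x.1) h
    have h2 : p.2 = q.2 := congrArg (fun x : Δ.X₁ × G => x.2) h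
    refine Prod.ext ?_ h2
    rw [← Δ.one.src_unit p.1, h1, Δ.one.src_unit]
  proj_submersion := ⟨fun a => ⟨((a, 1) : Δ.X₁ × G), rfl⟩, submersion_comp_fst .id⟩
  exact x := by
    constructor
    · rintro ⟨m, hm⟩
      exact ⟨((m, x.2) : Δ.X₀ × G), Prod.ext hm.symm rfl⟩
    · rintro ⟨p, rfl⟩
      exact ⟨p.1, rfl⟩

/-- A `G`-extension induced by a morphism `f : Δ → [G → Aut(G)]`: the quotient of the trivial
extension `Δ₁ × G → Δ₁ ⇉ Δ₀` by the bundle of groups `L = {l ∈ Δ₂ | l goes from a unit to a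
1-arrow j(l)}`, where `L` is mapped to `Δ₁` by `j` and to `G` by `f`: the classes in
`Δ₁ × G` are given by `(a j(l), g) ~ (a, f(l) g)`, and those in `Δ₁` by `a j(l) ~ a`. -/
structure InducedExtension where
  ext : GExtension G Δ.X₀
  quot : GExtension.Hom (trivialExtension f) ext
  base : ∀ m, quot.f₀ m = m
  incl : ∀ p, quot.tot ((trivialExtension f).incl p) = ext.incl p
  tot_submersion : SurjSubmersion quot.tot
  quo_submersion : SurjSubmersion quot.quo
  tot_fibre : ∀ (a a' : Δ.X₁) (g g' : G),
    quot.tot ((a, g) : Δ.X₁ × G) = quot.tot ((a', g') : Δ.X₁ × G) ↔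
      ∃ l : Δ.X₂, Δ.ver.src l = Δ.one.unit (Δ.one.src a') ∧ a = Δ.one.mul a' (Δ.ver.tgt l) ∧
        g' = (show G × 𝒜.A from f.f₂ l).1 * g
  quo_fibre : ∀ a a' : Δ.X₁, quot.quo a = quot.quo a' ↔
      ∃ l : Δ.X₂, Δ.ver.src l = Δ.one.unit (Δ.one.src a') ∧ a = Δ.one.mul a' (Δ.ver.tgt l)

end Bundles

end
end TwoBundle

/-! Analytic basis. A smooth map is a submersion exactly when a smooth local section passes through
every point of its domain (`surjSubmersion_iff`). Claims about submersions and diffeomorphisms thus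
become lifting problems, solved near one point. Charts are needed only to build fibre products, from
slice charts, and quotients by closed relations with local slices.

Part (a). Morita morphisms compose and are stable under fibre product, so a backward arrow that
follows a forward one can be moved in front of it; every zigzag is then equivalent to a span
(`exists_equiv_span`). Let `Γ ← Δ → [G → Aut(G)]` be a span. As `Γ` has only identity 2-arrows, two
1-arrows `a`, `b` of `Δ` with the same ends and the same image in `Γ` are joined by exactly one
2-arrow. By this uniqueness its `G`-component `trans a b` is compatible with both compositions.
Hence `Δ₁/j(L)` is the manifold of arrows of `Γ[Δ₀]`, onto which `Δ₁` submerses by hypothesis, and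
the Morita morphism to `Γ` comes for free. When the group element is moved from before the arrow to
after it, so that `(a, g)` is read as `f(a)(g)` followed by the label `a`, the relation on `Δ₁ × G`
becomes right multiplication by `trans`. Over a local section of `Δ₁ → H` the quotient is locally `H
× G`; the relation is closed, so the quotient is Hausdorff; and it is a congruence, so the groupoid
structure descends (`exists_inducedExtension`).

Part (b). Equivalence of zigzags is generated abstractly and has to be turned into geometric moves.
A zigzag from `X` to `Y` acts on refinements, that is, on spans `D ← E → X` with a Morita left leg:
forward arrows act by composition, backward arrows by fibre product. Equivalent zigzags act in the
same way up to two moves: pulling `E` back along a Morita morphism, and changing its right leg by a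
2-transformation (`Equiv.act`). The delicate point is that fibre products respect these moves
(`eqv_bwd`); it rests on the lifting of 2-transformations along Morita morphisms, possible after a
refinement (`exists_natTrans_lift`).

Each move induces a Morita morphism of induced extensions (`InducedExtension.exists_isMorita`): a
transformation twists the `G`-component, its multiplicativity makes the twist a homomorphism, and
its naturality matches the classes. Applied to the identity refinement of `Γ'`, the two bundles give
refinements linked by such moves. Each of these maps by a Morita morphism to the `Δ` of its
presentation, because the zigzag that relates the bases is made of Morita morphisms. -/

namespace TwoBundle

noncomputable section

open Mfd
open scoped Topology
open Filter

/-! ### Submersions and local sections -/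

namespace Mfd

variable {M N P K : Mfd.{u}}

/-- Smoothness at a point, within a set. -/
abbrev SmoothWithinAt (f : M → N) (S : Set M) (x : M) : Prop :=
  ContMDiffWithinAt 𝓘(ℝ, M.model) 𝓘(ℝ, N.model) ∞ f S x

/-- A smooth map on an open set whose differential at `v` is invertible restricts to a
diffeomorphism between open sets. -/
theorem exists_openPartialHomeomorph_contDiffOn {E : Type*} [NormedAddCommGroup E]
    [NormedSpace ℝ E] [CompleteSpace E] {Φ : E → E} {W : Set E} (hW : IsOpen W)
    (hΦ : ContDiffOn ℝ ∞ Φ W) {v : E} (hv : v ∈ W)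
    (hd : HasFDerivAt Φ (ContinuousLinearMap.id ℝ E) v) :
    ∃ θ : OpenPartialHomeomorph E E, v ∈ θ.source ∧ θ.source ⊆ W ∧ (∀ w, θ w = Φ w) ∧
      ContDiffOn ℝ ∞ θ θ.source ∧ ContDiffOn ℝ ∞ θ.symm θ.target := by
  have hat : ContDiffAt ℝ ∞ Φ v := hΦ.contDiffAt (hW.mem_nhds hv)
  let θ₀ := hat.toOpenPartialHomeomorph Φ (f' := ContinuousLinearEquiv.refl ℝ E) hd (by simp)
  -- The inverse function theorem gives a local inverse whose smoothness is only known at the image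
  -- of `v`. Restriction to the open set where the differential is invertible makes it smooth on the
  -- whole target.
  let I : Set (E →L[ℝ] E) := Set.range ((↑) : (E ≃L[ℝ] E) → E →L[ℝ] E)
  have hI : IsOpen I := ContinuousLinearEquiv.isOpen
  have hW' : IsOpen (W ∩ fderiv ℝ Φ ⁻¹' I) :=
    (hΦ.continuousOn_fderiv_of_isOpen hW (by simp)).isOpen_inter_preimage hW hI
  let θ := θ₀.restrOpen _ hW'
  have hsrc : θ.source = θ₀.source ∩ (W ∩ fderiv ℝ Φ ⁻¹' I) := θ₀.restrOpen_source _ hW'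
  have hcoe : ∀ w, θ w = Φ w := fun w => rfl
  have hsm : ContDiffOn ℝ ∞ θ θ.source := hΦ.mono (by rw [hsrc]; exact fun _ h => h.2.1)
  refine ⟨θ, ?_, by rw [hsrc]; exact fun _ h => h.2.1, hcoe, hsm, ?_⟩
  · rw [hsrc]
    refine ⟨hat.mem_toOpenPartialHomeomorph_source
      (f' := ContinuousLinearEquiv.refl ℝ E) hd (by simp), hv, ?_⟩
    rw [Set.mem_preimage, hd.fderiv]
    exact ⟨ContinuousLinearEquiv.refl ℝ E, rfl⟩
  · intro y hy
    have h1 := θ.map_target hy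
    rw [hsrc] at h1
    obtain ⟨e, he⟩ := h1.2.2
    have h2 : ContDiffAt ℝ ∞ Φ (θ.symm y) := hΦ.contDiffAt (hW.mem_nhds h1.2.1)
    refine (θ.contDiffAt_symm (f₀' := e) hy ?_ h2).contDiffWithinAt
    rw [he]
    exact (h2.differentiableAt (by simp)).hasFDerivAt

/-- The normal fibre dimension of a submersion `M → N`. -/
abbrev Compl (M N : Mfd.{u}) : Type :=
  Fin (Module.finrank ℝ M.model - Module.finrank ℝ N.model) → ℝ

/-- A smooth map with a smooth local section through `x` is a submersion at `x`. -/
theorem isSubmersionAtOfComplement_of_section {f : M → N} (hf : Smooth f) {x : M} {σ : N → M}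
    (hσ : SmoothWithinAt σ Set.univ (f x)) (hx : σ (f x) = x) (hfσ : ∀ᶠ y in 𝓝 (f x), f (σ y) = y) :
    Manifold.IsSubmersionAtOfComplement (Compl M N) 𝓘(ℝ, M.model) 𝓘(ℝ, N.model) ∞ f x := by
  let φ := chartAt M.model x
  let ψ := chartAt N.model (f x)
  let g : M.model → N.model := ψ ∘ f ∘ φ.symm
  let W : Set M.model := φ.target ∩ φ.symm ⁻¹' (f ⁻¹' ψ.source)
  have hWo : IsOpen W :=
    φ.symm.isOpen_inter_preimage (ψ.open_source.preimage hf.continuous)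
  have hgW : ContDiffOn ℝ ∞ g W := by
    rw [← contMDiffOn_iff_contDiffOn]
    refine (contMDiffOn_chart (x := f x)).comp
      (hf.comp_contMDiffOn ((contMDiffOn_chart_symm (x := x)).mono fun v hv => hv.1)) ?_
    exact fun v hv => hv.2
  let v₀ := φ x
  have hxφ : x ∈ φ.source := mem_chart_source _ x
  have hxψ : f x ∈ ψ.source := mem_chart_source _ (f x)
  have hv₀ : v₀ ∈ W := ⟨φ.map_source hxφ, by
    change f (φ.symm (φ x)) ∈ ψ.source
    rwa [φ.left_inv hxφ]⟩
  have hgd : HasFDerivAt g (fderiv ℝ g v₀) v₀ :=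
    ((hgW.contDiffAt (hWo.mem_nhds hv₀)).differentiableAt (by simp)).hasFDerivAt
  let s : N.model → M.model := φ ∘ σ ∘ ψ.symm
  have hs0 : s (ψ (f x)) = v₀ := by simp [s, v₀, ψ.left_inv hxψ, hx]
  have hsm : ContMDiffAt 𝓘(ℝ, N.model) 𝓘(ℝ, M.model) ∞ s (ψ (f x)) := by
    have h1 : ContMDiffAt 𝓘(ℝ, N.model) 𝓘(ℝ, N.model) ∞ ψ.symm (ψ (f x)) :=
      (contMDiffOn_chart_symm (x := f x)).contMDiffAt (ψ.open_target.mem_nhds (ψ.map_source hxψ))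
    have h2 : ContMDiffAt 𝓘(ℝ, N.model) 𝓘(ℝ, M.model) ∞ σ (ψ.symm (ψ (f x))) := by
      rw [ψ.left_inv hxψ]; exact hσ
    have h3 : ContMDiffAt 𝓘(ℝ, M.model) 𝓘(ℝ, M.model) ∞ φ (σ (ψ.symm (ψ (f x)))) := by
      rw [ψ.left_inv hxψ, hx]
      exact (contMDiffOn_chart (x := x)).contMDiffAt (φ.open_source.mem_nhds hxφ)
    exact h3.comp (ψ (f x)) (h2.comp _ h1)
  have hsd : HasFDerivAt s (fderiv ℝ s (ψ (f x))) (ψ (f x)) :=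
    ((contMDiffAt_iff_contDiffAt.1 hsm).differentiableAt (by simp)).hasFDerivAt
  have hgs : g ∘ s =ᶠ[𝓝 (ψ (f x))] id := by
    have h1 : Tendsto ψ.symm (𝓝 (ψ (f x))) (𝓝 (f x)) := by
      have := ψ.continuousAt_symm (ψ.map_source hxψ)
      rwa [ContinuousAt, ψ.left_inv hxψ] at this
    have h2 : ∀ᶠ y in 𝓝 (f x), σ y ∈ φ.source := by
      have hc : ContinuousAt σ (f x) := ContMDiffAt.continuousAt hσ
      refine hc.eventually_mem (φ.open_source.mem_nhds ?_)
      rwa [hx]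
    filter_upwards [h1.eventually hfσ, h1.eventually h2,
      ψ.open_target.mem_nhds (ψ.map_source hxψ)] with y h3 h4 h5
    simp only [g, s, Function.comp_apply, id]
    rw [φ.left_inv h4, h3, ψ.right_inv h5]
  -- Chain rule for `g ∘ s = id` near `ψ (f x)`: the differential of the section splits that of `g`.
  have hinv : Function.RightInverse (fderiv ℝ s (ψ (f x))) (fderiv ℝ g v₀) := by
    have h1 : HasFDerivAt (g ∘ s) ((fderiv ℝ g v₀).comp (fderiv ℝ s (ψ (f x)))) (ψ (f x)) := by
      refine HasFDerivAt.comp _ ?_ hsd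
      rwa [hs0]
    have h2 := h1.unique ((hasFDerivAt_id (𝕜 := ℝ) (ψ (f x))).congr_of_eventuallyEq hgs)
    intro w
    exact DFunLike.congr_fun h2 w
  let L := fderiv ℝ g v₀
  have hsurj : Function.Surjective L := hinv.surjective
  have hker : Module.finrank ℝ L.ker = Module.finrank ℝ (Compl M N) := by
    have h1 := LinearMap.finrank_range_add_finrank_ker (L : M.model →ₗ[ℝ] N.model)
    rw [LinearMap.range_eq_top.2 hsurj, finrank_top] at h1
    rw [Module.finrank_fin_fun]
    change _ + Module.finrank ℝ L.ker = _ at h1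
    omega
  -- By rank-nullity the kernel is isomorphic to `Compl M N`, a complement that depends on the
  -- dimensions alone and so serves at all points.
  let T : M.model ≃L[ℝ] N.model × Compl M N :=
    (ContinuousLinearEquiv.equivOfRightInverse L _ hinv).trans
      ((ContinuousLinearEquiv.refl ℝ _).prodCongr (ContinuousLinearEquiv.ofFinrankEq hker))
  have hT : ∀ w, (T w).1 = L w := fun w => rfl
  -- `Φ` replaces the linear coordinate `L v` by `g v` and keeps the kernel coordinate. Its
  -- differential at `v₀` is the identity, and in the coordinates `T ∘ Φ` the map `g` is the first
  -- projection.
  let Φ : M.model → M.model := fun v => T.symm (g v, (T v).2)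
  have hΦ : ContDiffOn ℝ ∞ Φ W := by
    have : ContDiff ℝ ∞ (fun v => (T v).2) := contDiff_snd.comp T.contDiff
    exact T.symm.contDiff.comp_contDiffOn (hgW.prodMk this.contDiffOn)
  have hΦd : HasFDerivAt Φ (ContinuousLinearMap.id ℝ M.model) v₀ := by
    have h1 : HasFDerivAt (fun v => (T v).2)
        ((ContinuousLinearMap.snd ℝ N.model (Compl M N)).comp
          (T : M.model →L[ℝ] N.model × Compl M N)) v₀ :=
      (ContinuousLinearMap.snd ℝ N.model (Compl M N)).hasFDerivAt.comp v₀ T.hasFDerivAt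
    have h2 := (T.symm.hasFDerivAt (x := (g v₀, (T v₀).2))).comp v₀ (hgd.prodMk h1)
    refine HasFDerivAt.congr_fderiv h2 (ContinuousLinearMap.ext fun w => ?_)
    apply T.injective
    change T (T.symm (L w, (T w).2)) = T w
    rw [T.apply_symm_apply]
    rfl
  obtain ⟨θ, h1, h2, h3, h4, h5⟩ := exists_openPartialHomeomorph_contDiffOn hWo hΦ hv₀ hΦd
  refine Manifold.IsSubmersionAtOfComplement.mk_of_continuousAt hf.continuous.continuousAt T
    (φ.trans θ) ψ (by simpa using ⟨hxφ, h1⟩) hxψ ?_ (IsManifold.chart_mem_maximalAtlas _) ?_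
  · rw [IsManifold.mem_maximalAtlas_iff_contMDiffOn]
    constructor
    · rw [OpenPartialHomeomorph.coe_trans, φ.trans_source]
      exact (contMDiffOn_iff_contDiffOn.2 h4).comp
        ((contMDiffOn_chart (x := x)).mono Set.inter_subset_left) fun v hv => hv.2
    · rw [OpenPartialHomeomorph.coe_trans_symm, φ.trans_target]
      exact (contMDiffOn_chart_symm (x := x)).comp
        ((contMDiffOn_iff_contDiffOn.2 h5).mono Set.inter_subset_left) fun v hv => hv.2
  · intro y hy
    have hy' : y ∈ θ.target := by
      have : y ∈ (φ.trans θ).target := by simpa using hy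
      rw [φ.trans_target] at this
      exact this.1
    have e1 : Φ (θ.symm y) = y := by rw [← h3, θ.right_inv hy']
    have e2 : (T y).1 = g (θ.symm y) := by
      conv_lhs => rw [← e1]
      simp [Φ]
    simp only [Function.comp_apply]
    rw [e2]
    simp [g]


/-- In adapted charts `f` is a projection. The section freezes the complementary coordinate at its
value at `x` and lets the other one vary. -/
theorem exists_section_of_isSubmersionAt {f : M → N} {x : M} {F : Type*} [NormedAddCommGroup F]
    [NormedSpace ℝ F]
    (hf : Manifold.IsSubmersionAtOfComplement F 𝓘(ℝ, M.model) 𝓘(ℝ, N.model) ∞ f x) :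
    ∃ σ : N → M, σ (f x) = x ∧
      ∀ᶠ y in 𝓝 (f x), SmoothWithinAt σ Set.univ y ∧ f (σ y) = y := by
  let D := hf.domChart
  let C := hf.codChart
  let e := hf.equiv
  have hw : ∀ v ∈ D.target, C (f (D.symm v)) = (e v).1 := fun v hv =>
    hf.writtenInCharts (by simpa using hv)
  have hxD : x ∈ D.source := hf.mem_domChart_source
  have hxC : f x ∈ C.source := hf.mem_codChart_source
  let q : N → M.model := fun y => e.symm (C y, (e (D x)).2)
  have hq0 : q (f x) = D x := by
    have := hw (D x) (D.map_source hxD)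
    rw [D.left_inv hxD] at this
    simp only [q, this]
    exact e.symm_apply_apply _
  have hqs : ContMDiffOn 𝓘(ℝ, N.model) 𝓘(ℝ, M.model) ∞ q C.source := by
    have h1 : ContMDiffOn 𝓘(ℝ, N.model) 𝓘(ℝ, N.model) ∞ C C.source :=
      contMDiffOn_of_mem_maximalAtlas hf.codChart_mem_maximalAtlas
    have h2 : ContDiff ℝ ∞ (fun w : N.model => e.symm (w, (e (D x)).2)) :=
      e.symm.contDiff.comp (contDiff_id.prodMk contDiff_const)
    exact (contMDiff_iff_contDiff.2 h2).comp_contMDiffOn h1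
  have hO : IsOpen (C.source ∩ q ⁻¹' D.target) :=
    hqs.continuousOn.isOpen_inter_preimage C.open_source D.open_target
  refine ⟨fun y => D.symm (q y), by simp only [hq0, D.left_inv hxD], ?_⟩
  have hmem : f x ∈ C.source ∩ q ⁻¹' D.target :=
    ⟨hxC, by rw [Set.mem_preimage, hq0]; exact D.map_source hxD⟩
  filter_upwards [hO.mem_nhds hmem] with y hy
  constructor
  · have h1 : ContMDiffOn 𝓘(ℝ, N.model) 𝓘(ℝ, M.model) ∞ (fun y => D.symm (q y))
        (C.source ∩ q ⁻¹' D.target) :=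
      (contMDiffOn_symm_of_mem_maximalAtlas hf.domChart_mem_maximalAtlas).comp
        (hqs.mono Set.inter_subset_left) fun y hy => hy.2
    exact (h1.contMDiffAt (hO.mem_nhds hy)).contMDiffWithinAt
  · have h1 : f (D.symm (q y)) ∈ C.source :=
      hf.source_subset_preimage_source (D.map_target hy.2)
    refine C.injOn h1 hy.1 ?_
    rw [hw _ hy.2]
    simp [q]

/-- `f` maps `M` onto `S`, and has smooth local sections, defined on `S`, through every point. -/
structure SubmOnto (f : M → N) (S : Set N) : Prop where
  smooth : Smooth f
  mem : ∀ x, f x ∈ S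
  surj : ∀ y ∈ S, ∃ x, f x = y
  sec : ∀ x, ∃ σ : N → M, σ (f x) = x ∧ ∀ᶠ y in 𝓝[S] f x, SmoothWithinAt σ S y ∧ f (σ y) = y

/-- This replaces charts by local sections in every later check that a map is a submersion. -/
theorem surjSubmersion_iff {f : M → N} : SurjSubmersion f ↔ SubmOnto f Set.univ := by
  constructor
  · rintro ⟨h1, h2⟩
    refine ⟨h2.contMDiff, fun _ => trivial, fun y _ => h1 y, fun x => ?_⟩
    rw [nhdsWithin_univ]
    exact exists_section_of_isSubmersionAt (h2.isSubmersionOfComplement_complement x)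
  · intro h
    refine ⟨fun y => h.surj y trivial,
      Manifold.IsSubmersionOfComplement.isSubmersion (F := Compl M N) fun x => ?_⟩
    obtain ⟨σ, h1, h2⟩ := h.sec x
    rw [nhdsWithin_univ] at h2
    exact isSubmersionAtOfComplement_of_section h.smooth h2.self_of_nhds.1 h1
      (h2.mono fun y hy => hy.2)

/-- Going through local sections replaces the complement chosen in the definition by one that
depends on the dimensions only, so that all slice charts of a fibre product share one model space.
-/
theorem SurjSubmersion.isSubmersionAtOfComplement {f : M → N} (hf : SurjSubmersion f) (x : M) :
    Manifold.IsSubmersionAtOfComplement (Compl M N) 𝓘(ℝ, M.model) 𝓘(ℝ, N.model) ∞ f x := by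
  obtain ⟨σ, h1, h2⟩ := (surjSubmersion_iff.1 hf).sec x
  rw [nhdsWithin_univ] at h2
  exact isSubmersionAtOfComplement_of_section hf.2.contMDiff h2.self_of_nhds.1 h1
    (h2.mono fun y hy => hy.2)

section Within
variable {S : Set K} {k : K}

theorem SmoothWithinAt.comp_of_eventually {g : M → N} {T : Set M} {h : K → M}
    (hg : SmoothWithinAt g T (h k)) (hh : SmoothWithinAt h S k) (hm : ∀ᶠ x in 𝓝[S] k, h x ∈ T) :
    SmoothWithinAt (fun x => g (h x)) S k :=
  (ContMDiffWithinAt.comp' k hg hh).mono_of_mem_nhdsWithin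
    (inter_mem self_mem_nhdsWithin hm)

theorem Smooth.comp_within {g : M → N} {h : K → M} (hg : Smooth g) (hh : SmoothWithinAt h S k) :
    SmoothWithinAt (fun x => g (h x)) S k :=
  ContMDiffAt.comp_contMDiffWithinAt k hg.contMDiffAt hh

theorem Smooth.within {g : K → N} (hg : Smooth g) : SmoothWithinAt g S k :=
  hg.contMDiffAt.contMDiffWithinAt

theorem SmoothWithinAt.pair {f : K → M} {g : K → N} (hf : SmoothWithinAt f S k)
    (hg : SmoothWithinAt g S k) : SmoothWithinAt (N := M.prod N) (fun x => (f x, g x)) S k := by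
  have h := ContMDiffWithinAt.prodMk hf hg
  rw [← modelWithCornersSelf_prod] at h
  exact h

theorem SmoothWithinAt.congr_of_eventually {f g : K → N} (hf : SmoothWithinAt f S k)
    (h : ∀ᶠ x in 𝓝[S] k, g x = f x) (hk : k ∈ S) : SmoothWithinAt g S k :=
  ContMDiffWithinAt.congr_of_eventuallyEq hf h (h.self_of_nhdsWithin hk)

theorem SmoothWithinAt.tendsto {f : K → N} (hf : SmoothWithinAt f S k) {T : Set N}
    (h : ∀ᶠ x in 𝓝[S] k, f x ∈ T) : Tendsto f (𝓝[S] k) (𝓝[T] (f k)) :=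
  tendsto_nhdsWithin_iff.2 ⟨ContMDiffWithinAt.continuousWithinAt hf, h⟩

/-- Lifting along a map with local sections. -/
theorem SubmOnto.lift {f : M → N} {T : Set N} (hf : SubmOnto f T) {h : K → N} (hk : k ∈ S)
    (hh : ∀ᶠ x in 𝓝[S] k, SmoothWithinAt h S x) (hm : ∀ᶠ x in 𝓝[S] k, h x ∈ T)
    (m : M) (hmk : f m = h k) :
    ∃ l : K → M, l k = m ∧ (∀ᶠ x in 𝓝[S] k, SmoothWithinAt l S x) ∧
      ∀ᶠ x in 𝓝[S] k, f (l x) = h x := by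
  obtain ⟨σ, h1, h2⟩ := hf.sec m
  rw [hmk] at h1 h2
  have ht := SmoothWithinAt.tendsto (hh.self_of_nhdsWithin hk) hm
  refine ⟨fun x => σ (h x), h1, ?_, (ht.eventually h2).mono fun x hx => hx.2⟩
  filter_upwards [hh, eventually_eventually_nhdsWithin.2 hm, ht.eventually h2] with x h3 h4 h5
  exact h5.1.comp_of_eventually h3 h4

end Within

/-- By injectivity the inverse agrees with a smooth local section near each point of `S`. The
condition `hne` is there because `DiffeoOnto` asks for an inverse defined on all of `N`, which
cannot exist if only `M` is empty. -/
theorem SubmOnto.diffeoOnto {f : M → N} {S : Set N} (hf : SubmOnto f S)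
    (hi : Function.Injective f) (hne : Nonempty N → Nonempty M) : DiffeoOnto f S := by
  classical
  refine ⟨hf.smooth, hf.mem, ?_⟩
  by_cases hN : Nonempty N
  · have := hne hN
    refine ⟨Function.invFun f, fun y hy => ?_, Function.leftInverse_invFun hi, fun y hy =>
      Function.invFun_eq (hf.surj y hy)⟩
    obtain ⟨x, rfl⟩ := hf.surj y hy
    obtain ⟨σ, -, h2⟩ := hf.sec x
    refine SmoothWithinAt.congr_of_eventually (h2.self_of_nhdsWithin hy).1 (h2.mono fun z hz => ?_)
      hy
    rw [← hz.2, Function.leftInverse_invFun hi, hz.2]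
  · exact ⟨fun y => (hN ⟨y⟩).elim, fun y => (hN ⟨y⟩).elim, fun x => (hN ⟨f x⟩).elim,
      fun y => (hN ⟨y⟩).elim⟩

theorem DiffeoOnto.injective {f : M → N} {S : Set N} (hf : DiffeoOnto f S) :
    Function.Injective f := by
  obtain ⟨h1, h2, g, h3, h4, h5⟩ := hf
  exact Function.LeftInverse.injective h4

/-- The inverse of a diffeomorphism onto a submanifold. -/
def DiffeoOnto.inv {f : M → N} {S : Set N} (hf : DiffeoOnto f S) : N → M :=
  hf.2.2.choose

section
variable {f : M → N} {S : Set N} (hf : DiffeoOnto f S)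

theorem DiffeoOnto.inv_smoothOn : SmoothOn hf.inv S := hf.2.2.choose_spec.1
theorem DiffeoOnto.inv_apply (x : M) : hf.inv (f x) = x := hf.2.2.choose_spec.2.1 x
theorem DiffeoOnto.apply_inv {y : N} (hy : y ∈ S) : f (hf.inv y) = y :=
  hf.2.2.choose_spec.2.2 y hy

end

theorem SurjSubmersionOnto.submOnto {f : M → N} {S : Set N} (hf : SurjSubmersionOnto f S) :
    SubmOnto f S := by
  obtain ⟨P, ι, q, hι, hq, h⟩ := hf
  obtain rfl : (fun x => ι (q x)) = f := funext h
  rw [surjSubmersion_iff] at hq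
  refine ⟨hι.1.comp hq.smooth, fun x => hι.2.1 _, fun y hy => ?_, fun x => ?_⟩
  · obtain ⟨x, hx⟩ := hq.surj (hι.inv y) trivial
    exact ⟨x, by rw [hx, hι.apply_inv hy]⟩
  · obtain ⟨l, h1, h2, h3⟩ := hq.lift (K := N) (S := S) (k := ι (q x)) (h := hι.inv) (hι.2.1 _)
      (eventually_mem_nhdsWithin.mono fun y hy => hι.inv_smoothOn y hy)
      (Eventually.of_forall fun _ => trivial) x (hι.inv_apply _).symm
    refine ⟨l, h1, ?_⟩
    filter_upwards [h2, h3, eventually_mem_nhdsWithin] with y h4 h5 h6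
    exact ⟨h4, by rw [h5, hι.apply_inv h6]⟩

/-- Local sections do not by themselves make `S` a manifold, whence the separate parametrization
`ι`. Sections of the induced map are lifts of `ι`. -/
theorem SubmOnto.surjSubmersionOnto {f : M → N} {S : Set N} (hf : SubmOnto f S) {ι : P → N}
    (hι : DiffeoOnto ι S) : SurjSubmersionOnto f S := by
  refine ⟨P, ι, fun x => hι.inv (f x), hι, surjSubmersion_iff.2 ⟨fun x => ?_, fun _ => trivial,
    fun y _ => ?_, fun x => ?_⟩, fun x => hι.apply_inv (hf.mem x)⟩
  · exact SmoothWithinAt.comp_of_eventually (hι.inv_smoothOn _ (hf.mem x)) (hf.smooth x)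
      (Eventually.of_forall hf.mem)
  · obtain ⟨x, hx⟩ := hf.surj (ι y) (hι.2.1 y)
    exact ⟨x, by rw [hx, hι.inv_apply]⟩
  · obtain ⟨l, h1, h2, h3⟩ := hf.lift (K := P) (S := Set.univ) (k := hι.inv (f x)) (h := ι) trivial
      (Eventually.of_forall fun y => Smooth.within hι.1)
      (Eventually.of_forall fun y => hι.2.1 y) x (hι.apply_inv (hf.mem x)).symm
    refine ⟨l, h1, ?_⟩
    filter_upwards [h2, h3] with y h4 h5
    exact ⟨h4, by rw [h5, hι.inv_apply]⟩

end Mfd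

/-! ### Manifolds from charts, and embedded submanifolds -/

namespace Mfd

/-- The smooth manifold defined by a family of smoothly compatible charts. -/
def ofCharts (Q : Type u) [TopologicalSpace Q] [T2Space Q] [SecondCountableTopology Q] (E : Type)
    [NormedAddCommGroup E] [NormedSpace ℝ E] [FiniteDimensional ℝ E]
    (e : Q → OpenPartialHomeomorph Q E) (he : ∀ x, x ∈ (e x).source)
    (hc : ∀ x y, ContDiffOn ℝ ∞ (fun v => e y ((e x).symm v)) ((e x).symm.trans (e y)).source) :
    Mfd.{u} :=
  letI : ChartedSpace E Q :=
    { atlas := Set.range e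
      chartAt := e
      mem_chart_source := he
      chart_mem_atlas := fun x => ⟨x, rfl⟩ }
  haveI : IsManifold 𝓘(ℝ, E) ∞ Q := by
    refine isManifold_of_contDiffOn 𝓘(ℝ, E) ∞ Q ?_
    rintro _ _ ⟨x, rfl⟩ ⟨y, rfl⟩
    simpa [Function.comp_def] using hc x y
  { carrier := Q
    model := E }

section Charts

variable {Q : Type u} [TopologicalSpace Q] [T2Space Q] [SecondCountableTopology Q] {E : Type}
  [NormedAddCommGroup E] [NormedSpace ℝ E] [FiniteDimensional ℝ E]
  (e : Q → OpenPartialHomeomorph Q E) (he : ∀ x, x ∈ (e x).source)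
  (hc : ∀ x y, ContDiffOn ℝ ∞ (fun v => e y ((e x).symm v)) ((e x).symm.trans (e y)).source)

theorem ofCharts_smoothOn (x : Q) :
    ContMDiffOn (M := (ofCharts Q E e he hc).carrier) 𝓘(ℝ, (ofCharts Q E e he hc).model) 𝓘(ℝ, E) ∞
      (e x) (e x).source :=
  contMDiffOn_chart (M := (ofCharts Q E e he hc).carrier)
    (I := 𝓘(ℝ, (ofCharts Q E e he hc).model)) (x := x)

theorem ofCharts_symm_smoothOn (x : Q) :
    ContMDiffOn (M' := (ofCharts Q E e he hc).carrier) 𝓘(ℝ, E) 𝓘(ℝ, (ofCharts Q E e he hc).model) ∞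
      (e x).symm (e x).target :=
  contMDiffOn_chart_symm (M := (ofCharts Q E e he hc).carrier)
    (I := 𝓘(ℝ, (ofCharts Q E e he hc).model)) (x := x)

end Charts

section Slice

variable (K : Mfd.{u}) (S : Set K) (E : Type) [NormedAddCommGroup E] [NormedSpace ℝ E]

/-- A parametrization, by an open subset of `E`, of a relatively open part of `S`, whose inverse
extends smoothly to an open subset of the ambient manifold. -/
structure SliceChart where
  χ : K → E
  σ : E → K
  U : Set K
  V : Set E
  isOpen_U : IsOpen U
  isOpen_V : IsOpen V
  smooth_χ : ContMDiffOn 𝓘(ℝ, K.model) 𝓘(ℝ, E) ∞ χ U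
  smooth_σ : ContMDiffOn 𝓘(ℝ, E) 𝓘(ℝ, K.model) ∞ σ V
  σ_mem : ∀ v ∈ V, σ v ∈ S
  σ_mem_U : ∀ v ∈ V, σ v ∈ U
  χ_mem : ∀ x ∈ U, x ∈ S → χ x ∈ V
  χ_σ : ∀ v ∈ V, χ (σ v) = v
  σ_χ : ∀ x ∈ U, x ∈ S → σ (χ x) = x

variable {K S E}

open Classical in
/-- The chart of the subset `S` defined by a slice chart. -/
def SliceChart.toChart (c : SliceChart K S E) (x : S) : OpenPartialHomeomorph S E where
  toFun q := c.χ q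
  -- `x` is a default value outside the target.
  invFun v := if h : v ∈ c.V then ⟨c.σ v, c.σ_mem v h⟩ else x
  source := Subtype.val ⁻¹' c.U
  target := c.V
  map_source' q hq := c.χ_mem q hq q.2
  map_target' v hv := by simpa [hv] using c.σ_mem_U v hv
  left_inv' q hq := by
    have h1 := c.χ_mem q hq q.2
    simp only [h1, dite_true]
    exact Subtype.ext (c.σ_χ q hq q.2)
  right_inv' v hv := by simpa [hv] using c.χ_σ v hv
  open_source := c.isOpen_U.preimage continuous_subtype_val
  open_target := c.isOpen_V
  continuousOn_toFun := c.smooth_χ.continuousOn.comp continuous_subtype_val.continuousOn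
    fun _ h => h
  continuousOn_invFun := by
    rw [Topology.IsInducing.subtypeVal.continuousOn_iff]
    refine c.smooth_σ.continuousOn.congr fun v hv => ?_
    simp [hv]

theorem SliceChart.toChart_apply (c : SliceChart K S E) (x : S) (q : S) :
    c.toChart x q = c.χ q := rfl

open Classical in
theorem SliceChart.toChart_symm (c : SliceChart K S E) (x : S) {v : E} (hv : v ∈ c.V) :
    ((c.toChart x).symm v : K) = c.σ v := by
  change ((if h : v ∈ c.V then ⟨c.σ v, c.σ_mem v h⟩ else x : S) : K) = c.σ v
  simp [hv]

variable [FiniteDimensional ℝ E] (c : S → SliceChart K S E) (hc : ∀ x : S, (x : K) ∈ (c x).U)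

/-- An embedded submanifold, described by slice charts. -/
def sub : Mfd.{u} :=
  ofCharts S E (fun x => (c x).toChart x) hc fun x y => by
    rw [← contMDiffOn_iff_contDiffOn]
    refine ContMDiffOn.congr (f := fun v => (c y).χ ((c x).σ v)) ?_ ?_
    · refine (c y).smooth_χ.comp ((c x).smooth_σ.mono fun v hv => hv.1) ?_
      rintro v ⟨hv, hv'⟩
      have h : (((c x).toChart x).symm v : K) ∈ (c y).U := hv'
      rw [(c x).toChart_symm x hv] at h
      exact h
    · rintro v ⟨hv, hv'⟩
      rw [(c y).toChart_apply, (c x).toChart_symm x hv]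

theorem sub_val_smooth : Smooth (M := sub c hc) (N := K) Subtype.val := by
  intro x
  have h2 : ContMDiffOn 𝓘(ℝ, (sub c hc).model) 𝓘(ℝ, E) ∞ (fun q : sub c hc => (c x).χ q.1)
    (Subtype.val ⁻¹' (c x).U) := ofCharts_smoothOn _ hc _ x
  have h3 := (c x).smooth_σ.comp h2 fun q hq => (c x).χ_mem q.1 hq q.2
  refine (h3.congr fun q hq => ((c x).σ_χ q.1 hq q.2).symm).contMDiffAt ?_
  exact ((c x).isOpen_U.preimage continuous_subtype_val).mem_nhds (hc x)

/-- The coordinate map `χ` is smooth on an open subset of the ambient manifold, so the coordinate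
expression of `h` is a composite of smooth ambient maps. -/
theorem sub_smoothWithinAt {L : Mfd.{u}} {h : L → sub c hc} {T : Set L} {k : L}
    (hh : SmoothWithinAt (N := K) (fun x => (h x).1) T k) : SmoothWithinAt h T k := by
  have hcv : ContinuousWithinAt (fun x => (h x).1) T k := ContMDiffWithinAt.continuousWithinAt hh
  let x : S := h k
  have hx : (h k).1 ∈ (c x).U := hc x
  have h3 : ContMDiffWithinAt 𝓘(ℝ, L.model) 𝓘(ℝ, E) ∞ (fun q => (c x).χ (h q).1) T k :=
    ((c x).smooth_χ.contMDiffAt ((c x).isOpen_U.mem_nhds hx)).comp_contMDiffWithinAt k hh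
  let s : E → sub c hc := ((c x).toChart x).symm
  have hs : ContMDiffOn 𝓘(ℝ, E) 𝓘(ℝ, (sub c hc).model) ∞ s (c x).V :=
    ofCharts_symm_smoothOn (fun x => (c x).toChart x) hc _ x
  have h4 : SmoothWithinAt (fun q => s ((c x).χ (h q).1)) T k :=
    (hs.contMDiffAt ((c x).isOpen_V.mem_nhds
      ((c x).χ_mem _ hx (h k).2))).comp_contMDiffWithinAt k h3
  refine h4.congr_of_eventuallyEq ?_ ?_
  · filter_upwards [hcv.eventually_mem ((c x).isOpen_U.mem_nhds hx)] with q hq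
    exact (((c x).toChart x).left_inv hq).symm
  · exact (((c x).toChart x).left_inv hx).symm

end Slice

/-! ### Quotient manifolds -/

section Quotient

variable (K : Mfd.{u}) (r : Setoid K) (E : Type) [NormedAddCommGroup E] [NormedSpace ℝ E]

/-- A chart of the quotient `K / r`, defined on the image of a saturated open set `U`. -/
structure QuotientChart where
  χ : K → E
  σ : E → K
  U : Set K
  V : Set E
  isOpen_U : IsOpen U
  isOpen_V : IsOpen V
  smooth_χ : ContMDiffOn 𝓘(ℝ, K.model) 𝓘(ℝ, E) ∞ χ U
  smooth_σ : ContMDiffOn 𝓘(ℝ, E) 𝓘(ℝ, K.model) ∞ σ V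
  saturated : ∀ x y, r x y → x ∈ U → y ∈ U
  σ_mem : ∀ v ∈ V, σ v ∈ U
  χ_mem : ∀ x ∈ U, χ x ∈ V
  χ_σ : ∀ v ∈ V, χ (σ v) = v
  χ_const : ∀ x y, r x y → x ∈ U → χ x = χ y
  σ_χ : ∀ x ∈ U, r (σ (χ x)) x

variable {K r E} (c : K → QuotientChart K r E) (hU : ∀ x, x ∈ (c x).U)
  (hσ : ∀ x, (c x).σ ((c x).χ x) = x)

-- If `y` is related to a point `x` of the open set `W`, then `σ ∘ χ` maps `y` to `x`, is continuous
-- near `y`, and moves points within their classes. All points near `y` are therefore related to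
-- points of `W`: the saturation of `W` is open.
include hU hσ in
theorem isOpenQuotientMap_mk : IsOpenQuotientMap (Quotient.mk r) := by
  refine ⟨Quotient.mk_surjective, continuous_quot_mk, fun W hW => ?_⟩
  refine isQuotientMap_quot_mk.isOpen_preimage.1 (isOpen_iff_mem_nhds.2 fun y hy => ?_)
  obtain ⟨x, hx, hxy⟩ := hy
  have hr : r x y := Quotient.exact hxy
  have hy : y ∈ (c x).U := (c x).saturated x y hr (hU x)
  have h1 : ContinuousAt (fun z => (c x).σ ((c x).χ z)) y :=
    ((c x).smooth_σ.continuousOn.continuousAt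
      ((c x).isOpen_V.mem_nhds ((c x).χ_mem y hy))).comp
      ((c x).smooth_χ.continuousOn.continuousAt ((c x).isOpen_U.mem_nhds hy))
  have h2 : (c x).σ ((c x).χ y) = x := by rw [← (c x).χ_const x y hr (hU x), hσ]
  filter_upwards [h1.eventually_mem (hW.mem_nhds (by rwa [h2])), (c x).isOpen_U.mem_nhds hy]
    with z h3 h4
  exact ⟨_, h3, Quotient.sound ((c x).σ_χ z h4)⟩

theorem QuotientChart.rel_out (x : K) : r (Quotient.mk r x).out x :=
  Quotient.mk_out x

/-- The chart of the quotient `K / r` defined by a `QuotientChart`. -/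
def QuotientChart.toChart (d : QuotientChart K r E) (ho : IsOpenQuotientMap (Quotient.mk r)) :
    OpenPartialHomeomorph (Quotient r) E where
  -- The choice of representative is immaterial: `χ` is constant on the classes in `U`.
  toFun q := d.χ q.out
  invFun v := Quotient.mk r (d.σ v)
  source := Quotient.mk r '' d.U
  target := d.V
  map_source' := by
    rintro _ ⟨x, hx, rfl⟩
    exact d.χ_mem _ (d.saturated _ _ (r.symm (rel_out x)) hx)
  map_target' v hv := ⟨_, d.σ_mem v hv, rfl⟩
  left_inv' := by
    rintro _ ⟨x, hx, rfl⟩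
    refine Quotient.sound ?_
    rw [← d.χ_const _ _ (r.symm (rel_out x)) hx]
    exact d.σ_χ x hx
  right_inv' v hv := by
    rw [← d.χ_const _ _ (r.symm (rel_out (d.σ v))) (d.σ_mem v hv)]
    exact d.χ_σ v hv
  open_source := ho.isOpenMap _ d.isOpen_U
  open_target := d.isOpen_V
  continuousOn_toFun := by
    rintro _ ⟨x, hx, rfl⟩
    refine (ho.continuousAt_comp_iff.1 ?_).continuousWithinAt
    refine (d.smooth_χ.continuousOn.continuousAt (d.isOpen_U.mem_nhds hx)).congr ?_
    filter_upwards [d.isOpen_U.mem_nhds hx] with y hy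
    exact d.χ_const _ _ (r.symm (rel_out y)) hy
  continuousOn_invFun := ho.continuous.comp_continuousOn d.smooth_σ.continuousOn

theorem QuotientChart.toChart_mk (d : QuotientChart K r E)
    (ho : IsOpenQuotientMap (Quotient.mk r)) {x : K} (hx : x ∈ d.U) :
    d.toChart ho (Quotient.mk r x) = d.χ x :=
  (d.χ_const _ _ (r.symm (rel_out x)) hx).symm

include hU hσ in
/-- The quotient of a manifold by a closed equivalence relation with local slices is a manifold,
and the projection onto it is a surjective submersion. -/
theorem exists_quotient [FiniteDimensional ℝ E] (hr : IsClosed {q : K × K | r q.1 q.2}) :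
    ∃ (Q : Mfd.{u}) (π : K → Q), SurjSubmersion π ∧ ∀ x y, π x = π y ↔ r x y := by
  have ho := isOpenQuotientMap_mk c hU hσ
  -- For an open quotient map, a closed relation means a Hausdorff quotient.
  have h2 : T2Space (Quotient r) := by
    rw [t2Space_iff_of_isOpenQuotientMap ho]
    have h : {q : K × K | Quotient.mk r q.1 = Quotient.mk r q.2} = {q | r q.1 q.2} :=
      Set.ext fun q => ⟨fun h => Quotient.exact h, fun h => Quotient.sound h⟩
    rwa [h]
  have h3 : SecondCountableTopology (Quotient r) :=
    ho.isQuotientMap.secondCountableTopology ho.isOpenMap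
  let e : Quotient r → OpenPartialHomeomorph (Quotient r) E := fun q => (c q.out).toChart ho
  have he : ∀ q, q ∈ (e q).source := fun q => ⟨q.out, hU _, q.out_eq⟩
  have hsat : ∀ (d : QuotientChart K r E) (x : K), Quotient.mk r x ∈ Quotient.mk r '' d.U →
      x ∈ d.U := by
    rintro d x ⟨y, hy, hxy⟩
    exact d.saturated y x (Quotient.exact hxy) hy
  have hc : ∀ x y, ContDiffOn ℝ ∞ (fun v => e y ((e x).symm v)) ((e x).symm.trans (e y)).source := by
    intro x y
    rw [← contMDiffOn_iff_contDiffOn]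
    refine ContMDiffOn.congr (f := fun v => (c y.out).χ ((c x.out).σ v)) ?_ ?_
    · refine (c y.out).smooth_χ.comp ((c x.out).smooth_σ.mono fun v hv => hv.1) ?_
      rintro v ⟨hv, hv'⟩
      exact hsat _ _ hv'
    · rintro v ⟨hv, hv'⟩
      exact (c y.out).toChart_mk ho (hsat _ _ hv')
  let Q := ofCharts (Quotient r) E e he hc
  let π : K → Q := Quotient.mk r
  have hπ : Smooth π := by
    intro x
    have hx : x ∈ (c (π x).out).U := hsat _ _ (he (π x))
    let s : E → Q := (e (π x)).symm
    have hs : ContMDiffOn 𝓘(ℝ, E) 𝓘(ℝ, Q.model) ∞ s (c (π x).out).V :=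
      ofCharts_symm_smoothOn e he hc (π x)
    have h4 := hs.comp (c (π x).out).smooth_χ fun z hz => (c (π x).out).χ_mem z hz
    refine (h4.congr fun z hz => ?_).contMDiffAt ((c (π x).out).isOpen_U.mem_nhds hx)
    exact (Quotient.sound ((c (π x).out).σ_χ z hz)).symm
  refine ⟨Q, π, surjSubmersion_iff.2 ⟨hπ, fun _ => trivial, fun q _ => Quotient.mk_surjective q,
    fun x => ?_⟩, fun x y => ⟨fun h => Quotient.exact h, fun h => Quotient.sound h⟩⟩
  -- The chart at `π x` is built on the slice through the representative `y`, so it gives a section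
  -- through `y`. The retraction onto the slice through `x` then moves this section to one through
  -- `x`.
  let y : K := (π x).out
  have hyx : r y x := Quotient.mk_out x
  let a : Q → E := e (π x)
  let A : Set Q := Quotient.mk r '' (c y).U
  have hA : IsOpen A := ho.isOpenMap _ (c y).isOpen_U
  have ha : ContMDiffOn 𝓘(ℝ, Q.model) 𝓘(ℝ, E) ∞ a A := ofCharts_smoothOn e he hc (π x)
  have hx : π x ∈ A := ⟨y, hU y, Quotient.sound hyx⟩
  have ha0 : (c y).σ (a (π x)) = y := by
    have : a (π x) = (c y).χ x := (c y).toChart_mk ho ((c y).saturated _ _ hyx (hU y))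
    rw [this, ← (c y).χ_const y x hyx (hU y), hσ]
  have haV : ∀ q ∈ A, a q ∈ (c y).V := fun q hq => ((c y).toChart ho).map_source hq
  have hz : ContMDiffOn 𝓘(ℝ, Q.model) 𝓘(ℝ, K.model) ∞ (fun q => (c y).σ (a q)) A :=
    (c y).smooth_σ.comp ha haV
  have hyU : y ∈ (c x).U := (c x).saturated x y (r.symm hyx) (hU x)
  have hB : IsOpen (A ∩ (fun q => (c y).σ (a q)) ⁻¹' (c x).U) :=
    hz.continuousOn.isOpen_inter_preimage hA (c x).isOpen_U
  have hw : ContMDiffOn 𝓘(ℝ, Q.model) 𝓘(ℝ, K.model) ∞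
      (fun q => (c x).σ ((c x).χ ((c y).σ (a q)))) (A ∩ (fun q => (c y).σ (a q)) ⁻¹' (c x).U) :=
    (c x).smooth_σ.comp ((c x).smooth_χ.comp (hz.mono Set.inter_subset_left) fun q hq => hq.2)
      fun q hq => (c x).χ_mem _ hq.2
  refine ⟨fun q => (c x).σ ((c x).χ ((c y).σ (a q))), ?_, ?_⟩
  · change (c x).σ ((c x).χ ((c y).σ (a (π x)))) = x
    rw [ha0, (c x).χ_const y x hyx hyU, hσ]
  · rw [nhdsWithin_univ]
    filter_upwards [hB.mem_nhds ⟨hx, by rw [Set.mem_preimage, ha0]; exact hyU⟩] with q hq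
    refine ⟨(hw.contMDiffAt (hB.mem_nhds hq)).contMDiffWithinAt, ?_⟩
    have h5 : π ((c y).σ (a q)) = q := ((c y).toChart ho).left_inv hq.1
    have h6 : π ((c x).σ ((c x).χ ((c y).σ (a q)))) = π ((c y).σ (a q)) :=
      Quotient.sound ((c x).σ_χ _ hq.2)
    rw [h6, h5]

end Quotient

/-! ### Fibre products of manifolds -/

section FibreProduct

variable {M N B K : Mfd.{u}} (f : M → B) (g : N → B)

/-- The fibre product of two maps, as a subset of the product. -/
def fpSet : Set (M.prod N) := {p : M × N | f p.1 = g p.2}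

variable {f g}

/-- The slice charts of a fibre product along a submersion. -/
def fpChart (hf : Smooth f) (hg : SurjSubmersion g) (p : M × N) :
    SliceChart (M.prod N) (fpSet f g) (M.model × Compl N B) :=
  let φ := chartAt M.model p.1
  let hs := hg.isSubmersionAtOfComplement p.2
  let D := hs.domChart
  let C := hs.codChart
  let e := hs.equiv
  have hw : ∀ n ∈ D.source, C (g n) = (e (D n)).1 := fun n hn => by
    have h : C (g (D.symm (D n))) = (e (D n)).1 :=
      hs.writtenInCharts (by simpa using D.map_source hn)
    rwa [D.left_inv hn] at h
  have hDC : ∀ n ∈ D.source, g n ∈ C.source := fun n hn => hs.source_subset_preimage_source hn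
  have h1 : ContMDiffOn 𝓘(ℝ, M.model × Compl N B) 𝓘(ℝ, M.model) ∞
      (fun w : M.model × Compl N B => φ.symm w.1) (Prod.fst ⁻¹' φ.target) :=
    (contMDiffOn_chart_symm (x := p.1)).comp
      (contMDiff_iff_contDiff.2 contDiff_fst).contMDiffOn fun w hw => hw
  have hfo : IsOpen (Prod.fst ⁻¹' φ.target ∩
      (fun w : M.model × Compl N B => f (φ.symm w.1)) ⁻¹' C.source) :=
    (hf.continuous.comp_continuousOn h1.continuousOn).isOpen_inter_preimage
      (φ.open_target.preimage continuous_fst) C.open_source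
  have h2 : ContMDiffOn 𝓘(ℝ, M.model × Compl N B) 𝓘(ℝ, N.model) ∞
      (fun w : M.model × Compl N B => e.symm (C (f (φ.symm w.1)), w.2))
      (Prod.fst ⁻¹' φ.target ∩
        (fun w : M.model × Compl N B => f (φ.symm w.1)) ⁻¹' C.source) := by
    have h3 : ContMDiffOn 𝓘(ℝ, M.model × Compl N B) 𝓘(ℝ, B.model) ∞
        (fun w : M.model × Compl N B => C (f (φ.symm w.1))) (Prod.fst ⁻¹' φ.target ∩
        (fun w : M.model × Compl N B => f (φ.symm w.1)) ⁻¹' C.source) :=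
      (contMDiffOn_of_mem_maximalAtlas hs.codChart_mem_maximalAtlas).comp
        (hf.comp_contMDiffOn (h1.mono Set.inter_subset_left)) fun w hw => hw.2
    rw [contMDiffOn_iff_contDiffOn] at h3 ⊢
    exact e.symm.contDiff.comp_contDiffOn (h3.prodMk contDiff_snd.contDiffOn)
  -- The coordinates of `(m, n)` are those of `m` and the complementary part of those of `n`; the
  -- rest of `n` is forced, since in the adapted charts it equals the coordinate of `f m = g n`.
  { χ := fun q : M × N => (φ q.1, (e (D q.2)).2)
    σ := fun w => ((φ.symm w.1, D.symm (e.symm (C (f (φ.symm w.1)), w.2))) : M × N)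
    U := φ.source ×ˢ D.source
    V := (Prod.fst ⁻¹' φ.target ∩
        (fun w : M.model × Compl N B => f (φ.symm w.1)) ⁻¹' C.source) ∩
        (fun w : M.model × Compl N B => e.symm (C (f (φ.symm w.1)), w.2)) ⁻¹' D.target
    isOpen_U := φ.open_source.prod D.open_source
    isOpen_V := h2.continuousOn.isOpen_inter_preimage hfo D.open_target
    smooth_χ := by
      have h3 : ContMDiffOn 𝓘(ℝ, (M.prod N).model) 𝓘(ℝ, M.model) ∞
          (fun q : M.prod N => φ q.1) (φ.source ×ˢ D.source : Set (M × N)) :=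
        (contMDiffOn_chart (x := p.1)).comp (smooth_fst (M := M) (N := N)).contMDiffOn
          fun q hq => hq.1
      have h4 : ContMDiffOn 𝓘(ℝ, (M.prod N).model) 𝓘(ℝ, N.model) ∞
          (fun q : M.prod N => D q.2) (φ.source ×ˢ D.source : Set (M × N)) :=
        (contMDiffOn_of_mem_maximalAtlas hs.domChart_mem_maximalAtlas).comp
          (smooth_snd (M := M) (N := N)).contMDiffOn fun q hq => hq.2
      have h5 : ContDiff ℝ ∞ (fun w : N.model => (e w).2) := contDiff_snd.comp e.contDiff
      exact h3.prodMk_space ((contMDiff_iff_contDiff.2 h5).comp_contMDiffOn h4)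
    smooth_σ := by
      have h3 := (contMDiffOn_symm_of_mem_maximalAtlas hs.domChart_mem_maximalAtlas).comp
        (h2.mono Set.inter_subset_left) fun w hw => hw.2
      have h4 := ContMDiffOn.prodMk (h1.mono fun w hw => hw.1.1) h3
      rw [← modelWithCornersSelf_prod] at h4
      exact h4
    σ_mem := fun w hw' => by
      have hn := D.map_target hw'.2
      refine C.injOn hw'.1.2 (hDC _ hn) ?_
      rw [hw _ hn, D.right_inv hw'.2]
      simp
    σ_mem_U := fun w hw => ⟨φ.map_target hw.1.1, D.map_target hw.2⟩
    χ_mem := fun q hq hq' => by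
      obtain ⟨m, n⟩ := q
      have hmn : f m = g n := hq'
      have h3 : φ.symm (φ m) = m := φ.left_inv hq.1
      have h4 : e.symm (C (f m), (e (D n)).2) = D n := by
        rw [hmn, hw n hq.2]; exact e.symm_apply_apply _
      refine ⟨⟨φ.map_source hq.1, ?_⟩, ?_⟩
      · simp only [Set.mem_preimage]
        rw [h3, hmn]; exact hDC n hq.2
      · simp only [Set.mem_preimage]
        rw [h3, h4]; exact D.map_source hq.2
    χ_σ := fun w hw => by
      refine Prod.ext (φ.right_inv hw.1.1) ?_
      change (e (D (D.symm _))).2 = w.2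
      rw [D.right_inv hw.2]
      simp
    σ_χ := fun q hq hq' => by
      obtain ⟨m, n⟩ := q
      have hmn : f m = g n := hq'
      have h3 : φ.symm (φ m) = m := φ.left_inv hq.1
      have h4 : e.symm (C (f m), (e (D n)).2) = D n := by
        rw [hmn, hw n hq.2]; exact e.symm_apply_apply _
      refine Prod.ext h3 ?_
      change D.symm (e.symm (C (f (φ.symm (φ m))), (e (D n)).2)) = n
      rw [h3, h4, D.left_inv hq.2] }

/-- The fibre product of a smooth map and a surjective submersion. -/
def fp (hf : Smooth f) (hg : SurjSubmersion g) : Mfd.{u} :=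
  sub (fun x : fpSet f g => fpChart hf hg x.1)
    fun x => ⟨mem_chart_source _ x.1.1,
      (hg.isSubmersionAtOfComplement x.1.2).mem_domChart_source⟩

variable {hf : Smooth f} {hg : SurjSubmersion g}

namespace fp

/-- The first projection of a fibre product. -/
def fst (x : fp hf hg) : M := Prod.fst (Subtype.val x : M × N)

/-- The second projection of a fibre product. -/
def snd (x : fp hf hg) : N := Prod.snd (Subtype.val x : M × N)

theorem w (x : fp hf hg) : f (fst x) = g (snd x) := Subtype.property (p := fpSet f g) x

variable (hf hg) in
/-- The point of a fibre product defined by a pair of points. -/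
def mk (m : M) (n : N) (h : f m = g n) : fp hf hg := (⟨((m, n) : M × N), h⟩ : fpSet f g)

@[simp] theorem fst_mk (m : M) (n : N) (h : f m = g n) : fst (mk hf hg m n h) = m := rfl
@[simp] theorem snd_mk (m : M) (n : N) (h : f m = g n) : snd (mk hf hg m n h) = n := rfl

@[ext] theorem ext {x y : fp hf hg} (h1 : fst x = fst y) (h2 : snd x = snd y) : x = y :=
  Subtype.ext (Prod.ext h1 h2)

theorem fst_smooth : Smooth (fst : fp hf hg → M) := smooth_fst.comp (sub_val_smooth _ _)
theorem snd_smooth : Smooth (snd : fp hf hg → N) := smooth_snd.comp (sub_val_smooth _ _)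

theorem smoothWithinAt {h : K → fp hf hg} {T : Set K} {k : K}
    (h1 : SmoothWithinAt (fun x => fst (h x)) T k) (h2 : SmoothWithinAt (fun x => snd (h x)) T k) :
    SmoothWithinAt h T k :=
  sub_smoothWithinAt _ _ (SmoothWithinAt.pair h1 h2)

end fp

end FibreProduct

end Mfd

/-! ### Smoothness near a point of a subset, and lifting -/

namespace Mfd

variable {K M N P Q B : Mfd.{u}} {S : Set K} {k : K}

/-- Smoothness, within a set, at all points of the set near a given one. -/
abbrev SmoothNear (f : K → M) (S : Set K) (k : K) : Prop :=
  ∀ᶠ x in 𝓝[S] k, SmoothWithinAt f S x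

theorem Smooth.near {f : K → M} (hf : Smooth f) : SmoothNear f S k :=
  Eventually.of_forall fun _ => hf.within

theorem SmoothNear.at {f : K → M} (hf : SmoothNear f S k) (hk : k ∈ S) : SmoothWithinAt f S k :=
  hf.self_of_nhdsWithin hk

theorem Smooth.comp_near {g : M → N} (hg : Smooth g) {f : K → M} (hf : SmoothNear f S k) :
    SmoothNear (fun x => g (f x)) S k :=
  hf.mono fun _ h => hg.comp_within h

theorem SmoothOn.comp_near {g : M → N} {T : Set M} (hg : SmoothOn g T) {f : K → M}
    (hf : SmoothNear f S k) (hm : ∀ᶠ x in 𝓝[S] k, f x ∈ T) : SmoothNear (fun x => g (f x)) S k := by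
  filter_upwards [hf, hm, eventually_eventually_nhdsWithin.2 hm] with x h1 h2 h3
  exact SmoothWithinAt.comp_of_eventually (hg _ h2) h1 h3

theorem SmoothNear.pair {f : K → M} {g : K → N} (hf : SmoothNear f S k) (hg : SmoothNear g S k) :
    SmoothNear (M := M.prod N) (fun x => (f x, g x)) S k := by
  filter_upwards [hf, hg] with x h1 h2 using h1.pair h2

theorem SmoothNear.congr {f g : K → M} (hf : SmoothNear f S k) (h : ∀ᶠ x in 𝓝[S] k, g x = f x) :
    SmoothNear g S k := by
  filter_upwards [hf, eventually_eventually_nhdsWithin.2 h, eventually_mem_nhdsWithin]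
    with x h1 h2 h3
  exact h1.congr_of_eventually h2 h3

theorem smoothOn_of_near {f : K → M} (h : ∀ k ∈ S, SmoothNear f S k) : SmoothOn f S :=
  fun k hk => (h k hk).at hk

theorem smooth_of_near {f : K → M} (h : ∀ k, SmoothNear f Set.univ k) : Smooth f :=
  fun k => (h k).at trivial

theorem SurjSubmersion.smooth {f : M → N} (hf : SurjSubmersion f) : Smooth f := hf.2.contMDiff

theorem SurjSubmersion.lift {f : M → N} (hf : SurjSubmersion f) {h : K → N} (hk : k ∈ S)
    (hh : SmoothNear h S k) (m : M) (hmk : f m = h k) :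
    ∃ l : K → M, l k = m ∧ SmoothNear l S k ∧ ∀ᶠ x in 𝓝[S] k, f (l x) = h x :=
  (surjSubmersion_iff.1 hf).lift hk hh (Eventually.of_forall fun _ => trivial) m hmk

/-- A surjective map is a submersion if the identity of its target lifts locally to its source. -/
theorem surjSubmersion_of_section {f : M → N} (hf : Smooth f) (hs : Function.Surjective f)
    (h : ∀ x, ∃ σ : N → M, σ (f x) = x ∧ SmoothNear σ Set.univ (f x) ∧
      ∀ᶠ y in 𝓝[Set.univ] f x, f (σ y) = y) : SurjSubmersion f := by
  refine surjSubmersion_iff.2 ⟨hf, fun _ => trivial, fun y _ => hs y, fun x => ?_⟩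
  obtain ⟨σ, h1, h2, h3⟩ := h x
  exact ⟨σ, h1, h2.and h3⟩

theorem SurjSubmersion.id : SurjSubmersion (id : M → M) := ⟨Function.surjective_id, .id⟩

theorem SurjSubmersion.comp {g : N → P} {f : M → N} (hg : SurjSubmersion g)
    (hf : SurjSubmersion f) : SurjSubmersion (g ∘ f) := by
  refine surjSubmersion_of_section (hg.smooth.comp hf.smooth) (hg.1.comp hf.1) fun x => ?_
  obtain ⟨l, h1, h2, h3⟩ := hg.lift (K := P) (S := Set.univ) (k := g (f x)) trivial
    (Smooth.near contMDiff_id) (f x) rfl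
  obtain ⟨l', h1', h2', h3'⟩ := hf.lift (K := P) (S := Set.univ) (k := g (f x)) trivial h2 x h1.symm
  refine ⟨l', h1', h2', ?_⟩
  filter_upwards [h3, h3'] with y h4 h5
  simp only [Function.comp_apply, h5, h4, _root_.id]

theorem SurjSubmersion.prodMap {f : M → N} {g : P → Q} (hf : SurjSubmersion f)
    (hg : SurjSubmersion g) :
    SurjSubmersion (M := M.prod P) (N := N.prod Q) (fun x => (f x.1, g x.2)) := by
  refine surjSubmersion_of_section
    (Smooth.pair (hf.smooth.comp smooth_fst) (hg.smooth.comp smooth_snd)) (fun y => ?_) fun x => ?_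
  · obtain ⟨a, ha⟩ := hf.1 y.1
    obtain ⟨b, hb⟩ := hg.1 y.2
    exact ⟨((a, b) : M × P), Prod.ext ha hb⟩
  · obtain ⟨l, h1, h2, h3⟩ := hf.lift (K := N.prod Q) (S := Set.univ)
      (k := ((f x.1, g x.2) : N × Q)) trivial (Smooth.near smooth_fst) x.1 rfl
    obtain ⟨l', h1', h2', h3'⟩ := hg.lift (K := N.prod Q) (S := Set.univ)
      (k := ((f x.1, g x.2) : N × Q)) trivial (Smooth.near smooth_snd) x.2 rfl
    refine ⟨fun y => ((l y, l' y) : M × P), Prod.ext h1 h1', h2.pair h2', ?_⟩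
    filter_upwards [h3, h3'] with y h4 h5 using Prod.ext h4 h5

namespace fp

variable {f : M → B} {g : N → B} {hf : Smooth f} {hg : SurjSubmersion g}

open Classical in
/-- The point of a fibre product defined by a pair of points, with a default value. -/
def mkD (x : fp hf hg) (m : M) (n : N) : fp hf hg := if h : f m = g n then mk hf hg m n h else x

theorem mkD_eq (x : fp hf hg) {m : M} {n : N} (h : f m = g n) : mkD x m n = mk hf hg m n h :=
  dif_pos h

theorem near {h : K → fp hf hg} (h1 : SmoothNear (fun x => fst (h x)) S k)
    (h2 : SmoothNear (fun x => snd (h x)) S k) : SmoothNear h S k := by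
  filter_upwards [h1, h2] with x h3 h4 using smoothWithinAt h3 h4

/-- Local lifts are total functions that satisfy the fibre condition only near `k`; away from there
the default value of `mkD` takes over without affecting smoothness. -/
theorem mkD_near (x : fp hf hg) {a : K → M} {b : K → N} (h1 : SmoothNear a S k)
    (h2 : SmoothNear b S k) (h : ∀ᶠ x in 𝓝[S] k, f (a x) = g (b x)) :
    SmoothNear (fun y => mkD x (a y) (b y)) S k := by
  refine near (h1.congr ?_) (h2.congr ?_)
  · filter_upwards [h] with y hy
    rw [mkD_eq x hy, fst_mk]
  · filter_upwards [h] with y hy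
    rw [mkD_eq x hy, snd_mk]

end fp

end Mfd

/-! ### Morita morphisms of Lie 2-groupoids -/

namespace LieGroupoid

variable {K M A N B : Mfd.{u}} {S : Set K} {k : K}

theorem mul_near (X : LieGroupoid M A) {a b : K → A} (ha : SmoothNear a S k)
    (hb : SmoothNear b S k) (h : ∀ᶠ x in 𝓝[S] k, X.src (a x) = X.tgt (b x)) :
    SmoothNear (fun x => X.mul (a x) (b x)) S k :=
  SmoothOn.comp_near X.mul_smooth (ha.pair hb) h

theorem src_smooth (X : LieGroupoid M A) : Smooth X.src := X.src_submersion.smooth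
theorem tgt_smooth (X : LieGroupoid M A) : Smooth X.tgt := X.tgt_submersion.smooth

/-- The arrows of the pullback groupoid form an embedded submanifold. -/
theorem exists_pullbackArrows (Y : LieGroupoid N B) {f₀ : M → N} (hf : SurjSubmersion f₀) :
    ∃ (P : Mfd.{u}) (ι : P → M.prod (B.prod M)), DiffeoOnto ι (pullbackArrows Y f₀) := by
  have hb : Smooth (M := B) (N := N.prod N) (fun b => (Y.tgt b, Y.src b)) :=
    Smooth.pair Y.tgt_smooth Y.src_smooth
  -- The triples are the fibre product of `(tgt, src) : B → N × N` and `f₀ × f₀`, with the factors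
  -- reordered.
  let ι : fp hb (hf.prodMap hf) → M.prod (B.prod M) :=
    fun x => ((fp.snd x).1, fp.fst x, (fp.snd x).2)
  refine ⟨_, ι, SubmOnto.diffeoOnto ⟨?_, ?_, ?_, fun x => ?_⟩ ?_ ?_⟩
  · exact Smooth.pair (smooth_fst.comp fp.snd_smooth)
      (Smooth.pair fp.fst_smooth (smooth_snd.comp fp.snd_smooth))
  · intro x
    exact ⟨congrArg Prod.fst (fp.w x), congrArg Prod.snd (fp.w x)⟩
  · rintro ⟨m, b, n⟩ ⟨h1, h2⟩
    exact ⟨fp.mk hb (hf.prodMap hf) b ((m, n) : M × M) (Prod.ext h1 h2), rfl⟩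
  · refine ⟨fun y => fp.mkD x y.2.1 ((y.1, y.2.2) : M × M), ?_, ?_⟩
    · exact fp.mkD_eq (hf := hb) (hg := hf.prodMap hf) x (fp.w x)
    · have h : ∀ᶠ y : M × B × M in 𝓝[pullbackArrows Y f₀] ι x, ((Y.tgt y.2.1, Y.src y.2.1) : N × N) =
          (f₀ y.1, f₀ y.2.2) := by
        filter_upwards [eventually_mem_nhdsWithin] with y hy using Prod.ext hy.1 hy.2
      refine Eventually.and (fp.mkD_near x (Smooth.near ?_) (Smooth.near ?_) h) ?_
      · exact smooth_fst.comp smooth_snd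
      · exact Smooth.pair smooth_fst (smooth_snd.comp smooth_snd)
      · filter_upwards [h] with y hy
        exact congrArg ι (fp.mkD_eq (hf := hb) (hg := hf.prodMap hf) (m := y.2.1)
          (n := ((y.1, y.2.2) : M × M)) x hy)
  · intro x y hxy
    have h1 : fp.fst x = fp.fst y := congrArg (fun p : M × B × M => p.2.1) hxy
    have h2 : (fp.snd x).1 = (fp.snd y).1 := congrArg (fun p : M × B × M => p.1) hxy
    have h3 : (fp.snd x).2 = (fp.snd y).2 := congrArg (fun p : M × B × M => p.2.2) hxy
    exact fp.ext h1 (Prod.ext h2 h3)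
  · rintro ⟨m, -, -⟩
    exact ⟨fp.mk hb (hf.prodMap hf) (Y.unit (f₀ m)) ((m, m) : M × M)
      (Prod.ext (Y.tgt_unit _) (Y.src_unit _))⟩

end LieGroupoid

namespace Lie2Groupoid

variable {X Y Z : Lie2Groupoid.{u}}

theorem src_ver_src (x : X.X₂) : X.one.src (X.ver.src x) = X.hor.src x := X.src_hom.src x
theorem tgt_ver_src (x : X.X₂) : X.one.tgt (X.ver.src x) = X.hor.tgt x := X.src_hom.tgt x
theorem src_ver_tgt (x : X.X₂) : X.one.src (X.ver.tgt x) = X.hor.src x := X.tgt_hom.src x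
theorem tgt_ver_tgt (x : X.X₂) : X.one.tgt (X.ver.tgt x) = X.hor.tgt x := X.tgt_hom.tgt x

namespace Hom

/-- The 1-arrows of `X` as 1-arrows of the pullback of `Y`. -/
def arrowFrame (f : Hom X Y) (a : X.X₁) : X.X₀.prod (Y.X₁.prod X.X₀) :=
  ((X.one.tgt a, f.f₁ a, X.one.src a) : X.X₀ × Y.X₁ × X.X₀)

/-- The 2-arrows of `X` as 2-arrows of the pullback of `Y` along `f₀` and `f₁`. -/
def cellFrame (f : Hom X Y) (x : X.X₂) : X.X₁.prod (Y.X₂.prod X.X₁) :=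
  ((X.ver.tgt x, f.f₂ x, X.ver.src x) : X.X₁ × Y.X₂ × X.X₁)

/-- The range of `cellFrame` for a Morita morphism. -/
def cellSet (f : Hom X Y) : Set (X.X₁.prod (Y.X₂.prod X.X₁)) :=
  {p : X.X₁ × Y.X₂ × X.X₁ | Y.ver.tgt p.2.1 = f.f₁ p.1 ∧ Y.ver.src p.2.1 = f.f₁ p.2.2 ∧
      X.one.tgt p.1 = X.one.tgt p.2.2 ∧ X.one.src p.1 = X.one.src p.2.2}

theorem arrowFrame_smooth (f : Hom X Y) : Smooth f.arrowFrame :=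
  Smooth.pair X.one.tgt_smooth (Smooth.pair f.one.smooth₁ X.one.src_smooth)

theorem arrowFrame_mem (f : Hom X Y) (a : X.X₁) :
    f.arrowFrame a ∈ LieGroupoid.pullbackArrows Y.one f.f₀ := ⟨f.one.tgt a, f.one.src a⟩

theorem cellFrame_smooth (f : Hom X Y) : Smooth f.cellFrame :=
  Smooth.pair X.ver.tgt_smooth (Smooth.pair f.ver.smooth₁ X.ver.src_smooth)

theorem cellFrame_mem (f : Hom X Y) (x : X.X₂) : f.cellFrame x ∈ f.cellSet :=
  ⟨f.ver.tgt x, f.ver.src x, (X.tgt_ver_tgt x).trans (X.tgt_ver_src x).symm,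
    (X.src_ver_tgt x).trans (X.src_ver_src x).symm⟩

/-- Reduces the Morita property to existence, local lifting and uniqueness. The manifold structure
needed for the 1-arrows comes from `exists_pullbackArrows`; none is needed for the 2-arrows, since a
bijection with local sections is a diffeomorphism onto its image. -/
theorem isMorita_of {f : Hom X Y} (h₀ : SurjSubmersion f.f₀)
    (h₁ : ∀ m y n, Y.one.tgt y = f.f₀ m → Y.one.src y = f.f₀ n →
      ∃ a, X.one.tgt a = m ∧ f.f₁ a = y ∧ X.one.src a = n)
    (h₁' : ∀ a, ∃ σ, σ (f.arrowFrame a) = a ∧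
      SmoothNear σ (LieGroupoid.pullbackArrows Y.one f.f₀) (f.arrowFrame a) ∧
      ∀ᶠ y in 𝓝[LieGroupoid.pullbackArrows Y.one f.f₀] f.arrowFrame a, f.arrowFrame (σ y) = y)
    (h₂ : ∀ a y b, Y.ver.tgt y = f.f₁ a → Y.ver.src y = f.f₁ b → X.one.tgt a = X.one.tgt b →
      X.one.src a = X.one.src b → ∃ x, X.ver.tgt x = a ∧ f.f₂ x = y ∧ X.ver.src x = b)
    (h₂' : ∀ x, ∃ σ, σ (f.cellFrame x) = x ∧
      SmoothNear σ f.cellSet (f.cellFrame x) ∧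
      ∀ᶠ y in 𝓝[f.cellSet] f.cellFrame x, f.cellFrame (σ y) = y)
    (h₂'' : ∀ x x', X.ver.tgt x = X.ver.tgt x' → f.f₂ x = f.f₂ x' → X.ver.src x = X.ver.src x' →
      x = x') : f.IsMorita := by
  obtain ⟨P, ι, hι⟩ := LieGroupoid.exists_pullbackArrows Y.one h₀
  refine ⟨h₀, SubmOnto.surjSubmersionOnto (f := f.arrowFrame)
      ⟨f.arrowFrame_smooth, f.arrowFrame_mem, ?_, ?_⟩ hι,
    SubmOnto.diffeoOnto (f := f.cellFrame) (S := f.cellSet)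
      ⟨f.cellFrame_smooth, f.cellFrame_mem, ?_, ?_⟩ ?_ ?_⟩
  · rintro ⟨m, y, n⟩ ⟨h, h'⟩
    obtain ⟨a, rfl, rfl, rfl⟩ := h₁ m y n h h'
    exact ⟨a, rfl⟩
  · intro a
    obtain ⟨σ, h1, h2, h3⟩ := h₁' a
    exact ⟨σ, h1, h2.and h3⟩
  · rintro ⟨a, y, b⟩ ⟨h, h', h'', h'''⟩
    obtain ⟨x, rfl, rfl, rfl⟩ := h₂ a y b h h' h'' h'''
    exact ⟨x, rfl⟩
  · intro a
    obtain ⟨σ, h1, h2, h3⟩ := h₂' a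
    exact ⟨σ, h1, h2.and h3⟩
  · intro x x' h
    exact h₂'' x x' (congrArg (fun p : X.X₁ × Y.X₂ × X.X₁ => p.1) h)
      (congrArg (fun p : X.X₁ × Y.X₂ × X.X₁ => p.2.1) h)
      (congrArg (fun p : X.X₁ × Y.X₂ × X.X₁ => p.2.2) h)
  · rintro ⟨a, -, -⟩
    exact ⟨X.ver.unit a⟩

namespace IsMorita

variable {f : Hom X Y} (hf : f.IsMorita) {K : Mfd.{u}} {S : Set K} {k : K}
include hf

theorem arrows_submOnto : SubmOnto f.arrowFrame (LieGroupoid.pullbackArrows Y.one f.f₀) :=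
  hf.arrows.submOnto

theorem exists_arrow {m n : X.X₀} {y : Y.X₁} (h1 : Y.one.tgt y = f.f₀ m)
    (h2 : Y.one.src y = f.f₀ n) : ∃ a, X.one.tgt a = m ∧ f.f₁ a = y ∧ X.one.src a = n := by
  obtain ⟨a, ha⟩ := hf.arrows_submOnto.surj ((m, y, n) : X.X₀ × Y.X₁ × X.X₀) ⟨h1, h2⟩
  exact ⟨a, congrArg (fun p : X.X₀ × Y.X₁ × X.X₀ => p.1) ha,
    congrArg (fun p : X.X₀ × Y.X₁ × X.X₀ => p.2.1) ha,
    congrArg (fun p : X.X₀ × Y.X₁ × X.X₀ => p.2.2) ha⟩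

/-- The form in which the submersion on 1-arrows is used. Prescribing the value `a₀` at `k` is what
makes the lifts serve as sections through a given point. -/
theorem lift_arrow {m n : K → X.X₀} {y : K → Y.X₁} (hk : k ∈ S) (hm : SmoothNear m S k)
    (hy : SmoothNear y S k) (hn : SmoothNear n S k)
    (h1 : ∀ᶠ x in 𝓝[S] k, Y.one.tgt (y x) = f.f₀ (m x))
    (h2 : ∀ᶠ x in 𝓝[S] k, Y.one.src (y x) = f.f₀ (n x))
    (a₀ : X.X₁) (ht : X.one.tgt a₀ = m k) (hfa : f.f₁ a₀ = y k) (hs : X.one.src a₀ = n k) :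
    ∃ a : K → X.X₁, a k = a₀ ∧ SmoothNear a S k ∧
      ∀ᶠ x in 𝓝[S] k, X.one.tgt (a x) = m x ∧ f.f₁ (a x) = y x ∧ X.one.src (a x) = n x := by
  obtain ⟨l, h3, h4, h5⟩ := hf.arrows_submOnto.lift hk (hm.pair (hy.pair hn))
    (by filter_upwards [h1, h2] with x h3 h4 using ⟨h3, h4⟩) a₀
    (Prod.ext ht (Prod.ext hfa hs))
  refine ⟨l, h3, h4, h5.mono fun x h => ?_⟩
  exact ⟨congrArg (fun p : X.X₀ × Y.X₁ × X.X₀ => p.1) h,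
    congrArg (fun p : X.X₀ × Y.X₁ × X.X₀ => p.2.1) h,
    congrArg (fun p : X.X₀ × Y.X₁ × X.X₀ => p.2.2) h⟩

/-- The 2-arrow of `X` with given boundary and image. -/
def cell (a : X.X₁) (y : Y.X₂) (b : X.X₁) : X.X₂ :=
  hf.cells.inv ((a, y, b) : X.X₁ × Y.X₂ × X.X₁)

theorem cell_spec {a : X.X₁} {y : Y.X₂} {b : X.X₁} (h1 : Y.ver.tgt y = f.f₁ a)
    (h2 : Y.ver.src y = f.f₁ b) (h3 : X.one.tgt a = X.one.tgt b)
    (h4 : X.one.src a = X.one.src b) : X.ver.tgt (hf.cell a y b) = a ∧ f.f₂ (hf.cell a y b) = y ∧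
      X.ver.src (hf.cell a y b) = b := by
  have h := hf.cells.apply_inv (y := ((a, y, b) : X.X₁ × Y.X₂ × X.X₁)) ⟨h1, h2, h3, h4⟩
  exact ⟨congrArg (fun p : X.X₁ × Y.X₂ × X.X₁ => p.1) h,
    congrArg (fun p : X.X₁ × Y.X₂ × X.X₁ => p.2.1) h,
    congrArg (fun p : X.X₁ × Y.X₂ × X.X₁ => p.2.2) h⟩

theorem cell_ext {x x' : X.X₂} (h1 : X.ver.tgt x = X.ver.tgt x') (h2 : f.f₂ x = f.f₂ x')
    (h3 : X.ver.src x = X.ver.src x') : x = x' :=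
  hf.cells.injective (Prod.ext h1 (Prod.ext h2 h3))

theorem cell_near {a b : K → X.X₁} {y : K → Y.X₂} (ha : SmoothNear a S k) (hy : SmoothNear y S k)
    (hb : SmoothNear b S k)
    (h : ∀ᶠ x in 𝓝[S] k, Y.ver.tgt (y x) = f.f₁ (a x) ∧ Y.ver.src (y x) = f.f₁ (b x) ∧
      X.one.tgt (a x) = X.one.tgt (b x) ∧ X.one.src (a x) = X.one.src (b x)) :
    SmoothNear (fun x => hf.cell (a x) (y x) (b x)) S k :=
  SmoothOn.comp_near hf.cells.inv_smoothOn (ha.pair (hy.pair hb)) h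

end IsMorita

theorem isMorita_id (X : Lie2Groupoid.{u}) : (Hom.id X).IsMorita := by
  refine isMorita_of .id ?_ ?_ ?_ ?_ ?_
  · rintro _ y _ rfl rfl
    exact ⟨y, rfl, rfl, rfl⟩
  · refine fun a => ⟨fun p => p.2.1, rfl, (Smooth.near (smooth_fst.comp smooth_snd)), ?_⟩
    filter_upwards [eventually_mem_nhdsWithin] with p hp using Prod.ext hp.1 (Prod.ext rfl hp.2)
  · rintro _ y _ rfl rfl _ _
    exact ⟨y, rfl, rfl, rfl⟩
  · refine fun a => ⟨fun p => p.2.1, rfl, (Smooth.near (smooth_fst.comp smooth_snd)), ?_⟩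
    filter_upwards [eventually_mem_nhdsWithin] with p hp using Prod.ext hp.1 (Prod.ext rfl hp.2.1)
  · exact fun x x' _ h _ => h

/-- Existence and local lifts are obtained in two stages, through `g` and then through `f`. The
intermediate 2-arrow of `Y` has boundary in the image of `f₁`, so that `f` can fill it in. -/
theorem IsMorita.comp {g : Hom Y Z} {f : Hom X Y} (hg : g.IsMorita) (hf : f.IsMorita) :
    (g.comp f).IsMorita := by
  refine isMorita_of (hg.base.comp hf.base) ?_ ?_ ?_ ?_ ?_
  · intro m z n h1 h2
    obtain ⟨b, h3, rfl, h4⟩ := hg.exists_arrow h1 h2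
    obtain ⟨a, h5, rfl, h6⟩ := hf.exists_arrow h3 h4
    exact ⟨a, h5, rfl, h6⟩
  · intro a
    have hk := (g.comp f).arrowFrame_mem a
    have hm := @eventually_mem_nhdsWithin _ _ ((g.comp f).arrowFrame a)
      (LieGroupoid.pullbackArrows Z.one (g.comp f).f₀)
    obtain ⟨b, h1, h2, h3⟩ := hg.lift_arrow (K := X.X₀.prod (Z.X₁.prod X.X₀)) hk
      (m := fun p => f.f₀ p.1) (y := fun p => p.2.1) (n := fun p => f.f₀ p.2.2)
      (Smooth.near (f.one.smooth₀.comp smooth_fst)) (Smooth.near (smooth_fst.comp smooth_snd))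
      (Smooth.near (f.one.smooth₀.comp (smooth_snd.comp smooth_snd)))
      (hm.mono fun p hp => hp.1) (hm.mono fun p hp => hp.2) (f.f₁ a) (f.one.tgt a) rfl (f.one.src a)
    obtain ⟨c, h1', h2', h3'⟩ := hf.lift_arrow (K := X.X₀.prod (Z.X₁.prod X.X₀)) hk
      (m := fun p => p.1) (y := b) (n := fun p => p.2.2)
      (Smooth.near smooth_fst) h2 (Smooth.near (smooth_snd.comp smooth_snd))
      (h3.mono fun p hp => hp.1) (h3.mono fun p hp => hp.2.2) a rfl h1.symm rfl
    refine ⟨c, h1', h2', ?_⟩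
    filter_upwards [h3, h3'] with p h4 h5
    refine Prod.ext h5.1 (Prod.ext ?_ h5.2.2)
    change g.f₁ (f.f₁ (c p)) = p.2.1
    rw [h5.2.1, h4.2.1]
  · intro a z b h1 h2 h3 h4
    obtain ⟨h5, h6, h7⟩ := hg.cell_spec (a := f.f₁ a) (b := f.f₁ b) h1 h2
      (by rw [f.one.tgt, f.one.tgt, h3]) (by rw [f.one.src, f.one.src, h4])
    obtain ⟨h5', h6', h7'⟩ := hf.cell_spec h5 h7 h3 h4
    exact ⟨_, h5', by change g.f₂ (f.f₂ _) = z; rw [h6', h6], h7'⟩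
  · intro x
    have hm := @eventually_mem_nhdsWithin _ _ ((g.comp f).cellFrame x) (g.comp f).cellSet
    have key : ∀ p : X.X₁ × Z.X₂ × X.X₁, p ∈ (g.comp f).cellSet →
        _ ∧ _ := fun p hp => by
      have h1 := hg.cell_spec (a := f.f₁ p.1) (y := p.2.1) (b := f.f₁ p.2.2) hp.1 hp.2.1
        (by rw [f.one.tgt, f.one.tgt, hp.2.2.1]) (by rw [f.one.src, f.one.src, hp.2.2.2])
      exact ⟨h1, hf.cell_spec h1.1 h1.2.2 hp.2.2.1 hp.2.2.2⟩
    refine ⟨fun p => hf.cell p.1 (hg.cell (f.f₁ p.1) p.2.1 (f.f₁ p.2.2)) p.2.2, ?_, ?_, ?_⟩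
    · obtain ⟨h1, h2⟩ := key _ ((g.comp f).cellFrame_mem x)
      refine hf.cell_ext h2.1 (hg.cell_ext ?_ ?_ ?_) h2.2.2
      · rw [h2.2.1, h1.1, f.ver.tgt]; rfl
      · rw [h2.2.1, h1.2.1]; rfl
      · rw [h2.2.1, h1.2.2, f.ver.src]; rfl
    · refine hf.cell_near (Smooth.near smooth_fst) (hg.cell_near
        (Smooth.near (f.one.smooth₁.comp smooth_fst)) (Smooth.near (smooth_fst.comp smooth_snd))
        (Smooth.near (f.one.smooth₁.comp (smooth_snd.comp smooth_snd)))
        (hm.mono fun p hp => ?_)) (Smooth.near (smooth_snd.comp smooth_snd))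
        (hm.mono fun p hp => ?_)
      · exact ⟨hp.1, hp.2.1, by rw [f.one.tgt, f.one.tgt, hp.2.2.1],
          by rw [f.one.src, f.one.src, hp.2.2.2]⟩
      · exact ⟨(key p hp).1.1, (key p hp).1.2.2, hp.2.2.1, hp.2.2.2⟩
    · filter_upwards [hm] with p hp
      obtain ⟨h1, h2⟩ := key p hp
      refine Prod.ext h2.1 (Prod.ext ?_ h2.2.2)
      change g.f₂ (f.f₂ _) = p.2.1
      rw [h2.2.1, h1.2.1]
  · intro x x' h1 h2 h3
    exact hf.cell_ext h1 (hg.cell_ext (by rw [f.ver.tgt, f.ver.tgt, h1]) h2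
      (by rw [f.ver.src, f.ver.src, h3])) h3

end Hom

end Lie2Groupoid

/-! ### Fibre products of Lie groupoids along fibrations -/

namespace Mfd.fp

variable {M N B : Mfd.{u}} {f : M → B} {g : N → B} {hf : Smooth f} {hg : SurjSubmersion g}

theorem fst_surjSubmersion : SurjSubmersion (fst : fp hf hg → M) := by
  refine surjSubmersion_of_section fst_smooth (fun m => ?_) fun x => ?_
  · obtain ⟨n, hn⟩ := hg.1 (f m)
    exact ⟨mk hf hg m n hn.symm, rfl⟩
  · obtain ⟨l, h1, h2, h3⟩ := hg.lift (K := M) (S := Set.univ) (k := fst x) trivial (Smooth.near hf)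
      (snd x) (w x).symm
    refine ⟨fun m => mkD x m (l m), ?_, mkD_near x (Smooth.near contMDiff_id) h2
      (h3.mono fun m hm => hm.symm), ?_⟩
    · beta_reduce; rw [h1, mkD_eq x (w x)]; rfl
    · filter_upwards [h3] with m hm
      rw [mkD_eq x hm.symm]; rfl

theorem snd_surjSubmersion (hf' : SurjSubmersion f) : SurjSubmersion (snd : fp hf hg → N) := by
  refine surjSubmersion_of_section snd_smooth (fun m => ?_) fun x => ?_
  · obtain ⟨n, hn⟩ := hf'.1 (g m)
    exact ⟨mk hf hg n m hn, rfl⟩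
  · obtain ⟨l, h1, h2, h3⟩ := hf'.lift (K := N) (S := Set.univ) (k := snd x) trivial
      (Smooth.near hg.smooth) (fst x) (w x)
    refine ⟨fun m => mkD x (l m) m, ?_, mkD_near x h2 (Smooth.near contMDiff_id) h3, ?_⟩
    · beta_reduce; rw [h1, mkD_eq x (w x)]; rfl
    · filter_upwards [h3] with m hm
      rw [mkD_eq x hm]; rfl

end Mfd.fp

namespace LieGroupoid

variable {M A N B O C L D : Mfd.{u}}

/-- Arrows lift, smoothly, along `(g₀, g₁)`, with prescribed source. -/
def IsFibration (Z : LieGroupoid N B) (Y : LieGroupoid O C) (g₀ : N → O) (g₁ : B → C) : Prop :=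
  ∀ ⦃K : Mfd.{u}⦄ ⦃S : Set K⦄ ⦃k : K⦄, k ∈ S → ∀ ⦃n : K → N⦄ ⦃y : K → C⦄,
    SmoothNear n S k → SmoothNear y S k → (∀ᶠ x in 𝓝[S] k, Y.src (y x) = g₀ (n x)) →
    ∀ b₀, Z.src b₀ = n k → g₁ b₀ = y k →
    ∃ b : K → B, b k = b₀ ∧ SmoothNear b S k ∧ ∀ᶠ x in 𝓝[S] k, Z.src (b x) = n x ∧ g₁ (b x) = y x

namespace IsHom

variable {X : LieGroupoid M A} {Z : LieGroupoid N B} {Y : LieGroupoid O C} {f₀ : M → O}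
  {f₁ : A → C} {g₀ : N → O} {g₁ : B → C} (hf : IsHom X Y f₀ f₁) (hg : IsHom Z Y g₀ g₁)
  (h₀ : SurjSubmersion g₀) (h₁ : SurjSubmersion g₁)

theorem inv {X : LieGroupoid M A} {Y : LieGroupoid O C} (hf : IsHom X Y f₀ f₁) (a : A) :
    f₁ (X.inv a) = Y.inv (f₁ a) := by
  have h1 : Y.mul (f₁ (X.inv a)) (f₁ a) = Y.unit (Y.src (f₁ a)) := by
    rw [← hf.mul _ _ (X.src_inv a), X.inv_mul, hf.unit, hf.src]
  have h2 : Y.src (f₁ (X.inv a)) = Y.tgt (f₁ a) := by rw [hf.src, X.src_inv, hf.tgt]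
  calc f₁ (X.inv a) = Y.mul (f₁ (X.inv a)) (Y.unit (Y.src (f₁ (X.inv a)))) := (Y.mul_unit _).symm
    _ = Y.mul (f₁ (X.inv a)) (Y.mul (f₁ a) (Y.inv (f₁ a))) := by rw [Y.mul_inv, h2]
    _ = Y.mul (Y.mul (f₁ (X.inv a)) (f₁ a)) (Y.inv (f₁ a)) := by
      rw [Y.mul_assoc _ _ _ h2 (Y.tgt_inv _).symm]
    _ = Y.inv (f₁ a) := by rw [h1, ← Y.tgt_inv, Y.unit_mul]

/-- The source map of a fibre product of Lie groupoids. -/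
def fpSrc (x : fp hf.smooth₁ h₁) : fp hf.smooth₀ h₀ :=
  fp.mk _ _ (X.src (fp.fst x)) (Z.src (fp.snd x)) (by rw [← hf.src, ← hg.src, fp.w x])

/-- The inversion of a fibre product of Lie groupoids. -/
def fpInv (x : fp hf.smooth₁ h₁) : fp hf.smooth₁ h₁ :=
  fp.mk _ _ (X.inv (fp.fst x)) (Z.inv (fp.snd x)) (by rw [hf.inv, hg.inv, fp.w x])

/-- The units of a fibre product of Lie groupoids. -/
def fpUnit (x : fp hf.smooth₀ h₀) : fp hf.smooth₁ h₁ :=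
  fp.mk _ _ (X.unit (fp.fst x)) (Z.unit (fp.snd x)) (by rw [hf.unit, hg.unit, fp.w x])

theorem _root_.TwoBundle.LieGroupoid.inv_inv (X : LieGroupoid M A) (a : A) :
    X.inv (X.inv a) = a := by
  calc X.inv (X.inv a) = X.mul (X.inv (X.inv a)) (X.unit (X.src (X.inv (X.inv a)))) :=
        (X.mul_unit _).symm
    _ = X.mul (X.inv (X.inv a)) (X.mul (X.inv a) a) := by
      rw [X.inv_mul, X.src_inv, X.tgt_inv]
    _ = X.mul (X.mul (X.inv (X.inv a)) (X.inv a)) a := by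
      rw [X.mul_assoc _ _ _ (X.src_inv _) (X.src_inv _)]
    _ = a := by rw [X.inv_mul, X.src_inv, X.unit_mul]

theorem fpInv_smooth : Smooth (fpInv hf hg h₁) := fun _ =>
  fp.smoothWithinAt (Smooth.within (X.inv_smooth.comp fp.fst_smooth))
    (Smooth.within (Z.inv_smooth.comp fp.snd_smooth))

theorem fpUnit_smooth : Smooth (fpUnit hf hg h₀ h₁) := fun _ =>
  fp.smoothWithinAt (Smooth.within (X.unit_smooth.comp fp.fst_smooth))
    (Smooth.within (Z.unit_smooth.comp fp.snd_smooth))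

/-- Lift the `X`-component along the source map of `X`. Its image in `Y` must then be lifted to `Z`
with prescribed source, which is the purpose of `IsFibration`. -/
theorem fpSrc_surjSubmersion (hl : IsFibration Z Y g₀ g₁) :
    SurjSubmersion (fpSrc hf hg h₀ h₁) := by
  refine surjSubmersion_of_section (fun x => ?_) (fun x => ⟨fpUnit hf hg h₀ h₁ x, ?_⟩) fun x => ?_
  · exact fp.smoothWithinAt (Smooth.within (X.src_smooth.comp fp.fst_smooth))
      (Smooth.within (Z.src_smooth.comp fp.snd_smooth))
  · exact fp.ext (X.src_unit _) (Z.src_unit _)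
  · obtain ⟨a, h1, h2, h3⟩ := X.src_submersion.lift (K := fp hf.smooth₀ h₀) (S := Set.univ)
      (k := fpSrc hf hg h₀ h₁ x) (h := fp.fst) trivial (Smooth.near fp.fst_smooth) (fp.fst x) rfl
    obtain ⟨b, h1', h2', h3'⟩ := hl (k := fpSrc hf hg h₀ h₁ x) (Set.mem_univ _) (n := fp.snd)
      (y := fun p => f₁ (a p)) (Smooth.near fp.snd_smooth) (Smooth.comp_near hf.smooth₁ h2)
      (h3.mono fun p hp => by rw [hf.src, hp, fp.w p]) (fp.snd x) rfl (by rw [h1, fp.w x])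
    have h4 := h3'.mono fun p hp => hp.2.symm
    refine ⟨fun p => fp.mkD x (a p) (b p), ?_, fp.mkD_near x h2 h2' h4, ?_⟩
    · beta_reduce; rw [h1, h1', fp.mkD_eq x (fp.w x)]; rfl
    · filter_upwards [h3, h3', h4] with p h5 h6 h7
      rw [fp.mkD_eq x h7]
      exact fp.ext h5 h6.1

end IsHom

section fp

variable {X : LieGroupoid M A} {Z : LieGroupoid N B} {Y : LieGroupoid O C} {f₀ : M → O}
  {f₁ : A → C} {g₀ : N → O} {g₁ : B → C} (hf : IsHom X Y f₀ f₁) (hg : IsHom Z Y g₀ g₁)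
  (h₀ : SurjSubmersion g₀) (h₁ : SurjSubmersion g₁) (hl : IsFibration Z Y g₀ g₁)

include hg in
theorem fp_mul {p q : fp hf.smooth₁ h₁} (h : X.src (fp.fst p) = X.tgt (fp.fst q))
    (h' : Z.src (fp.snd p) = Z.tgt (fp.snd q)) :
    f₁ (X.mul (fp.fst p) (fp.fst q)) = g₁ (Z.mul (fp.snd p) (fp.snd q)) := by
  rw [hf.mul _ _ h, hg.mul _ _ h', fp.w p, fp.w q]

/-- The fibre product of Lie groupoids along a fibration. -/
def fibreProduct : LieGroupoid (fp hf.smooth₀ h₀) (fp hf.smooth₁ h₁) where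
  src := IsHom.fpSrc hf hg h₀ h₁
  -- Taken as the source of the inverse, the target is a submersion by `submersion_comp_diffeo`;
  -- that it is the componentwise target is recovered in `fst_fibreProduct_tgt` and
  -- `snd_fibreProduct_tgt`.
  tgt x := IsHom.fpSrc hf hg h₀ h₁ (IsHom.fpInv hf hg h₁ x)
  unit := IsHom.fpUnit hf hg h₀ h₁
  -- The product is total: the default value `p` is used when the componentwise products have
  -- different images in `Y`.
  mul p q := fp.mkD p (X.mul (fp.fst p) (fp.fst q)) (Z.mul (fp.snd p) (fp.snd q))
  inv := IsHom.fpInv hf hg h₁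
  src_submersion := IsHom.fpSrc_surjSubmersion hf hg h₀ h₁ hl
  tgt_submersion := by
    have h := IsHom.fpSrc_surjSubmersion hf hg h₀ h₁ hl
    have hi : ∀ x, IsHom.fpInv hf hg h₁ (IsHom.fpInv hf hg h₁ x) = x :=
      fun x => fp.ext (X.inv_inv _) (Z.inv_inv _)
    refine ⟨fun y => ?_, submersion_comp_diffeo h.2 (IsHom.fpInv_smooth hf hg h₁)
      (IsHom.fpInv_smooth hf hg h₁) hi hi⟩
    obtain ⟨x, hx⟩ := h.1 y
    exact ⟨IsHom.fpInv hf hg h₁ x, by beta_reduce; rw [hi, hx]⟩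
  unit_smooth := IsHom.fpUnit_smooth hf hg h₀ h₁
  inv_smooth := IsHom.fpInv_smooth hf hg h₁
  mul_smooth := by
    refine smoothOn_of_near fun k hk => ?_
    have h : ∀ p : fp hf.smooth₁ h₁ × fp hf.smooth₁ h₁, IsHom.fpSrc hf hg h₀ h₁ p.1 =
        IsHom.fpSrc hf hg h₀ h₁ (IsHom.fpInv hf hg h₁ p.2) →
        X.src (fp.fst p.1) = X.tgt (fp.fst p.2) ∧ Z.src (fp.snd p.1) = Z.tgt (fp.snd p.2) := by
      intro p hp
      exact ⟨(congrArg fp.fst hp).trans (X.src_inv _), (congrArg fp.snd hp).trans (Z.src_inv _)⟩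
    have hm := @eventually_mem_nhdsWithin ((fp hf.smooth₁ h₁).prod (fp hf.smooth₁ h₁)) _ k
      {p : fp hf.smooth₁ h₁ × fp hf.smooth₁ h₁ | IsHom.fpSrc hf hg h₀ h₁ p.1 =
        IsHom.fpSrc hf hg h₀ h₁ (IsHom.fpInv hf hg h₁ p.2)}
    have h1 := X.mul_near (S := {p : fp hf.smooth₁ h₁ × fp hf.smooth₁ h₁ |
        IsHom.fpSrc hf hg h₀ h₁ p.1 = IsHom.fpSrc hf hg h₀ h₁ (IsHom.fpInv hf hg h₁ p.2)}) (k := k)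
      (a := fun p => fp.fst p.1) (b := fun p => fp.fst p.2)
      (Smooth.near (fp.fst_smooth.comp smooth_fst))
      (Smooth.near (fp.fst_smooth.comp smooth_snd)) (hm.mono fun p hp => (h p hp).1)
    have h2 := Z.mul_near (S := {p : fp hf.smooth₁ h₁ × fp hf.smooth₁ h₁ |
        IsHom.fpSrc hf hg h₀ h₁ p.1 = IsHom.fpSrc hf hg h₀ h₁ (IsHom.fpInv hf hg h₁ p.2)}) (k := k)
      (a := fun p => fp.snd p.1) (b := fun p => fp.snd p.2)
      (Smooth.near (fp.snd_smooth.comp smooth_fst))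
      (Smooth.near (fp.snd_smooth.comp smooth_snd)) (hm.mono fun p hp => (h p hp).2)
    have e : ∀ᶠ p : fp hf.smooth₁ h₁ × fp hf.smooth₁ h₁ in
        𝓝[{p : fp hf.smooth₁ h₁ × fp hf.smooth₁ h₁ |
        IsHom.fpSrc hf hg h₀ h₁ p.1 = IsHom.fpSrc hf hg h₀ h₁ (IsHom.fpInv hf hg h₁ p.2)}] k,
        f₁ (X.mul (fp.fst p.1) (fp.fst p.2)) = g₁ (Z.mul (fp.snd p.1) (fp.snd p.2)) :=
      hm.mono fun p hp => fp_mul hf hg h₁ (h p hp).1 (h p hp).2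
    refine fp.near (h1.congr ?_) (h2.congr ?_)
    · filter_upwards [e] with p hp
      rw [fp.mkD_eq _ hp]; rfl
    · filter_upwards [e] with p hp
      rw [fp.mkD_eq _ hp]; rfl
  src_unit x := fp.ext (X.src_unit _) (Z.src_unit _)
  tgt_unit x := fp.ext ((X.src_inv _).trans (X.tgt_unit _)) ((Z.src_inv _).trans (Z.tgt_unit _))
  src_mul a b h := by
    have h1 := (congrArg fp.fst h).trans (X.src_inv _)
    have h2 := (congrArg fp.snd h).trans (Z.src_inv _)
    rw [fp.mkD_eq _ (fp_mul hf hg h₁ h1 h2)]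
    exact fp.ext (X.src_mul _ _ h1) (Z.src_mul _ _ h2)
  tgt_mul a b h := by
    have h1 := (congrArg fp.fst h).trans (X.src_inv _)
    have h2 := (congrArg fp.snd h).trans (Z.src_inv _)
    rw [fp.mkD_eq _ (fp_mul hf hg h₁ h1 h2)]
    exact fp.ext ((X.src_inv _).trans ((X.tgt_mul _ _ h1).trans (X.src_inv _).symm))
      ((Z.src_inv _).trans ((Z.tgt_mul _ _ h2).trans (Z.src_inv _).symm))
  mul_assoc a b c h h' := by
    have h1 := (congrArg fp.fst h).trans (X.src_inv _)
    have h2 := (congrArg fp.snd h).trans (Z.src_inv _)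
    have h1' := (congrArg fp.fst h').trans (X.src_inv _)
    have h2' := (congrArg fp.snd h').trans (Z.src_inv _)
    rw [fp.mkD_eq a (fp_mul hf hg h₁ h1 h2), fp.mkD_eq b (fp_mul hf hg h₁ h1' h2'),
      fp.mkD_eq (hf := hf.smooth₁) (hg := h₁), fp.mkD_eq (hf := hf.smooth₁) (hg := h₁)]
    · exact fp.ext (X.mul_assoc _ _ _ h1 h1') (Z.mul_assoc _ _ _ h2 h2')
    · exact fp_mul hf hg h₁ (h1.trans (X.tgt_mul _ _ h1').symm)
        (h2.trans (Z.tgt_mul _ _ h2').symm)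
    · exact fp_mul hf hg h₁ ((X.src_mul _ _ h1).trans h1') ((Z.src_mul _ _ h2).trans h2')
  unit_mul a := by
    have h1 : X.mul (X.unit (X.src (X.inv (fp.fst a)))) (fp.fst a) = fp.fst a := by
      rw [X.src_inv, X.unit_mul]
    have h2 : Z.mul (Z.unit (Z.src (Z.inv (fp.snd a)))) (fp.snd a) = fp.snd a := by
      rw [Z.src_inv, Z.unit_mul]
    exact (fp.mkD_eq _ ((congrArg f₁ h1).trans ((fp.w a).trans (congrArg g₁ h2).symm))).trans
      (fp.ext h1 h2)
  mul_unit a := by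
    have h1 : X.mul (fp.fst a) (X.unit (X.src (fp.fst a))) = fp.fst a := X.mul_unit _
    have h2 : Z.mul (fp.snd a) (Z.unit (Z.src (fp.snd a))) = fp.snd a := Z.mul_unit _
    exact (fp.mkD_eq _ ((congrArg f₁ h1).trans ((fp.w a).trans (congrArg g₁ h2).symm))).trans
      (fp.ext h1 h2)
  src_inv a := rfl
  tgt_inv a := fp.ext (congrArg X.src (X.inv_inv _)) (congrArg Z.src (Z.inv_inv _))
  inv_mul a := by
    have h1 := X.inv_mul (fp.fst a)
    have h2 := Z.inv_mul (fp.snd a)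
    refine (fp.mkD_eq _ (?_ : f₁ (X.mul (X.inv (fp.fst a)) (fp.fst a)) =
      g₁ (Z.mul (Z.inv (fp.snd a)) (fp.snd a)))).trans (fp.ext h1 h2)
    rw [h1, h2, hf.unit, hg.unit, ← hf.src, ← hg.src, fp.w a]
  mul_inv a := by
    have h1 := X.mul_inv (fp.fst a)
    have h2 := Z.mul_inv (fp.snd a)
    refine (fp.mkD_eq _ (?_ : f₁ (X.mul (fp.fst a) (X.inv (fp.fst a))) =
      g₁ (Z.mul (fp.snd a) (Z.inv (fp.snd a))))).trans (fp.ext (h1.trans ?_) (h2.trans ?_))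
    · rw [h1, h2, hf.unit, hg.unit, ← hf.tgt, ← hg.tgt, fp.w a]
    · exact congrArg X.unit (X.src_inv _).symm
    · exact congrArg Z.unit (Z.src_inv _).symm

theorem fst_fibreProduct_tgt (a : fp hf.smooth₁ h₁) :
    fp.fst ((fibreProduct hf hg h₀ h₁ hl).tgt a) = X.tgt (fp.fst a) := X.src_inv _

theorem snd_fibreProduct_tgt (a : fp hf.smooth₁ h₁) :
    fp.snd ((fibreProduct hf hg h₀ h₁ hl).tgt a) = Z.tgt (fp.snd a) := Z.src_inv _

theorem fibreProduct_mul {a b : fp hf.smooth₁ h₁}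
    (h : (fibreProduct hf hg h₀ h₁ hl).src a = (fibreProduct hf hg h₀ h₁ hl).tgt b) :
    fp.fst ((fibreProduct hf hg h₀ h₁ hl).mul a b) = X.mul (fp.fst a) (fp.fst b) ∧
      fp.snd ((fibreProduct hf hg h₀ h₁ hl).mul a b) = Z.mul (fp.snd a) (fp.snd b) := by
  have h1 := (congrArg fp.fst h).trans (X.src_inv _)
  have h2 := (congrArg fp.snd h).trans (Z.src_inv _)
  have h3 : (fibreProduct hf hg h₀ h₁ hl).mul a b = _ := fp.mkD_eq _ (fp_mul hf hg h₁ h1 h2)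
  rw [h3]
  exact ⟨rfl, rfl⟩

theorem fibreProduct_fst : IsHom (fibreProduct hf hg h₀ h₁ hl) X fp.fst fp.fst where
  smooth₀ := fp.fst_smooth
  smooth₁ := fp.fst_smooth
  src _ := rfl
  tgt _ := (fst_fibreProduct_tgt hf hg h₀ h₁ hl _).symm
  unit _ := rfl
  mul _ _ h := (fibreProduct_mul hf hg h₀ h₁ hl h).1

theorem fibreProduct_snd : IsHom (fibreProduct hf hg h₀ h₁ hl) Z fp.snd fp.snd where
  smooth₀ := fp.snd_smooth
  smooth₁ := fp.snd_smooth
  src _ := rfl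
  tgt _ := (snd_fibreProduct_tgt hf hg h₀ h₁ hl _).symm
  unit _ := rfl
  mul _ _ h := (fibreProduct_mul hf hg h₀ h₁ hl h).2

/-- Universal property. It yields functoriality of the vertical source, target and unit of the
2-groupoid fibre product from that of their components. -/
theorem fibreProduct_isHom {W : LieGroupoid L D} {k₀ : L → fp hf.smooth₀ h₀}
    {k₁ : D → fp hf.smooth₁ h₁} (h : IsHom W X (fp.fst ∘ k₀) (fp.fst ∘ k₁))
    (h' : IsHom W Z (fp.snd ∘ k₀) (fp.snd ∘ k₁)) :
    IsHom W (fibreProduct hf hg h₀ h₁ hl) k₀ k₁ := by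
  have hs : ∀ a, (fibreProduct hf hg h₀ h₁ hl).src (k₁ a) = k₀ (W.src a) :=
    fun a => fp.ext (h.src a) (h'.src a)
  have ht : ∀ a, (fibreProduct hf hg h₀ h₁ hl).tgt (k₁ a) = k₀ (W.tgt a) :=
    fun a => fp.ext ((fst_fibreProduct_tgt hf hg h₀ h₁ hl _).trans (h.tgt a))
      ((snd_fibreProduct_tgt hf hg h₀ h₁ hl _).trans (h'.tgt a))
  refine ⟨fun _ => fp.smoothWithinAt h.smooth₀.within h'.smooth₀.within,
    fun _ => fp.smoothWithinAt h.smooth₁.within h'.smooth₁.within, hs, ht,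
    fun m => fp.ext (h.unit m) (h'.unit m), fun a b hab => ?_⟩
  have h1 := fibreProduct_mul hf hg h₀ h₁ hl (a := k₁ a) (b := k₁ b) (by rw [hs, ht, hab])
  exact fp.ext ((h.mul a b hab).trans h1.1.symm) ((h'.mul a b hab).trans h1.2.symm)

end fp

end LieGroupoid

/-! ### Fibre products of Lie 2-groupoids along Morita morphisms -/

namespace Lie2Groupoid

variable {X Y Z W : Lie2Groupoid.{u}}

namespace Hom.IsMorita

variable {g : Hom Z Y} (hg : g.IsMorita)
include hg

/-- First lift the two ends through the submersion on objects, then the 1-arrow between the lifted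
ends. -/
theorem surjSubmersion₁ : SurjSubmersion g.f₁ := by
  refine surjSubmersion_of_section g.one.smooth₁ (fun y => ?_) fun b => ?_
  · obtain ⟨m, hm⟩ := hg.base.1 (Y.one.tgt y)
    obtain ⟨n, hn⟩ := hg.base.1 (Y.one.src y)
    obtain ⟨a, -, ha, -⟩ := hg.exists_arrow hm.symm hn.symm
    exact ⟨a, ha⟩
  · obtain ⟨m, h1, h2, h3⟩ := hg.base.lift (K := Y.X₁) (S := Set.univ) (k := g.f₁ b) trivial
      (Smooth.near Y.one.tgt_smooth) (Z.one.tgt b) (g.one.tgt b).symm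
    obtain ⟨n, h1', h2', h3'⟩ := hg.base.lift (K := Y.X₁) (S := Set.univ) (k := g.f₁ b) trivial
      (Smooth.near Y.one.src_smooth) (Z.one.src b) (g.one.src b).symm
    obtain ⟨a, h4, h5, h6⟩ := hg.lift_arrow (K := Y.X₁) (S := Set.univ) (k := g.f₁ b) trivial h2
      (Smooth.near contMDiff_id) h2' (h3.mono fun y hy => hy.symm) (h3'.mono fun y hy => hy.symm) b
      h1.symm rfl h1'.symm
    exact ⟨a, h4, h5, h6.mono fun y hy => hy.2.1⟩

theorem lift_cell {K : Mfd.{u}} {S : Set K} {k : K} {a b : K → Z.X₁} {y : K → Y.X₂}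
    (ha : SmoothNear a S k) (hy : SmoothNear y S k) (hb : SmoothNear b S k)
    (h : ∀ᶠ x in 𝓝[S] k, Y.ver.tgt (y x) = g.f₁ (a x) ∧ Y.ver.src (y x) = g.f₁ (b x) ∧
      Z.one.tgt (a x) = Z.one.tgt (b x) ∧ Z.one.src (a x) = Z.one.src (b x)) (hk : k ∈ S)
    (z₀ : Z.X₂) (h1 : Z.ver.tgt z₀ = a k) (h2 : g.f₂ z₀ = y k) (h3 : Z.ver.src z₀ = b k) :
    ∃ z : K → Z.X₂, z k = z₀ ∧ SmoothNear z S k ∧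
      ∀ᶠ x in 𝓝[S] k, Z.ver.tgt (z x) = a x ∧ g.f₂ (z x) = y x ∧ Z.ver.src (z x) = b x := by
  refine ⟨fun x => hg.cell (a x) (y x) (b x), ?_, hg.cell_near ha hy hb h,
    h.mono fun x hx => hg.cell_spec hx.1 hx.2.1 hx.2.2.1 hx.2.2.2⟩
  obtain ⟨e1, e2, e3, e4⟩ := h.self_of_nhdsWithin hk
  obtain ⟨h4, h5, h6⟩ := hg.cell_spec e1 e2 e3 e4
  exact hg.cell_ext (h4.trans h1.symm) (h5.trans h2.symm) (h6.trans h3.symm)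

theorem exists_cell {a b : Z.X₁} {y : Y.X₂} (h1 : Y.ver.tgt y = g.f₁ a)
    (h2 : Y.ver.src y = g.f₁ b) (h3 : Z.one.tgt a = Z.one.tgt b)
    (h4 : Z.one.src a = Z.one.src b) :
    ∃ z, Z.ver.tgt z = a ∧ g.f₂ z = y ∧ Z.ver.src z = b :=
  ⟨_, hg.cell_spec h1 h2 h3 h4⟩

/-- Lift both boundary 1-arrows with the same prescribed ends; the 2-arrow between the lifts is then
determined by its image. -/
theorem lift_hor {K : Mfd.{u}} {S : Set K} {k : K} (hk : k ∈ S) {m n : K → Z.X₀} {y : K → Y.X₂}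
    (hm : SmoothNear m S k) (hy : SmoothNear y S k) (hn : SmoothNear n S k)
    (h1 : ∀ᶠ x in 𝓝[S] k, Y.hor.tgt (y x) = g.f₀ (m x))
    (h2 : ∀ᶠ x in 𝓝[S] k, Y.hor.src (y x) = g.f₀ (n x))
    (z₀ : Z.X₂) (ht : Z.hor.tgt z₀ = m k) (hgz : g.f₂ z₀ = y k) (hs : Z.hor.src z₀ = n k) :
    ∃ z : K → Z.X₂, z k = z₀ ∧ SmoothNear z S k ∧
      ∀ᶠ x in 𝓝[S] k, Z.hor.tgt (z x) = m x ∧ g.f₂ (z x) = y x ∧ Z.hor.src (z x) = n x := by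
  obtain ⟨a, a1, a2, a3⟩ := hg.lift_arrow hk hm (Smooth.comp_near Y.ver.tgt_smooth hy) hn
    (h1.mono fun x hx => by rw [tgt_ver_tgt, hx]) (h2.mono fun x hx => by rw [src_ver_tgt, hx])
    (Z.ver.tgt z₀) (by rw [tgt_ver_tgt, ht]) (by rw [← g.ver.tgt, hgz]) (by rw [src_ver_tgt, hs])
  obtain ⟨b, b1, b2, b3⟩ := hg.lift_arrow hk hm (Smooth.comp_near Y.ver.src_smooth hy) hn
    (h1.mono fun x hx => by rw [tgt_ver_src, hx]) (h2.mono fun x hx => by rw [src_ver_src, hx])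
    (Z.ver.src z₀) (by rw [tgt_ver_src, ht]) (by rw [← g.ver.src, hgz]) (by rw [src_ver_src, hs])
  obtain ⟨z, z1, z2, z3⟩ := hg.lift_cell a2 hy b2 (by
    filter_upwards [a3, b3] with x h3 h4
    exact ⟨h3.2.1.symm, h4.2.1.symm, h3.1.trans h4.1.symm, h3.2.2.trans h4.2.2.symm⟩) hk z₀
    a1.symm hgz b1.symm
  refine ⟨z, z1, z2, ?_⟩
  filter_upwards [z3, a3] with x h3 h4
  exact ⟨by rw [← tgt_ver_tgt, h3.1, h4.1], h3.2.1, by rw [← src_ver_tgt, h3.1, h4.2.2]⟩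

theorem surjSubmersion₂ : SurjSubmersion g.f₂ := by
  refine surjSubmersion_of_section g.ver.smooth₁ (fun y => ?_) fun z => ?_
  · obtain ⟨a, ha⟩ := hg.surjSubmersion₁.1 (Y.ver.tgt y)
    obtain ⟨b, h1, h2, h3⟩ := hg.exists_arrow (m := Z.one.tgt a) (n := Z.one.src a)
      (y := Y.ver.src y) (by rw [← g.one.tgt, ha, tgt_ver_tgt, tgt_ver_src])
      (by rw [← g.one.src, ha, src_ver_tgt, src_ver_src])
    obtain ⟨z, -, hz, -⟩ := hg.exists_cell ha.symm h2.symm h1.symm h3.symm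
    exact ⟨z, hz⟩
  · obtain ⟨m, h1, h2, h3⟩ := hg.base.lift (K := Y.X₂) (S := Set.univ) (k := g.f₂ z) trivial
      (Smooth.near Y.hor.tgt_smooth) (Z.hor.tgt z) (g.hor.tgt z).symm
    obtain ⟨n, h1', h2', h3'⟩ := hg.base.lift (K := Y.X₂) (S := Set.univ) (k := g.f₂ z) trivial
      (Smooth.near Y.hor.src_smooth) (Z.hor.src z) (g.hor.src z).symm
    obtain ⟨a, h4, h5, h6⟩ := hg.lift_hor (K := Y.X₂) (S := Set.univ) (k := g.f₂ z) trivial h2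
      (Smooth.near contMDiff_id) h2' (h3.mono fun y hy => hy.symm) (h3'.mono fun y hy => hy.symm) z
      h1.symm rfl h1'.symm
    exact ⟨a, h4, h5, h6.mono fun y hy => hy.2.1⟩

theorem isFibration_one : LieGroupoid.IsFibration Z.one Y.one g.f₀ g.f₁ := by
  intro K S k hk n y hn hy h b₀ hb hgb
  obtain ⟨m, h1, h2, h3⟩ := hg.base.lift hk (Smooth.comp_near Y.one.tgt_smooth hy) (Z.one.tgt b₀)
    (by rw [← g.one.tgt, hgb])
  obtain ⟨b, h4, h5, h6⟩ := hg.lift_arrow hk h2 hy hn (h3.mono fun y hy => hy.symm) h b₀ h1.symm hgb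
    hb
  exact ⟨b, h4, h5, h6.mono fun x hx => ⟨hx.2.2, hx.2.1⟩⟩

theorem isFibration_hor : LieGroupoid.IsFibration Z.hor Y.hor g.f₀ g.f₂ := by
  intro K S k hk n y hn hy h b₀ hb hgb
  obtain ⟨m, h1, h2, h3⟩ := hg.base.lift hk (Smooth.comp_near Y.hor.tgt_smooth hy) (Z.hor.tgt b₀)
    (by rw [← g.hor.tgt, hgb])
  obtain ⟨b, h4, h5, h6⟩ := hg.lift_hor hk h2 hy hn (h3.mono fun y hy => hy.symm) h b₀ h1.symm hgb
    hb
  exact ⟨b, h4, h5, h6.mono fun x hx => ⟨hx.2.2, hx.2.1⟩⟩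

/-- Only the target 1-arrow remains to be lifted, with the ends of the given source 1-arrow; the
2-arrow follows by filling in. -/
theorem isFibration_ver : LieGroupoid.IsFibration Z.ver Y.ver g.f₁ g.f₂ := by
  intro K S k hk n y hn hy h z₀ hz hgz
  obtain ⟨a, a1, a2, a3⟩ := hg.lift_arrow hk (Smooth.comp_near Z.one.tgt_smooth hn)
    (Smooth.comp_near Y.ver.tgt_smooth hy) (Smooth.comp_near Z.one.src_smooth hn)
    (h.mono fun x hx => by rw [tgt_ver_tgt, ← tgt_ver_src, hx, g.one.tgt])
    (h.mono fun x hx => by rw [src_ver_tgt, ← src_ver_src, hx, g.one.src]) (Z.ver.tgt z₀)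
    (by rw [← hz, tgt_ver_tgt, tgt_ver_src]) (by rw [← hgz, g.ver.tgt])
    (by rw [← hz, src_ver_tgt, src_ver_src])
  obtain ⟨z, z1, z2, z3⟩ := hg.lift_cell a2 hy hn (by
    filter_upwards [a3, h] with x h3 h4
    exact ⟨h3.2.1.symm, h4, h3.1, h3.2.2⟩) hk z₀ a1.symm hgz hz
  exact ⟨z, z1, z2, z3.mono fun x hx => ⟨hx.2.2, hx.2.1⟩⟩

end Hom.IsMorita

section Pullback

variable (f : Hom X Y) {g : Hom Z Y} (hg : g.IsMorita)

/-- The 1-arrows of a fibre product of Lie 2-groupoids. -/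
abbrev pullbackOne := LieGroupoid.fibreProduct f.one g.one hg.base hg.surjSubmersion₁
  hg.isFibration_one

/-- The vertical composition of a fibre product of Lie 2-groupoids. -/
abbrev pullbackVer := LieGroupoid.fibreProduct f.ver g.ver hg.surjSubmersion₁ hg.surjSubmersion₂
  hg.isFibration_ver

/-- The horizontal composition of a fibre product of Lie 2-groupoids. -/
abbrev pullbackHor := LieGroupoid.fibreProduct f.hor g.hor hg.base hg.surjSubmersion₂
  hg.isFibration_hor

theorem pullback_src_hom :
    LieGroupoid.IsHom (pullbackHor f hg) (pullbackOne f hg) id (pullbackVer f hg).src :=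
  LieGroupoid.fibreProduct_isHom _ _ _ _ _
    (X.src_hom.comp (LieGroupoid.fibreProduct_fst _ _ _ _ _))
    (Z.src_hom.comp (LieGroupoid.fibreProduct_snd _ _ _ _ _))

theorem pullback_tgt_hom :
    LieGroupoid.IsHom (pullbackHor f hg) (pullbackOne f hg) id (pullbackVer f hg).tgt := by
  refine LieGroupoid.fibreProduct_isHom _ _ _ _ _ ?_ ?_
  · have h := X.tgt_hom.comp (LieGroupoid.fibreProduct_fst f.hor g.hor hg.base hg.surjSubmersion₂
      hg.isFibration_hor)
    have e : X.ver.tgt ∘ fp.fst = fp.fst ∘ (pullbackVer f hg).tgt :=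
      funext fun x => (LieGroupoid.fst_fibreProduct_tgt f.ver g.ver hg.surjSubmersion₁
        hg.surjSubmersion₂ hg.isFibration_ver x).symm
    rwa [e] at h
  · have h := Z.tgt_hom.comp (LieGroupoid.fibreProduct_snd f.hor g.hor hg.base hg.surjSubmersion₂
      hg.isFibration_hor)
    have e : Z.ver.tgt ∘ fp.snd = fp.snd ∘ (pullbackVer f hg).tgt :=
      funext fun x => (LieGroupoid.snd_fibreProduct_tgt f.ver g.ver hg.surjSubmersion₁
        hg.surjSubmersion₂ hg.isFibration_ver x).symm
    rwa [e] at h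

/-- The fibre product of Lie 2-groupoids along a Morita morphism. -/
def pullback : Lie2Groupoid.{u} where
  X₀ := fp f.one.smooth₀ hg.base
  X₁ := fp f.one.smooth₁ hg.surjSubmersion₁
  X₂ := fp f.ver.smooth₁ hg.surjSubmersion₂
  one := pullbackOne f hg
  ver := pullbackVer f hg
  hor := pullbackHor f hg
  src_hom := pullback_src_hom f hg
  tgt_hom := pullback_tgt_hom f hg
  unit_hom := LieGroupoid.fibreProduct_isHom _ _ _ _ _
    (X.unit_hom.comp (LieGroupoid.fibreProduct_fst _ _ _ _ _))
    (Z.unit_hom.comp (LieGroupoid.fibreProduct_snd _ _ _ _ _))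
  interchange a b c d h1 h2 h3 := by
    have hs := (pullback_src_hom f hg).src
    have ht := (pullback_src_hom f hg).tgt
    have hs' := (pullback_tgt_hom f hg).src
    have ht' := (pullback_tgt_hom f hg).tgt
    simp only [id] at hs ht hs' ht'
    have h4 : (pullbackHor f hg).src b = (pullbackHor f hg).tgt d := by
      rw [← hs', ← h1, hs, h3, ← ht, h2, ht']
    have h5 : (pullbackHor f hg).src ((pullbackVer f hg).mul a b) =
        (pullbackHor f hg).tgt ((pullbackVer f hg).mul c d) := by
      rw [← hs', (pullbackVer f hg).tgt_mul _ _ h1, hs', h3, ← ht', ← ht',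
        (pullbackVer f hg).tgt_mul _ _ h2]
    have h6 : (pullbackVer f hg).src ((pullbackHor f hg).mul a c) =
        (pullbackVer f hg).tgt ((pullbackHor f hg).mul b d) := by
      rw [(pullback_src_hom f hg).mul _ _ h3, (pullback_tgt_hom f hg).mul _ _ h4, h1, h2]
    obtain ⟨e1, e1'⟩ := LieGroupoid.fibreProduct_mul _ _ _ _ hg.isFibration_hor h5
    obtain ⟨e2, e2'⟩ := LieGroupoid.fibreProduct_mul _ _ _ _ hg.isFibration_ver h6
    obtain ⟨e3, e3'⟩ := LieGroupoid.fibreProduct_mul _ _ _ _ hg.isFibration_ver h1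
    obtain ⟨e4, e4'⟩ := LieGroupoid.fibreProduct_mul _ _ _ _ hg.isFibration_ver h2
    obtain ⟨e5, e5'⟩ := LieGroupoid.fibreProduct_mul _ _ _ _ hg.isFibration_hor h3
    obtain ⟨e6, e6'⟩ := LieGroupoid.fibreProduct_mul _ _ _ _ hg.isFibration_hor h4
    have hv : ∀ {p q : fp f.ver.smooth₁ hg.surjSubmersion₂},
        (pullbackVer f hg).src p = (pullbackVer f hg).tgt q →
        X.ver.src (fp.fst p) = X.ver.tgt (fp.fst q) ∧ Z.ver.src (fp.snd p) = Z.ver.tgt (fp.snd q) :=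
      fun h => ⟨(congrArg fp.fst h).trans (X.ver.src_inv _),
        (congrArg fp.snd h).trans (Z.ver.src_inv _)⟩
    refine fp.ext ?_ ?_
    · rw [e1, e2, e3, e4, e5, e6]
      exact X.interchange _ _ _ _ (hv h1).1 (hv h2).1
        ((congrArg fp.fst h3).trans (X.hor.src_inv _))
    · rw [e1', e2', e3', e4', e5', e6']
      exact Z.interchange _ _ _ _ (hv h1).2 (hv h2).2
        ((congrArg fp.snd h3).trans (Z.hor.src_inv _))

/-- The first projection of a fibre product of Lie 2-groupoids. -/
def pullbackFst : Hom (pullback f hg) X where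
  f₀ := fp.fst
  f₁ := fp.fst
  f₂ := fp.fst
  one := LieGroupoid.fibreProduct_fst _ _ _ _ hg.isFibration_one
  ver := LieGroupoid.fibreProduct_fst _ _ _ _ hg.isFibration_ver
  hor := LieGroupoid.fibreProduct_fst _ _ _ _ hg.isFibration_hor

/-- The second projection of a fibre product of Lie 2-groupoids. -/
def pullbackSnd : Hom (pullback f hg) Z where
  f₀ := fp.snd
  f₁ := fp.snd
  f₂ := fp.snd
  one := LieGroupoid.fibreProduct_snd _ _ _ _ hg.isFibration_one
  ver := LieGroupoid.fibreProduct_snd _ _ _ _ hg.isFibration_ver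
  hor := LieGroupoid.fibreProduct_snd _ _ _ _ hg.isFibration_hor

theorem pullback_w : f.comp (pullbackFst f hg) = g.comp (pullbackSnd f hg) :=
  Hom.ext (funext fun x => fp.w (hf := f.one.smooth₀) (hg := hg.base) x)
    (funext fun x => fp.w (hf := f.one.smooth₁) (hg := hg.surjSubmersion₁) x)
    (funext fun x => fp.w (hf := f.ver.smooth₁) (hg := hg.surjSubmersion₂) x)

/-- Stability under base change: the `X`-component of a lift is given, and its image in `Y` lifts
through `g` with the prescribed boundary. -/
theorem pullbackFst_isMorita : (pullbackFst f hg).IsMorita := by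
  refine Hom.isMorita_of fp.fst_surjSubmersion ?_ ?_ ?_ ?_ ?_
  · intro m y n h1 h2
    obtain ⟨z, e1, e2, e3⟩ := hg.exists_arrow (m := fp.snd m) (n := fp.snd n) (y := f.f₁ y)
      (by rw [f.one.tgt, h1]; exact fp.w m) (by rw [f.one.src, h2]; exact fp.w n)
    exact ⟨fp.mk f.one.smooth₁ hg.surjSubmersion₁ y z e2.symm,
      fp.ext ((LieGroupoid.fst_fibreProduct_tgt _ _ _ _ hg.isFibration_one _).trans h1)
        ((LieGroupoid.snd_fibreProduct_tgt _ _ _ _ hg.isFibration_one _).trans e1), rfl,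
      fp.ext h2 e3⟩
  · intro a
    have hk := (pullbackFst f hg).arrowFrame_mem a
    have hm := @eventually_mem_nhdsWithin _ _ ((pullbackFst f hg).arrowFrame a)
      (LieGroupoid.pullbackArrows X.one (pullbackFst f hg).f₀)
    obtain ⟨z, h1, h2, h3⟩ := hg.lift_arrow
      (K := (pullback f hg).X₀.prod (X.X₁.prod (pullback f hg).X₀)) hk
      (m := fun p => fp.snd p.1) (y := fun p => f.f₁ p.2.1) (n := fun p => fp.snd p.2.2)
      (Smooth.near (fp.snd_smooth.comp smooth_fst))
      (Smooth.near (f.one.smooth₁.comp (smooth_fst.comp smooth_snd)))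
      (Smooth.near (fp.snd_smooth.comp (smooth_snd.comp smooth_snd)))
      (hm.mono fun p hp => by rw [f.one.tgt, hp.1]; exact fp.w _)
      (hm.mono fun p hp => by rw [f.one.src, hp.2]; exact fp.w _) (fp.snd a)
      (LieGroupoid.snd_fibreProduct_tgt _ _ _ _ hg.isFibration_one _).symm (fp.w a).symm rfl
    have h4 := h3.mono fun p hp => hp.2.1.symm
    refine ⟨fun p => fp.mkD a p.2.1 (z p), ?_, fp.mkD_near a
      (Smooth.near (smooth_fst.comp smooth_snd)) h2 h4, ?_⟩
    · beta_reduce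
      rw [h1]
      exact fp.mkD_eq (hf := f.one.smooth₁) (hg := hg.surjSubmersion₁) a (fp.w a)
    · filter_upwards [h3, h4, hm] with p h5 h6 h7
      rw [fp.mkD_eq a h6]
      exact Prod.ext (fp.ext ((LieGroupoid.fst_fibreProduct_tgt _ _ _ _ hg.isFibration_one _).trans
        h7.1) ((LieGroupoid.snd_fibreProduct_tgt _ _ _ _ hg.isFibration_one _).trans h5.1))
        (Prod.ext rfl (fp.ext h7.2 h5.2.2))
  · intro a y b h1 h2 h3 h4
    have h3' := ((LieGroupoid.snd_fibreProduct_tgt _ _ _ _ hg.isFibration_one a).symm.trans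
      ((congrArg fp.snd h3).trans
        (LieGroupoid.snd_fibreProduct_tgt _ _ _ _ hg.isFibration_one b)))
    obtain ⟨z, e1, e2, e3⟩ := hg.exists_cell (a := fp.snd a) (b := fp.snd b) (y := f.f₂ y)
      (by rw [f.ver.tgt, h1]; exact fp.w a) (by rw [f.ver.src, h2]; exact fp.w b) h3'
      (congrArg fp.snd h4)
    exact ⟨fp.mk f.ver.smooth₁ hg.surjSubmersion₂ y z e2.symm,
      fp.ext ((LieGroupoid.fst_fibreProduct_tgt _ _ _ _ hg.isFibration_ver _).trans h1)
        ((LieGroupoid.snd_fibreProduct_tgt _ _ _ _ hg.isFibration_ver _).trans e1), rfl,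
      fp.ext h2 e3⟩
  · intro x
    have hk := (pullbackFst f hg).cellFrame_mem x
    have hm := @eventually_mem_nhdsWithin _ _ ((pullbackFst f hg).cellFrame x)
      (pullbackFst f hg).cellSet
    obtain ⟨z, h1, h2, h3⟩ := hg.lift_cell
      (K := (pullback f hg).X₁.prod (X.X₂.prod (pullback f hg).X₁))
      (a := fun p => fp.snd p.1) (y := fun p => f.f₂ p.2.1) (b := fun p => fp.snd p.2.2)
      (Smooth.near (fp.snd_smooth.comp smooth_fst))
      (Smooth.near (f.ver.smooth₁.comp (smooth_fst.comp smooth_snd)))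
      (Smooth.near (fp.snd_smooth.comp (smooth_snd.comp smooth_snd)))
      (hm.mono fun p hp => ⟨by rw [f.ver.tgt, hp.1]; exact fp.w _,
        by rw [f.ver.src, hp.2.1]; exact fp.w _,
        ((LieGroupoid.snd_fibreProduct_tgt _ _ _ _ hg.isFibration_one p.1).symm.trans
          ((congrArg fp.snd hp.2.2.1).trans
            (LieGroupoid.snd_fibreProduct_tgt _ _ _ _ hg.isFibration_one p.2.2))),
        congrArg fp.snd hp.2.2.2⟩) hk (fp.snd x)
      (LieGroupoid.snd_fibreProduct_tgt _ _ _ _ hg.isFibration_ver _).symm (fp.w x).symm rfl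
    have h4 := h3.mono fun p hp => hp.2.1.symm
    refine ⟨fun p => fp.mkD x p.2.1 (z p), ?_, fp.mkD_near x
      (Smooth.near (smooth_fst.comp smooth_snd)) h2 h4, ?_⟩
    · beta_reduce
      rw [h1]
      exact fp.mkD_eq (hf := f.ver.smooth₁) (hg := hg.surjSubmersion₂) x (fp.w x)
    · filter_upwards [h3, h4, hm] with p h5 h6 h7
      rw [fp.mkD_eq x h6]
      exact Prod.ext (fp.ext ((LieGroupoid.fst_fibreProduct_tgt _ _ _ _ hg.isFibration_ver _).trans
        h7.1) ((LieGroupoid.snd_fibreProduct_tgt _ _ _ _ hg.isFibration_ver _).trans h5.1))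
        (Prod.ext rfl (fp.ext h7.2.1 h5.2.2))
  · intro x x' h1 h2 h3
    exact fp.ext h2 (hg.cell_ext
      ((LieGroupoid.snd_fibreProduct_tgt _ _ _ _ hg.isFibration_ver x).symm.trans
        ((congrArg fp.snd h1).trans
          (LieGroupoid.snd_fibreProduct_tgt _ _ _ _ hg.isFibration_ver x')))
      ((fp.w x).symm.trans ((congrArg f.f₂ h2).trans (fp.w x'))) (congrArg fp.snd h3))

-- The mirror image of the previous argument, with lifts through `f`. It is what carries a Morita
-- morphism back along the backward arrows of a zigzag.
variable {f} in
theorem pullbackSnd_isMorita (hf : f.IsMorita) : (pullbackSnd f hg).IsMorita := by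
  refine Hom.isMorita_of (fp.snd_surjSubmersion hf.base) ?_ ?_ ?_ ?_ ?_
  · intro m y n h1 h2
    obtain ⟨z, e1, e2, e3⟩ := hf.exists_arrow (m := fp.fst m) (n := fp.fst n) (y := g.f₁ y)
      (by rw [g.one.tgt, h1]; exact (fp.w m).symm) (by rw [g.one.src, h2]; exact (fp.w n).symm)
    exact ⟨fp.mk f.one.smooth₁ hg.surjSubmersion₁ z y e2,
      fp.ext ((LieGroupoid.fst_fibreProduct_tgt _ _ _ _ hg.isFibration_one _).trans e1)
        ((LieGroupoid.snd_fibreProduct_tgt _ _ _ _ hg.isFibration_one _).trans h1), rfl,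
      fp.ext e3 h2⟩
  · intro a
    have hk := (pullbackSnd f hg).arrowFrame_mem a
    have hm := @eventually_mem_nhdsWithin _ _ ((pullbackSnd f hg).arrowFrame a)
      (LieGroupoid.pullbackArrows Z.one (pullbackSnd f hg).f₀)
    obtain ⟨z, h1, h2, h3⟩ := hf.lift_arrow
      (K := (pullback f hg).X₀.prod (Z.X₁.prod (pullback f hg).X₀)) hk
      (m := fun p => fp.fst p.1) (y := fun p => g.f₁ p.2.1) (n := fun p => fp.fst p.2.2)
      (Smooth.near (fp.fst_smooth.comp smooth_fst))
      (Smooth.near (g.one.smooth₁.comp (smooth_fst.comp smooth_snd)))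
      (Smooth.near (fp.fst_smooth.comp (smooth_snd.comp smooth_snd)))
      (hm.mono fun p hp => by rw [g.one.tgt, hp.1]; exact (fp.w _).symm)
      (hm.mono fun p hp => by rw [g.one.src, hp.2]; exact (fp.w _).symm) (fp.fst a)
      (LieGroupoid.fst_fibreProduct_tgt _ _ _ _ hg.isFibration_one _).symm (fp.w a) rfl
    have h4 := h3.mono fun p hp => hp.2.1
    refine ⟨fun p => fp.mkD a (z p) p.2.1, ?_, fp.mkD_near a h2
      (Smooth.near (smooth_fst.comp smooth_snd)) h4, ?_⟩
    · beta_reduce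
      rw [h1]
      exact fp.mkD_eq (hf := f.one.smooth₁) (hg := hg.surjSubmersion₁) a (fp.w a)
    · filter_upwards [h3, h4, hm] with p h5 h6 h7
      rw [fp.mkD_eq a h6]
      exact Prod.ext (fp.ext ((LieGroupoid.fst_fibreProduct_tgt _ _ _ _ hg.isFibration_one _).trans
        h5.1) ((LieGroupoid.snd_fibreProduct_tgt _ _ _ _ hg.isFibration_one _).trans h7.1))
        (Prod.ext rfl (fp.ext h5.2.2 h7.2))
  · intro a y b h1 h2 h3 h4
    have h3' := ((LieGroupoid.fst_fibreProduct_tgt _ _ _ _ hg.isFibration_one a).symm.trans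
      ((congrArg fp.fst h3).trans
        (LieGroupoid.fst_fibreProduct_tgt _ _ _ _ hg.isFibration_one b)))
    obtain ⟨z, e1, e2, e3⟩ := hf.exists_cell (a := fp.fst a) (b := fp.fst b) (y := g.f₂ y)
      (by rw [g.ver.tgt, h1]; exact (fp.w a).symm) (by rw [g.ver.src, h2]; exact (fp.w b).symm) h3'
      (congrArg fp.fst h4)
    exact ⟨fp.mk f.ver.smooth₁ hg.surjSubmersion₂ z y e2,
      fp.ext ((LieGroupoid.fst_fibreProduct_tgt _ _ _ _ hg.isFibration_ver _).trans e1)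
        ((LieGroupoid.snd_fibreProduct_tgt _ _ _ _ hg.isFibration_ver _).trans h1), rfl,
      fp.ext e3 h2⟩
  · intro x
    have hk := (pullbackSnd f hg).cellFrame_mem x
    have hm := @eventually_mem_nhdsWithin _ _ ((pullbackSnd f hg).cellFrame x)
      (pullbackSnd f hg).cellSet
    obtain ⟨z, h1, h2, h3⟩ := hf.lift_cell
      (K := (pullback f hg).X₁.prod (Z.X₂.prod (pullback f hg).X₁))
      (a := fun p => fp.fst p.1) (y := fun p => g.f₂ p.2.1) (b := fun p => fp.fst p.2.2)
      (Smooth.near (fp.fst_smooth.comp smooth_fst))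
      (Smooth.near (g.ver.smooth₁.comp (smooth_fst.comp smooth_snd)))
      (Smooth.near (fp.fst_smooth.comp (smooth_snd.comp smooth_snd)))
      (hm.mono fun p hp => ⟨by rw [g.ver.tgt, hp.1]; exact (fp.w _).symm,
        by rw [g.ver.src, hp.2.1]; exact (fp.w _).symm,
        ((LieGroupoid.fst_fibreProduct_tgt _ _ _ _ hg.isFibration_one p.1).symm.trans
          ((congrArg fp.fst hp.2.2.1).trans
            (LieGroupoid.fst_fibreProduct_tgt _ _ _ _ hg.isFibration_one p.2.2))),
        congrArg fp.fst hp.2.2.2⟩) hk (fp.fst x)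
      (LieGroupoid.fst_fibreProduct_tgt _ _ _ _ hg.isFibration_ver _).symm (fp.w x) rfl
    have h4 := h3.mono fun p hp => hp.2.1
    refine ⟨fun p => fp.mkD x (z p) p.2.1, ?_, fp.mkD_near x h2
      (Smooth.near (smooth_fst.comp smooth_snd)) h4, ?_⟩
    · beta_reduce
      rw [h1]
      exact fp.mkD_eq (hf := f.ver.smooth₁) (hg := hg.surjSubmersion₂) x (fp.w x)
    · filter_upwards [h3, h4, hm] with p h5 h6 h7
      rw [fp.mkD_eq x h6]
      exact Prod.ext (fp.ext ((LieGroupoid.fst_fibreProduct_tgt _ _ _ _ hg.isFibration_ver _).trans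
        h5.1) ((LieGroupoid.snd_fibreProduct_tgt _ _ _ _ hg.isFibration_ver _).trans h7.1))
        (Prod.ext rfl (fp.ext h5.2.2 h7.2.1))
  · intro x x' h1 h2 h3
    exact fp.ext (hf.cell_ext
      ((LieGroupoid.fst_fibreProduct_tgt _ _ _ _ hg.isFibration_ver x).symm.trans
        ((congrArg fp.fst h1).trans
          (LieGroupoid.fst_fibreProduct_tgt _ _ _ _ hg.isFibration_ver x')))
      ((fp.w x).trans ((congrArg g.f₂ h2).trans (fp.w x').symm)) (congrArg fp.fst h3)) h2

end Pullback

end Lie2Groupoid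

/-! ### Natural 2-transformations and their lifting -/

namespace LieGroupoid

/-- The pair groupoid, with one arrow between any two points. -/
def pair (M : Mfd.{u}) : LieGroupoid M (M.prod M) where
  src := Prod.snd
  tgt := Prod.fst
  unit m := ((m, m) : M × M)
  mul := fun p q : M × M => ((p.1, q.2) : M × M)
  inv := fun p : M × M => ((p.2, p.1) : M × M)
  src_submersion := ⟨fun m => ⟨((m, m) : M × M), rfl⟩, submersion_snd⟩
  tgt_submersion := ⟨fun m => ⟨((m, m) : M × M), rfl⟩, submersion_comp_fst .id⟩
  unit_smooth := Smooth.pair contMDiff_id contMDiff_id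
  inv_smooth := Smooth.pair smooth_snd smooth_fst
  mul_smooth := SmoothOn.pair (smooth_fst.comp_contMDiffOn smoothOn_fst)
    (smooth_snd.comp_contMDiffOn smoothOn_snd)
  src_unit _ := rfl
  tgt_unit _ := rfl
  src_mul _ _ _ := rfl
  tgt_mul _ _ _ := rfl
  mul_assoc _ _ _ _ _ := rfl
  unit_mul _ := rfl
  mul_unit _ := rfl
  src_inv _ := rfl
  tgt_inv _ := rfl
  inv_mul _ := rfl
  mul_inv _ := rfl

variable {M A N : Mfd.{u}}

theorem pair_isHom (X : LieGroupoid M A) :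
    IsHom X (pair M) id (fun a => ((X.tgt a, X.src a) : M × M)) where
  smooth₀ := contMDiff_id
  smooth₁ := Smooth.pair X.tgt_smooth X.src_smooth
  src _ := rfl
  tgt _ := rfl
  unit m := Prod.ext (X.tgt_unit m) (X.src_unit m)
  mul a b h := Prod.ext (X.tgt_mul a b h) (X.src_mul a b h)

theorem pair_map_isHom {p : N → M} (hp : Smooth p) :
    IsHom (pair N) (pair M) p (fun x : N × N => ((p x.1, p x.2) : M × M)) where
  smooth₀ := hp
  smooth₁ := Smooth.pair (hp.comp smooth_fst) (hp.comp smooth_snd)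
  src _ := rfl
  tgt _ := rfl
  unit _ := rfl
  mul _ _ _ := rfl

theorem IsHom.discrete {f : N → M} (hf : Smooth f) : IsHom (discrete N) (discrete M) f f where
  smooth₀ := hf
  smooth₁ := hf
  src _ := rfl
  tgt _ := rfl
  unit _ := rfl
  mul _ _ _ := rfl

end LieGroupoid

namespace Lie2Groupoid

variable {X Y Z W D : Lie2Groupoid.{u}}

/-- The morphism from a Lie 2-groupoid to the pair groupoid of its objects. -/
def toPair (X : Lie2Groupoid.{u}) : Hom X (ofGroupoid (.pair X.X₀)) where
  f₀ := id
  f₁ a := ((X.one.tgt a, X.one.src a) : X.X₀ × X.X₀)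
  f₂ x := ((X.hor.tgt x, X.hor.src x) : X.X₀ × X.X₀)
  one := X.one.pair_isHom
  hor := X.hor.pair_isHom
  ver :=
    { smooth₀ := X.one.pair_isHom.smooth₁
      smooth₁ := X.hor.pair_isHom.smooth₁
      src := fun x => Prod.ext (X.tgt_ver_src x).symm (X.src_ver_src x).symm
      tgt := fun x => Prod.ext (X.tgt_ver_tgt x).symm (X.src_ver_tgt x).symm
      unit := fun a => Prod.ext (X.unit_hom.tgt a) (X.unit_hom.src a)
      mul := fun a b h => Prod.ext
        (by change X.hor.tgt _ = X.hor.tgt a; rw [← tgt_ver_tgt, X.ver.tgt_mul _ _ h, tgt_ver_tgt])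
        (by change X.hor.src _ = X.hor.src a; rw [← src_ver_tgt, X.ver.tgt_mul _ _ h, src_ver_tgt]) }

/-- The morphism of pair groupoids defined by a map. -/
def pairMap {M N : Mfd.{u}} {p : N → M} (hp : Smooth p) :
    Hom (ofGroupoid (.pair N)) (ofGroupoid (.pair M)) where
  f₀ := p
  f₁ := fun x : N × N => ((p x.1, p x.2) : M × M)
  f₂ := fun x : N × N => ((p x.1, p x.2) : M × M)
  one := LieGroupoid.pair_map_isHom hp
  hor := LieGroupoid.pair_map_isHom hp
  ver := LieGroupoid.IsHom.discrete (LieGroupoid.pair_map_isHom hp).smooth₁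

/-- Gives refinements with prescribed objects: the fibre product of this morphism with `toPair D`,
where `M` is the manifold of objects of `D`, is Morita over `D`, and its objects map to `N`. -/
theorem pairMap_isMorita {M N : Mfd.{u}} {p : N → M} (hp : SurjSubmersion p) :
    (pairMap hp.smooth).IsMorita := by
  refine Hom.isMorita_of hp ?_ ?_ ?_ ?_ ?_
  · intro m y n h1 h2
    exact ⟨((m, n) : N × N), rfl, Prod.ext h1.symm h2.symm, rfl⟩
  · intro a
    refine ⟨fun q => ((q.1, q.2.2) : N × N), rfl,
      Smooth.near (Smooth.pair smooth_fst (smooth_snd.comp smooth_snd)), ?_⟩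
    filter_upwards [eventually_mem_nhdsWithin] with q hq
    exact Prod.ext rfl (Prod.ext (Prod.ext hq.1.symm hq.2.symm) rfl)
  · intro a y b h1 _ h3 h4
    exact ⟨a, rfl, h1.symm, Prod.ext h3 h4⟩
  · intro a
    refine ⟨fun q => q.1, rfl, Smooth.near smooth_fst, ?_⟩
    filter_upwards [eventually_mem_nhdsWithin] with q hq
    exact Prod.ext rfl (Prod.ext hq.1.symm (Prod.ext hq.2.2.1 hq.2.2.2))
  · exact fun x x' h _ _ => h

theorem ver_src_hor {a b : X.X₂} (h : X.hor.src a = X.hor.tgt b) :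
    X.ver.src (X.hor.mul a b) = X.one.mul (X.ver.src a) (X.ver.src b) := X.src_hom.mul a b h

theorem ver_tgt_hor {a b : X.X₂} (h : X.hor.src a = X.hor.tgt b) :
    X.ver.tgt (X.hor.mul a b) = X.one.mul (X.ver.tgt a) (X.ver.tgt b) := X.tgt_hom.mul a b h

theorem hor_src_unit (a : X.X₁) : X.hor.src (X.ver.unit a) = X.one.src a := X.unit_hom.src a
theorem hor_tgt_unit (a : X.X₁) : X.hor.tgt (X.ver.unit a) = X.one.tgt a := X.unit_hom.tgt a

theorem ver_unit_mul {a b : X.X₁} (h : X.one.src a = X.one.tgt b) :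
    X.ver.unit (X.one.mul a b) = X.hor.mul (X.ver.unit a) (X.ver.unit b) := X.unit_hom.mul a b h

theorem ver_unit_unit (m : X.X₀) : X.ver.unit (X.one.unit m) = X.hor.unit m := X.unit_hom.unit m

namespace Hom

namespace NatTrans

/-- The identity transformation. -/
def refl (f : Hom X Y) : NatTrans f f where
  φ m := Y.one.unit (f.f₀ m)
  ψ j := Y.ver.unit (f.f₁ j)
  smooth_φ := Y.one.unit_smooth.comp f.one.smooth₀
  smooth_ψ := Y.ver.unit_smooth.comp f.one.smooth₁
  src_φ m := Y.one.src_unit _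
  tgt_φ m := Y.one.tgt_unit _
  src_ψ j := by rw [Y.ver.src_unit, ← f.one.tgt, Y.one.unit_mul]
  tgt_ψ j := by rw [Y.ver.tgt_unit, ← f.one.src, Y.one.mul_unit]
  naturality x := by
    rw [ver_unit_unit, ver_unit_unit, ← f.hor.src, ← f.hor.tgt, Y.hor.mul_unit, Y.hor.unit_mul,
      ← f.ver.src, ← f.ver.tgt, Y.ver.mul_unit, Y.ver.unit_mul]
  map_mul j i h := by
    have h' : Y.one.src (f.f₁ j) = Y.one.tgt (f.f₁ i) := by rw [f.one.src, f.one.tgt, h]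
    rw [f.one.mul _ _ h, ver_unit_mul h']
    have := Y.ver.unit_mul (Y.hor.mul (Y.ver.unit (f.f₁ j)) (Y.ver.unit (f.f₁ i)))
    rw [ver_tgt_hor (by rw [hor_src_unit, hor_tgt_unit, h']), Y.ver.tgt_unit, Y.ver.tgt_unit,
      ver_unit_mul h'] at this
    exact this.symm

/-- Precomposition of a transformation with a morphism. -/
def precomp {f g : Hom X Y} (α : NatTrans f g) (h : Hom W X) :
    NatTrans (f.comp h) (g.comp h) where
  φ m := α.φ (h.f₀ m)
  ψ j := α.ψ (h.f₁ j)
  smooth_φ := α.smooth_φ.comp h.one.smooth₀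
  smooth_ψ := α.smooth_ψ.comp h.one.smooth₁
  src_φ m := α.src_φ _
  tgt_φ m := α.tgt_φ _
  src_ψ j := by rw [α.src_ψ, h.one.tgt]; rfl
  tgt_ψ j := by rw [α.tgt_ψ, h.one.src]; rfl
  naturality x := by
    have := α.naturality (h.f₂ x)
    rwa [h.hor.src, h.hor.tgt, h.ver.src, h.ver.tgt] at this
  map_mul j i hji := by
    rw [h.one.mul _ _ hji]
    exact α.map_mul _ _ (by rw [h.one.src, h.one.tgt, hji])

/-- Postcomposition of a transformation with a morphism. -/
def postcomp {f g : Hom X Y} (α : NatTrans f g) (k : Hom Y Z) :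
    NatTrans (k.comp f) (k.comp g) where
  φ m := k.f₁ (α.φ m)
  ψ j := k.f₂ (α.ψ j)
  smooth_φ := k.one.smooth₁.comp α.smooth_φ
  smooth_ψ := k.ver.smooth₁.comp α.smooth_ψ
  src_φ m := by rw [k.one.src, α.src_φ]; rfl
  tgt_φ m := by rw [k.one.tgt, α.tgt_φ]; rfl
  src_ψ j := by rw [k.ver.src, α.src_ψ, k.one.mul _ _ (by rw [α.src_φ, f.one.tgt])]; rfl
  tgt_ψ j := by rw [k.ver.tgt, α.tgt_ψ, k.one.mul _ _ (by rw [α.tgt_φ, g.one.src])]; rfl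
  naturality x := by
    have h1 : Y.hor.src (g.f₂ x) = Y.hor.tgt (Y.ver.unit (α.φ (X.hor.src x))) := by
      rw [hor_tgt_unit, α.tgt_φ, g.hor.src]
    have h2 : Y.hor.src (Y.ver.unit (α.φ (X.hor.tgt x))) = Y.hor.tgt (f.f₂ x) := by
      rw [hor_src_unit, α.src_φ, f.hor.tgt]
    have h := congrArg k.f₂ (α.naturality x)
    rw [k.ver.mul, k.ver.mul, k.hor.mul _ _ h1, k.hor.mul _ _ h2, k.ver.unit, k.ver.unit] at h
    · exact h
    · rw [α.src_ψ, ver_tgt_hor h2, Y.ver.tgt_unit, f.ver.tgt, tgt_ver_tgt]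
    · rw [α.tgt_ψ, ver_src_hor h1, Y.ver.src_unit, g.ver.src, src_ver_src]
  map_mul j i hji := by
    have h1 : Y.hor.src (Y.ver.unit (g.f₁ j)) = Y.hor.tgt (α.ψ i) := by
      rw [hor_src_unit, ← tgt_ver_tgt, α.tgt_ψ, Y.one.tgt_mul, g.one.tgt, g.one.src, hji]
      rw [α.tgt_φ, g.one.src]
    have h2 : Y.hor.src (α.ψ j) = Y.hor.tgt (Y.ver.unit (f.f₁ i)) := by
      rw [hor_tgt_unit, ← src_ver_src, α.src_ψ, Y.one.src_mul, f.one.tgt, f.one.src, hji]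
      rw [α.src_φ, f.one.tgt]
    rw [α.map_mul _ _ hji, k.ver.mul, k.hor.mul _ _ h1, k.hor.mul _ _ h2, k.ver.unit, k.ver.unit]
    · rfl
    · rw [ver_src_hor h1, ver_tgt_hor h2, α.tgt_ψ, α.src_ψ, Y.ver.src_unit, Y.ver.tgt_unit, hji,
        Y.one.mul_assoc]
      · rw [α.tgt_φ, g.one.src, hji]
      · rw [α.src_φ, f.one.tgt]

end NatTrans

variable {g : Hom Z Y} (hg : g.IsMorita) {b b' : Hom D Z} (α : NatTrans (g.comp b) (g.comp b'))

/-- A transformation `g ∘ b → g ∘ b'`, with `g` a Morita morphism, lifts to a transformation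
`b → b'` if its components do. -/
def NatTrans.lift (u : D.X₀ → Z.X₁) (hu : Smooth u) (ht : ∀ d, Z.one.tgt (u d) = b'.f₀ d)
    (hgu : ∀ d, g.f₁ (u d) = α.φ d) (hs : ∀ d, Z.one.src (u d) = b.f₀ d) : NatTrans b b' :=
  have c1 : ∀ j, Z.one.src (b'.f₁ j) = Z.one.tgt (u (D.one.src j)) := fun j => by
    rw [ht, b'.one.src]
  have c2 : ∀ j, Z.one.src (u (D.one.tgt j)) = Z.one.tgt (b.f₁ j) := fun j => by
    rw [hs, b.one.tgt]
  have h1 : ∀ j, Y.ver.tgt (α.ψ j) = g.f₁ (Z.one.mul (b'.f₁ j) (u (D.one.src j))) := fun j => by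
    rw [α.tgt_ψ, g.one.mul _ _ (c1 j), hgu]; rfl
  have h2 : ∀ j, Y.ver.src (α.ψ j) = g.f₁ (Z.one.mul (u (D.one.tgt j)) (b.f₁ j)) := fun j => by
    rw [α.src_ψ, g.one.mul _ _ (c2 j), hgu]; rfl
  have h3 : ∀ j, Z.one.tgt (Z.one.mul (b'.f₁ j) (u (D.one.src j))) =
      Z.one.tgt (Z.one.mul (u (D.one.tgt j)) (b.f₁ j)) := fun j => by
    rw [Z.one.tgt_mul _ _ (c1 j), Z.one.tgt_mul _ _ (c2 j), b'.one.tgt, ht]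
  have h4 : ∀ j, Z.one.src (Z.one.mul (b'.f₁ j) (u (D.one.src j))) =
      Z.one.src (Z.one.mul (u (D.one.tgt j)) (b.f₁ j)) := fun j => by
    rw [Z.one.src_mul _ _ (c1 j), Z.one.src_mul _ _ (c2 j), b.one.src, hs]
  -- The only possible choice: the 2-arrow over `α.ψ j` with the boundary imposed by `u`. Both
  -- coherence laws then follow from `cell_ext`, by comparing boundaries in `Z` and images in `Y`.
  let ψ : D.X₁ → Z.X₂ := fun j => hg.cell (Z.one.mul (b'.f₁ j) (u (D.one.src j))) (α.ψ j)
    (Z.one.mul (u (D.one.tgt j)) (b.f₁ j))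
  have hψ : ∀ j, Z.ver.tgt (ψ j) = Z.one.mul (b'.f₁ j) (u (D.one.src j)) ∧ g.f₂ (ψ j) = α.ψ j ∧
      Z.ver.src (ψ j) = Z.one.mul (u (D.one.tgt j)) (b.f₁ j) := fun j =>
    hg.cell_spec (h1 j) (h2 j) (h3 j) (h4 j)
  { φ := u
    ψ := ψ
    smooth_φ := hu
    smooth_ψ := smooth_of_near fun k => by
      refine hg.cell_near
        (Z.one.mul_near (Smooth.near b'.one.smooth₁) (Smooth.near (hu.comp D.one.src_smooth))
          (Eventually.of_forall c1)) (Smooth.near α.smooth_ψ)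
        (Z.one.mul_near (Smooth.near (hu.comp D.one.tgt_smooth)) (Smooth.near b.one.smooth₁)
          (Eventually.of_forall c2))
        (Eventually.of_forall fun j => ⟨h1 j, h2 j, h3 j, h4 j⟩)
    src_φ := hs
    tgt_φ := ht
    src_ψ := fun j => (hψ j).2.2
    tgt_ψ := fun j => (hψ j).1
    naturality := fun x => by
      have e1 : Z.hor.src (b'.f₂ x) = Z.hor.tgt (Z.ver.unit (u (D.hor.src x))) := by
        rw [hor_tgt_unit, ht, b'.hor.src]
      have e2 : Z.hor.src (Z.ver.unit (u (D.hor.tgt x))) = Z.hor.tgt (b.f₂ x) := by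
        rw [hor_src_unit, hs, b.hor.tgt]
      have e3 : Z.ver.src (Z.hor.mul (b'.f₂ x) (Z.ver.unit (u (D.hor.src x)))) =
          Z.ver.tgt (ψ (D.ver.src x)) := by
        rw [(hψ _).1, ver_src_hor e1, Z.ver.src_unit, b'.ver.src, src_ver_src]
      have e4 : Z.ver.src (ψ (D.ver.tgt x)) =
          Z.ver.tgt (Z.hor.mul (Z.ver.unit (u (D.hor.tgt x))) (b.f₂ x)) := by
        rw [(hψ _).2.2, ver_tgt_hor e2, Z.ver.tgt_unit, b.ver.tgt, tgt_ver_tgt]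
      refine hg.cell_ext ?_ ?_ ?_
      · rw [Z.ver.tgt_mul _ _ e3, Z.ver.tgt_mul _ _ e4, (hψ _).1, ver_tgt_hor e1, Z.ver.tgt_unit,
          b'.ver.tgt, src_ver_tgt]
      · rw [g.ver.mul _ _ e3, g.ver.mul _ _ e4, g.hor.mul _ _ e1, g.hor.mul _ _ e2, (hψ _).2.1,
          (hψ _).2.1, g.ver.unit, g.ver.unit, hgu, hgu]
        exact α.naturality x
      · rw [Z.ver.src_mul _ _ e3, Z.ver.src_mul _ _ e4, (hψ _).2.2, ver_src_hor e2, Z.ver.src_unit,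
          b.ver.src, tgt_ver_src]
    map_mul := fun j i h => by
      have d1 : Z.one.src (b'.f₁ j) = Z.one.tgt (b'.f₁ i) := by rw [b'.one.src, b'.one.tgt, h]
      have d2 : Z.one.src (b.f₁ j) = Z.one.tgt (b.f₁ i) := by rw [b.one.src, b.one.tgt, h]
      have e1 : Z.hor.src (Z.ver.unit (b'.f₁ j)) = Z.hor.tgt (ψ i) := by
        rw [hor_src_unit, ← tgt_ver_tgt, (hψ i).1, Z.one.tgt_mul _ _ (c1 i), d1]
      have e2 : Z.hor.src (ψ j) = Z.hor.tgt (Z.ver.unit (b.f₁ i)) := by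
        rw [hor_tgt_unit, ← src_ver_src, (hψ j).2.2, Z.one.src_mul _ _ (c2 j), d2]
      have e3 : Z.ver.src (Z.hor.mul (Z.ver.unit (b'.f₁ j)) (ψ i)) =
          Z.ver.tgt (Z.hor.mul (ψ j) (Z.ver.unit (b.f₁ i))) := by
        rw [ver_src_hor e1, ver_tgt_hor e2, (hψ i).2.2, (hψ j).1, Z.ver.src_unit, Z.ver.tgt_unit, h,
          Z.one.mul_assoc _ _ _ (by rw [← h]; exact c1 j) (c2 i)]
      refine hg.cell_ext ?_ ?_ ?_
      · rw [Z.ver.tgt_mul _ _ e3, (hψ _).1, ver_tgt_hor e1, (hψ i).1, Z.ver.tgt_unit,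
          b'.one.mul _ _ h, D.one.src_mul _ _ h, Z.one.mul_assoc _ _ _ d1 (c1 i)]
      · rw [g.ver.mul _ _ e3, g.hor.mul _ _ e1, g.hor.mul _ _ e2, (hψ _).2.1,
          (hψ _).2.1, (hψ _).2.1, g.ver.unit, g.ver.unit]
        exact α.map_mul j i h
      · rw [Z.ver.src_mul _ _ e3, (hψ _).2.2, ver_src_hor e2, (hψ j).2.2, Z.ver.src_unit,
          b.one.mul _ _ h, D.one.tgt_mul _ _ h, Z.one.mul_assoc _ _ _ (c2 j) d2] }

include hg α in
/-- A transformation `g ∘ b → g ∘ b'`, with `g` a Morita morphism, lifts to a transformation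
`b → b'` after a refinement of the domain. -/
theorem exists_natTrans_lift :
    ∃ (D' : Lie2Groupoid.{u}) (p : Hom D' D), p.IsMorita ∧
      Nonempty (NatTrans (b.comp p) (b'.comp p)) := by
  obtain ⟨P, ι, q, hι, hq, hιq⟩ := hg.arrows
  have hmem : ∀ d, ((b'.f₀ d, α.φ d, b.f₀ d) : Z.X₀ × Y.X₁ × Z.X₀) ∈
      LieGroupoid.pullbackArrows Y.one g.f₀ := fun d => ⟨α.tgt_φ d, α.src_φ d⟩
  -- `c d` records the component at `d` with the ends that its lift must have, so the lifts at `d`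
  -- are the fibre of `q : Z₁ → P` over `c d`. They exist only locally in `d`; taking them as the
  -- new objects makes the lift tautological.
  let c : D.X₀ → P := fun d => hι.inv ((b'.f₀ d, α.φ d, b.f₀ d) : Z.X₀ × Y.X₁ × Z.X₀)
  have hc : Smooth c := smooth_of_near fun k => SmoothOn.comp_near hι.inv_smoothOn
    (Smooth.near (Smooth.pair b'.one.smooth₀ (Smooth.pair α.smooth_φ b.one.smooth₀)))
    (Eventually.of_forall hmem)
  have hp : SurjSubmersion (fp.fst : fp hc hq → D.X₀) := fp.fst_surjSubmersion
  have hm := pairMap_isMorita hp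
  let p := pullbackFst (toPair D) hm
  let n : (pullback (toPair D) hm).X₀ → fp hc hq := fp.snd
  have hn : ∀ w, fp.fst (n w) = p.f₀ w := fun w => (fp.w w).symm
  have hu : ∀ w, ((Z.one.tgt (fp.snd (n w)), g.f₁ (fp.snd (n w)), Z.one.src (fp.snd (n w))) :
      Z.X₀ × Y.X₁ × Z.X₀) = (b'.f₀ (p.f₀ w), α.φ (p.f₀ w), b.f₀ (p.f₀ w)) := fun w => by
    rw [← hn]
    have h1 := (hιq (fp.snd (n w))).symm
    rw [← fp.w (n w), hι.apply_inv (hmem _)] at h1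
    exact h1
  exact ⟨_, p, pullbackFst_isMorita _ hm, ⟨NatTrans.lift hg (b := b.comp p) (b' := b'.comp p)
    (α.precomp p) (fun w => fp.snd (n w)) (fp.snd_smooth.comp fp.snd_smooth)
    (fun w => congrArg (fun x : Z.X₀ × Y.X₁ × Z.X₀ => x.1) (hu w))
    (fun w => congrArg (fun x : Z.X₀ × Y.X₁ × Z.X₀ => x.2.1) (hu w))
    (fun w => congrArg (fun x : Z.X₀ × Y.X₁ × Z.X₀ => x.2.2) (hu w))⟩⟩

end Hom

end Lie2Groupoid

/-! ### Refinements and the calculus of fractions -/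

namespace Lie2Groupoid

variable {X Y Z D V : Lie2Groupoid.{u}}

/-- The identity transformation between equal morphisms. -/
def Hom.NatTrans.ofEq {f g : Hom X Y} (h : f = g) : Hom.NatTrans f g := h ▸ .refl f

/-- A Lie 2-groupoid over `D` by a Morita morphism, with a morphism to `Y`. -/
structure Refinement (D Y : Lie2Groupoid.{u}) where
  E : Lie2Groupoid.{u}
  p : Hom E D
  hp : p.IsMorita
  c : Hom E Y

namespace Refinement

/-- Two refinements are related if one is the pullback of the other along a Morita morphism, or if
their morphisms to `Y` are related by a transformation. -/
inductive Rel : Refinement D Y → Refinement D Y → Prop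
  | refine (r : Refinement D Y) {V : Lie2Groupoid.{u}} (h : Hom V r.E) (hh : h.IsMorita) :
      Rel ⟨V, r.p.comp h, r.hp.comp hh, r.c.comp h⟩ r
  | natTrans (r : Refinement D Y) (c' : Hom r.E Y) (α : Hom.NatTrans r.c c') :
      Rel r ⟨r.E, r.p, r.hp, c'⟩

/-- The equivalence relation generated by `Rel`. -/
abbrev Eqv (r r' : Refinement D Y) : Prop := Relation.EqvGen Rel r r'

/-- Composition with a morphism. -/
def fwd (r : Refinement D Y) (f : Hom Y Z) : Refinement D Z := ⟨r.E, r.p, r.hp, f.comp r.c⟩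

/-- Composition with a Morita morphism read backwards. -/
def bwd (r : Refinement D Y) {g : Hom Z Y} (hg : g.IsMorita) : Refinement D Z :=
  ⟨pullback r.c hg, r.p.comp (pullbackFst r.c hg), r.hp.comp (pullbackFst_isMorita r.c hg),
    pullbackSnd r.c hg⟩

theorem eqv_refine {r r' : Refinement D Y} (h : Hom r'.E r.E) (hh : h.IsMorita)
    (hp : r'.p = r.p.comp h) (hc : r'.c = r.c.comp h) : Eqv r' r := by
  obtain ⟨E, p, h2, c⟩ := r'
  dsimp only at h hp hc hh
  subst hp hc
  exact .rel _ _ (.refine r h hh)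

/-- Characterizes the fibre product up to the two moves: any `V` that completes the square up to a
transformation represents it. Over the common refinement of `V` and the strict fibre product there
are two morphisms to `Z` whose composites with `g` are related; after one more refinement the
relation lifts to `Z`. -/
theorem eqv_bwd (r : Refinement D Y) {g : Hom Z Y} (hg : g.IsMorita) {k : Hom V r.E}
    (hk : k.IsMorita) (b : Hom V Z) (α : Hom.NatTrans (g.comp b) (r.c.comp k)) :
    Eqv ⟨V, r.p.comp k, r.hp.comp hk, b⟩ (r.bwd hg) := by
  have h1 := pullbackFst_isMorita r.c hg
  have hu := pullbackFst_isMorita k h1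
  have hu' := pullbackSnd_isMorita h1 hk
  have e := pullback_w k h1
  have e' := pullback_w r.c hg
  have β : Hom.NatTrans (g.comp (b.comp (pullbackFst k h1)))
      (g.comp ((pullbackSnd r.c hg).comp (pullbackSnd k h1))) := by
    have h2 : (r.c.comp k).comp (pullbackFst k h1) =
        g.comp ((pullbackSnd r.c hg).comp (pullbackSnd k h1)) :=
      (congrArg (fun q => r.c.comp q) e).trans (congrArg (fun q => q.comp (pullbackSnd k h1)) e')
    rw [← h2]
    exact α.precomp _
  obtain ⟨U, q, hq, ⟨γ⟩⟩ := Hom.exists_natTrans_lift hg β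
  refine .trans _ ⟨U, r.p.comp (k.comp ((pullbackFst k h1).comp q)),
    r.hp.comp (hk.comp (hu.comp hq)), b.comp ((pullbackFst k h1).comp q)⟩ _
    (.symm _ _ (eqv_refine ((pullbackFst k h1).comp q) (hu.comp hq) rfl rfl)) ?_
  refine .trans _ _ _ (.rel _ _ (.natTrans _ _ γ)) ?_
  refine eqv_refine ((pullbackSnd k h1).comp q) (hu'.comp hq) ?_ rfl
  exact congrArg (fun x => r.p.comp (x.comp q)) e

theorem Eqv.fwd {r r' : Refinement D Y} (h : Eqv r r') (f : Hom Y Z) :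
    Eqv (r.fwd f) (r'.fwd f) := by
  induction h with
  | rel r r' h =>
    cases h with
    | refine _ h hh => exact .rel _ _ (.refine (r'.fwd f) h hh)
    | natTrans _ c' α => exact .rel _ _ (.natTrans (r.fwd f) _ (α.postcomp f))
  | refl r => exact .refl _
  | symm _ _ _ ih => exact .symm _ _ ih
  | trans _ _ _ _ _ ih ih' => exact .trans _ _ _ ih ih'

theorem Eqv.bwd {r r' : Refinement D Y} (h : Eqv r r') {g : Hom Z Y} (hg : g.IsMorita) :
    Eqv (r.bwd hg) (r'.bwd hg) := by
  induction h with
  | rel r r' h =>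
    cases h with
    | refine _ h hh =>
      exact eqv_bwd r' hg (hh.comp (pullbackFst_isMorita _ hg)) (pullbackSnd (r'.c.comp h) hg)
        (.ofEq (pullback_w (r'.c.comp h) hg).symm)
    | natTrans _ c' α =>
      refine eqv_bwd ⟨r.E, r.p, r.hp, c'⟩ hg (pullbackFst_isMorita r.c hg) (pullbackSnd r.c hg) ?_
      rw [← pullback_w r.c hg]
      exact α.precomp _
  | refl r => exact .refl _
  | symm _ _ _ ih => exact .symm _ _ ih
  | trans _ _ _ _ _ ih ih' => exact .trans _ _ _ ih ih'

end Refinement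

namespace GenMor

open Refinement

/-- Composition of a refinement with a generalized morphism. -/
def act : {Y : Lie2Groupoid.{u}} → GenMor X Y → Refinement D X → Refinement D Y
  | _, nil _, r => r
  | _, fwd F f, r => (act F r).fwd f
  | _, bwd F _ hg, r => (act F r).bwd hg

theorem act_comp (F : GenMor X Y) (K : GenMor Y Z) (r : Refinement D X) :
    (F.comp K).act r = K.act (F.act r) := by
  induction K with
  | nil => rfl
  | fwd K f ih => exact congrArg (fun q => Refinement.fwd q f) ih
  | bwd K g hg ih => exact congrArg (fun q => Refinement.bwd q hg) ih

theorem act_eqv (K : GenMor X Y) {r r' : Refinement D X} (h : Eqv r r') :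
    Eqv (K.act r) (K.act r') := by
  induction K with
  | nil => exact h
  | fwd K f ih => exact ih.fwd f
  | bwd K g hg ih => exact ih.bwd hg

/-- Turns the abstractly generated equivalence of zigzags into a chain of the two geometric moves.
Induction on the generators is possible because `D` and the refinement acted upon are arbitrary,
which lets the two concatenation rules go through. -/
theorem Equiv.act {F F' : GenMor X Y} (h : Equiv F F') :
    ∀ r : Refinement D X, Eqv (F.act r) (F'.act r) := by
  induction h with
  | refl F => exact fun r => .refl _
  | symm _ ih => exact fun r => .symm _ _ (ih r)
  | trans _ _ ih ih' => exact fun r => .trans _ _ _ (ih r) (ih' r)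
  | natTrans α => exact fun r => .rel _ _ (.natTrans (r.fwd _) _ (α.precomp r.c))
  | bwd_fwd φ hφ =>
    exact fun r => eqv_refine (pullbackFst r.c hφ) (pullbackFst_isMorita r.c hφ) rfl
      (pullback_w r.c hφ).symm
  | fwd_bwd φ hφ =>
    -- The square over `φ ∘ r.c` is already completed by `r.c` and the identity of `r.E`.
    exact fun r => .symm _ _ (eqv_bwd (r.fwd φ) hφ (Hom.isMorita_id r.E) r.c (.refl _))
  | id X => exact fun r => .refl _
  | fwd_fwd f g => exact fun r => .refl _
  | comp_left K _ ih =>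
    intro r
    rw [act_comp, act_comp]
    exact ih _
  | comp_right K _ ih =>
    intro r
    rw [act_comp, act_comp]
    exact act_eqv K (ih r)

/-- Forward arrows compose Morita morphisms, and backward arrows pull one back along another. -/
theorem AllMorita.act {E : GenMor X Y} (hE : E.AllMorita) {r : Refinement D X}
    (hr : r.c.IsMorita) : (E.act r).c.IsMorita := by
  induction E with
  | nil => exact hr
  | fwd F f ih =>
    rw [AllMorita] at hE
    exact hE.2.comp (ih hE.1)
  | bwd F g hg ih =>
    rw [AllMorita] at hE
    exact pullbackSnd_isMorita hg (ih hE)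

/-- Replacement of a segment of a zigzag. -/
theorem Equiv.within {Y' : Lie2Groupoid.{u}} (K : GenMor X Y) {F F' : GenMor Y Y'} (h : Equiv F F')
    (L : GenMor Y' Z) : Equiv ((K.comp F).comp L) ((K.comp F').comp L) :=
  .comp_right L (.comp_left K h)

/-- Append the composite forwards and backwards, split its forward copy into `k` and `φ`, and cancel
both against the given backward arrows. -/
theorem equiv_bwd_bwd {φ : Hom Y X} (hφ : φ.IsMorita) {k : Hom Z Y} (hk : k.IsMorita) :
    Equiv (((nil X).bwd φ hφ).bwd k hk) ((nil X).bwd (φ.comp k) (hφ.comp hk)) := by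
  refine .trans (.comp_left (((nil X).bwd φ hφ).bwd k hk) (.symm (.fwd_bwd _ (hφ.comp hk)))) ?_
  refine .trans (Equiv.within (((nil X).bwd φ hφ).bwd k hk) (.symm (.fwd_fwd k φ))
    ((nil _).bwd _ (hφ.comp hk))) ?_
  refine .trans (Equiv.within ((nil X).bwd φ hφ) (.bwd_fwd k hk)
    ((of φ).bwd _ (hφ.comp hk))) ?_
  exact Equiv.within (nil X) (.bwd_fwd φ hφ) ((nil _).bwd _ (hφ.comp hk))

/-- Insert the first projection backwards and forwards, exchange the two sides of the commutative
square, and cancel `g`. -/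
theorem equiv_fwd_bwd (c : Hom X Y) {g : Hom Z Y} (hg : g.IsMorita) :
    Equiv ((of c).bwd g hg)
      (.span (pullbackFst c hg) (pullbackFst_isMorita c hg) (pullbackSnd c hg)) := by
  have h1 := pullbackFst_isMorita c hg
  have e : Equiv ((of (pullbackFst c hg)).fwd c) ((of (pullbackSnd c hg)).fwd g) := by
    refine .trans (.fwd_fwd _ _) ?_
    rw [pullback_w]
    exact .symm (.fwd_fwd _ _)
  refine .trans (.comp_right ((of c).bwd g hg) (.symm (.bwd_fwd _ h1))) ?_
  refine .trans (Equiv.within ((nil X).bwd _ h1) e ((nil _).bwd g hg)) ?_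
  exact .comp_left (.span _ h1 (pullbackSnd c hg)) (.fwd_bwd g hg)

/-- Every generalized morphism is equivalent to a span. -/
theorem exists_equiv_span (F : GenMor X Y) :
    ∃ (E : Lie2Groupoid.{u}) (φ : Hom E X) (hφ : φ.IsMorita) (f : Hom E Y),
      Equiv F (.span φ hφ f) := by
  induction F with
  | nil =>
    refine ⟨X, Hom.id X, Hom.isMorita_id X, Hom.id X, .symm (.bwd_fwd _ _)⟩
  | fwd F f ih =>
    obtain ⟨E, φ, hφ, c, h⟩ := ih
    refine ⟨E, φ, hφ, f.comp c, .trans (.comp_right (of f) h) ?_⟩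
    exact .comp_left ((nil _).bwd φ hφ) (.fwd_fwd c f)
  | bwd F g hg ih =>
    obtain ⟨E, φ, hφ, c, h⟩ := ih
    have h1 := pullbackFst_isMorita c hg
    refine ⟨_, φ.comp (pullbackFst c hg), hφ.comp h1, pullbackSnd c hg,
      .trans (.comp_right ((nil _).bwd g hg) h) ?_⟩
    exact .trans (.comp_left ((nil _).bwd φ hφ) (equiv_fwd_bwd c hg))
      (.comp_right (of (pullbackSnd c hg)) (equiv_bwd_bwd hφ h1))

end GenMor

end Lie2Groupoid

/-! ### Quotients of Lie groupoids by congruences -/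

namespace Mfd

variable {K A B M N Q : Mfd.{u}} {S : Set K} {k : K}

/-- Near any point `h` is the composite with a local section of `π`. -/
theorem SurjSubmersion.smooth_of_comp {π : A → Q} (hπ : SurjSubmersion π) {h : Q → N}
    (hh : Smooth (fun a => h (π a))) : Smooth h := by
  refine smooth_of_near fun q => ?_
  obtain ⟨a, rfl⟩ := hπ.1 q
  obtain ⟨l, -, h2, h3⟩ := hπ.lift (K := Q) (S := Set.univ) (k := π a) trivial
    (Smooth.near contMDiff_id) a rfl
  exact SmoothNear.congr (Smooth.comp_near hh h2) (h3.mono fun x hx => by rw [hx]; rfl)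

theorem SurjSubmersion.of_comp {π : A → Q} (hπ : SurjSubmersion π) {h : Q → N}
    (hh : SurjSubmersion (fun a => h (π a))) : SurjSubmersion h := by
  refine surjSubmersion_of_section (hπ.smooth_of_comp hh.smooth) (fun n => ?_) fun q => ?_
  · obtain ⟨a, ha⟩ := hh.1 n
    exact ⟨π a, ha⟩
  · obtain ⟨a, rfl⟩ := hπ.1 q
    obtain ⟨l, h1, h2, h3⟩ := hh.lift (K := N) (S := Set.univ) (k := h (π a)) trivial
      (Smooth.near contMDiff_id) a rfl
    exact ⟨fun n => π (l n), congrArg π h1, Smooth.comp_near hπ.smooth h2, h3⟩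

/-- A chart of a quotient `K / r` obtained from a local slice of `r` parametrized by an open subset
of a manifold `B`. -/
def QuotientChart.ofSlice {r : Setoid K} (χ : K → B) (σ : B → K) (U : Set K) (W : Set B)
    (hU : IsOpen U) (hW : IsOpen W) (hχ : SmoothOn χ U) (hσ : SmoothOn σ W)
    (hr : ∀ x y, r x y → x ∈ U → y ∈ U ∧ χ x = χ y) (hm : ∀ x ∈ U, χ x ∈ W ∧ r (σ (χ x)) x)
    (hm' : ∀ b ∈ W, σ b ∈ U ∧ χ (σ b) = b) (b₀ : B) : QuotientChart K r B.model where
  χ x := chartAt B.model b₀ (χ x)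
  σ v := σ ((chartAt B.model b₀).symm v)
  U := U ∩ χ ⁻¹' (chartAt B.model b₀).source
  V := (chartAt B.model b₀).target ∩ (chartAt B.model b₀).symm ⁻¹' W
  isOpen_U := hχ.continuousOn.isOpen_inter_preimage hU (chartAt B.model b₀).open_source
  isOpen_V := (chartAt B.model b₀).isOpen_inter_preimage_symm hW
  smooth_χ := (contMDiffOn_chart (I := 𝓘(ℝ, B.model)) (x := b₀)).comp
    (hχ.mono Set.inter_subset_left) fun _ hx => hx.2
  smooth_σ := hσ.comp ((contMDiffOn_chart_symm (I := 𝓘(ℝ, B.model)) (x := b₀)).mono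
    Set.inter_subset_left) fun _ hx => hx.2
  saturated x y h hx := ⟨(hr x y h hx.1).1, by
    rw [Set.mem_preimage, ← (hr x y h hx.1).2]; exact hx.2⟩
  σ_mem v hv := ⟨(hm' _ hv.2).1, by
    rw [Set.mem_preimage, (hm' _ hv.2).2]; exact (chartAt B.model b₀).map_target hv.1⟩
  χ_mem x hx := ⟨(chartAt B.model b₀).map_source hx.2, by
    rw [Set.mem_preimage, (chartAt B.model b₀).left_inv hx.2]; exact (hm x hx.1).1⟩
  χ_σ v hv := by
    rw [(hm' _ hv.2).2, (chartAt B.model b₀).right_inv hv.1]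
  χ_const x y h hx := by rw [(hr x y h hx.1).2]
  σ_χ x hx := by
    rw [(chartAt B.model b₀).left_inv hx.2]
    exact (hm x hx.1).2

end Mfd

namespace LieGroupoid

variable {M A Q N B : Mfd.{u}} (X : LieGroupoid M A)

/-- A surjective submersion defined on the arrows of a Lie groupoid whose fibres are the classes of
a congruence. -/
structure Congruence (π : A → Q) : Prop where
  submersion : SurjSubmersion π
  src : ∀ a b, π a = π b → X.src a = X.src b
  tgt : ∀ a b, π a = π b → X.tgt a = X.tgt b
  mul : ∀ a a' b b', π a = π a' → π b = π b' → X.src a = X.tgt b →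
    π (X.mul a b) = π (X.mul a' b')

namespace Congruence

variable {X} {π : A → Q} (h : X.Congruence π)
include h

/-- Compatibility with products suffices: `b⁻¹ = a⁻¹ (a b⁻¹)` is equivalent to `a⁻¹ (b b⁻¹) = a⁻¹`.
-/
theorem inv {a b : A} (hab : π a = π b) : π (X.inv a) = π (X.inv b) := by
  have hs := h.src a b hab
  have ht := h.tgt a b hab
  have e1 : X.src (X.inv a) = X.tgt b := by rw [X.src_inv, ht]
  have e2 : X.src b = X.tgt (X.inv b) := (X.tgt_inv b).symm
  have h1 : π (X.mul (X.inv a) (X.mul a (X.inv b))) = π (X.mul (X.inv a) (X.mul b (X.inv b))) := by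
    have e3 : X.src a = X.tgt (X.inv b) := hs.trans e2
    refine h.mul _ _ _ _ rfl (h.mul _ _ _ _ hab rfl e3) ?_
    rw [X.src_inv, X.tgt_mul _ _ e3]
  rw [← X.mul_assoc _ _ _ (X.src_inv a) (hs.trans e2), X.inv_mul, hs, e2, X.unit_mul, X.mul_inv,
    ← e1, X.mul_unit] at h1
  exact h1.symm

/-- A choice of representatives. -/
def rep (q : Q) : A := Function.surjInv h.submersion.1 q

theorem apply_rep (q : Q) : π (h.rep q) = q := Function.surjInv_eq h.submersion.1 q

theorem src_rep (a : A) : X.src (h.rep (π a)) = X.src a := h.src _ _ (h.apply_rep _)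
theorem tgt_rep (a : A) : X.tgt (h.rep (π a)) = X.tgt a := h.tgt _ _ (h.apply_rep _)
theorem inv_rep (a : A) : π (X.inv (h.rep (π a))) = π (X.inv a) := h.inv (h.apply_rep _)

theorem mul_rep {a b : A} (hab : X.src a = X.tgt b) :
    π (X.mul (h.rep (π a)) (h.rep (π b))) = π (X.mul a b) :=
  h.mul _ _ _ _ (h.apply_rep _) (h.apply_rep _) (by rw [h.src_rep, h.tgt_rep, hab])


end Congruence

variable {X} {π : A → Q} (h : X.Congruence π)

/-- The quotient of a Lie groupoid by a congruence. -/
def descend : LieGroupoid M Q where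
  src q := X.src (h.rep q)
  tgt q := X.tgt (h.rep q)
  unit m := π (X.unit m)
  -- The representatives `rep` are arbitrary and not smooth. Smoothness holds because the congruence
  -- allows them to be replaced by local smooth lifts.
  mul p q := π (X.mul (h.rep p) (h.rep q))
  inv q := π (X.inv (h.rep q))
  src_submersion := h.submersion.of_comp (by simp only [h.src_rep]; exact X.src_submersion)
  tgt_submersion := h.submersion.of_comp (by simp only [h.tgt_rep]; exact X.tgt_submersion)
  unit_smooth := h.submersion.smooth.comp X.unit_smooth
  inv_smooth := h.submersion.smooth_of_comp (by
    simp only [h.inv_rep]; exact h.submersion.smooth.comp X.inv_smooth)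
  mul_smooth := by
    refine smoothOn_of_near ?_
    rintro ⟨p, q⟩ hpq
    obtain ⟨a, rfl⟩ := h.submersion.1 p
    obtain ⟨b, rfl⟩ := h.submersion.1 q
    obtain ⟨l, -, h2, h3⟩ := h.submersion.lift (K := Q.prod Q) hpq (Smooth.near smooth_fst) a rfl
    obtain ⟨l', -, h2', h3'⟩ := h.submersion.lift (K := Q.prod Q) hpq (Smooth.near smooth_snd) b rfl
    have h4 := @eventually_mem_nhdsWithin _ _ ((π a, π b) : Q.prod Q)
      {p : Q × Q | X.src (h.rep p.1) = X.tgt (h.rep p.2)}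
    have h5 : ∀ᶠ x in 𝓝[{p : Q × Q | X.src (h.rep p.1) = X.tgt (h.rep p.2)}]
        ((π a, π b) : Q.prod Q), X.src (l x) = X.tgt (l' x) := by
      filter_upwards [h3, h3', h4] with x e e' e''
      rw [← h.src_rep, ← h.tgt_rep (l' x), e, e']
      exact e''
    refine SmoothNear.congr (Smooth.comp_near h.submersion.smooth (X.mul_near h2 h2' h5)) ?_
    filter_upwards [h3, h3', h5] with x e e' e''
    rw [← h.mul_rep e'', e, e']
  src_unit m := by rw [h.src_rep, X.src_unit]
  tgt_unit m := by rw [h.tgt_rep, X.tgt_unit]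
  src_mul p q hpq := by rw [h.src_rep, X.src_mul _ _ hpq]
  tgt_mul p q hpq := by rw [h.tgt_rep, X.tgt_mul _ _ hpq]
  mul_assoc p q r hpq hqr := by
    rw [← h.apply_rep p, ← h.apply_rep q, ← h.apply_rep r]
    generalize h.rep p = a at *
    generalize h.rep q = b at *
    generalize h.rep r = c at *
    rw [h.mul_rep hpq, h.mul_rep hqr, h.mul_rep (by rw [X.src_mul _ _ hpq, hqr]),
      h.mul_rep (by rw [X.tgt_mul _ _ hqr, hpq]), X.mul_assoc _ _ _ hpq hqr]
  unit_mul q := by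
    obtain ⟨a, rfl⟩ := h.submersion.1 q
    rw [h.tgt_rep, h.mul_rep (X.src_unit _), X.unit_mul]
  mul_unit q := by
    obtain ⟨a, rfl⟩ := h.submersion.1 q
    rw [h.src_rep, h.mul_rep (X.tgt_unit _).symm, X.mul_unit]
  src_inv q := by rw [h.src_rep, X.src_inv]
  tgt_inv q := by rw [h.tgt_rep, X.tgt_inv]
  inv_mul q := by
    obtain ⟨a, rfl⟩ := h.submersion.1 q
    rw [h.src_rep, h.inv_rep, h.mul_rep (X.src_inv _), X.inv_mul]
  mul_inv q := by
    obtain ⟨a, rfl⟩ := h.submersion.1 q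
    rw [h.tgt_rep, h.inv_rep, h.mul_rep (X.tgt_inv _).symm, X.mul_inv]

theorem descend_isHom : IsHom X (descend h) id π where
  smooth₀ := contMDiff_id
  smooth₁ := h.submersion.smooth
  src := h.src_rep
  tgt := h.tgt_rep
  unit _ := rfl
  mul _ _ hab := (h.mul_rep hab).symm

/-- A morphism from the quotient of a Lie groupoid is determined by a morphism of the groupoid. -/
theorem IsHom.of_descend {Y : LieGroupoid N B} {f₀ : M → N} {f₁ : Q → B}
    (hf : IsHom X Y f₀ (fun a => f₁ (π a))) : IsHom (descend h) Y f₀ f₁ where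
  smooth₀ := hf.smooth₀
  smooth₁ := h.submersion.smooth_of_comp hf.smooth₁
  src q := by
    obtain ⟨a, rfl⟩ := h.submersion.1 q
    rw [hf.src]; exact congrArg f₀ (h.src_rep a).symm
  tgt q := by
    obtain ⟨a, rfl⟩ := h.submersion.1 q
    rw [hf.tgt]; exact congrArg f₀ (h.tgt_rep a).symm
  unit m := hf.unit m
  mul p q hpq := by
    obtain ⟨a, rfl⟩ := h.submersion.1 p
    obtain ⟨b, rfl⟩ := h.submersion.1 q
    have hab : X.src a = X.tgt b := by rw [← h.src_rep, ← h.tgt_rep]; exact hpq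
    rw [← hf.mul a b hab]
    exact congrArg f₁ (h.mul_rep hab)

end LieGroupoid

/-! ### The `G`-component of 2-arrows and the relation on `Δ₁ × G` -/

namespace Lie2Groupoid.Hom

variable {G : LieGrp.{u}} {𝒜 : G.AutLieGroup} {Δ : Lie2Groupoid.{u}} (f : Hom Δ 𝒜.twoGroup)

/-- The component in `Aut(G)` of a morphism to `[G → Aut(G)]`. -/
def aut (a : Δ.X₁) : 𝒜.A := f.f₁ a

/-- The component in `G` of a morphism to `[G → Aut(G)]`. -/
def gComp (x : Δ.X₂) : G := (show G × 𝒜.A from f.f₂ x).1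

theorem aut_smooth : Smooth (N := 𝒜.A.toMfd) f.aut := f.one.smooth₁

theorem gComp_smooth : Smooth (N := G.toMfd) f.gComp := smooth_fst.comp f.ver.smooth₁

theorem aut_unit (m : Δ.X₀) : f.aut (Δ.one.unit m) = 1 := f.one.unit m

theorem aut_mul {a b : Δ.X₁} (h : Δ.one.src a = Δ.one.tgt b) :
    f.aut (Δ.one.mul a b) = f.aut a * f.aut b := f.one.mul a b h

theorem f₂_eq (x : Δ.X₂) : f.f₂ x = ((f.gComp x, f.aut (Δ.ver.src x)) : G × 𝒜.A) :=
  Prod.ext rfl (f.ver.src x)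

theorem aut_tgt (x : Δ.X₂) : f.aut (Δ.ver.tgt x) = 𝒜.ad (f.gComp x) * f.aut (Δ.ver.src x) := by
  refine (f.ver.tgt x).symm.trans ?_
  rw [f₂_eq]; rfl

theorem gComp_unit (a : Δ.X₁) : f.gComp (Δ.ver.unit a) = 1 :=
  congrArg (fun p : G × 𝒜.A => p.1) (f.ver.unit a)

theorem gComp_ver {x y : Δ.X₂} (h : Δ.ver.src x = Δ.ver.tgt y) :
    f.gComp (Δ.ver.mul x y) = f.gComp x * f.gComp y :=
  congrArg (fun p : G × 𝒜.A => p.1) (f.ver.mul x y h)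

theorem gComp_hor {x y : Δ.X₂} (h : Δ.hor.src x = Δ.hor.tgt y) :
    f.gComp (Δ.hor.mul x y) = f.gComp x * 𝒜.act (f.aut (Δ.ver.src x)) (f.gComp y) := by
  have h1 := congrArg (fun p : G × 𝒜.A => p.1) (f.hor.mul x y h)
  rw [f₂_eq f x] at h1
  exact h1

theorem aut_inv (a : Δ.X₁) : f.aut (Δ.one.inv a) = (f.aut a)⁻¹ := by
  refine eq_inv_of_mul_eq_one_left ?_
  rw [← f.aut_mul (Δ.one.src_inv _), Δ.one.inv_mul, f.aut_unit]

/-- The 2-arrows between two 1-arrows are the translates of those starting at a unit. -/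
theorem exists_loop_iff_exists_cell {a a' : Δ.X₁} {P : G → Prop} :
    (∃ l, Δ.ver.src l = Δ.one.unit (Δ.one.src a') ∧ a = Δ.one.mul a' (Δ.ver.tgt l) ∧
      P (f.gComp l)) ↔ ∃ x, Δ.ver.src x = a' ∧ Δ.ver.tgt x = a ∧
        P (𝒜.act (f.aut a')⁻¹ (f.gComp x)) := by
  constructor
  · rintro ⟨l, h1, rfl, h2⟩
    have e : Δ.hor.src (Δ.ver.unit a') = Δ.hor.tgt l := by
      rw [hor_src_unit, ← tgt_ver_src, h1, Δ.one.tgt_unit]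
    -- Horizontal translation by the identity 2-arrow of `a'`. It acts on the `G`-component by
    -- `f(a')`, whence the inverse action in the statement.
    refine ⟨Δ.hor.mul (Δ.ver.unit a') l, ?_, ?_, ?_⟩
    · rw [ver_src_hor e, Δ.ver.src_unit, h1, Δ.one.mul_unit]
    · rw [ver_tgt_hor e, Δ.ver.tgt_unit]
    · rwa [f.gComp_hor e, f.gComp_unit, one_mul, Δ.ver.src_unit, 𝒜.inv_act_act]
  · rintro ⟨x, rfl, rfl, h⟩
    have e : Δ.hor.src (Δ.ver.unit (Δ.one.inv (Δ.ver.src x))) = Δ.hor.tgt x := by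
      rw [hor_src_unit, Δ.one.src_inv, tgt_ver_src]
    refine ⟨Δ.hor.mul (Δ.ver.unit (Δ.one.inv (Δ.ver.src x))) x, ?_, ?_, ?_⟩
    · rw [ver_src_hor e, Δ.ver.src_unit, Δ.one.inv_mul]
    · rw [ver_tgt_hor e, Δ.ver.tgt_unit, ← Δ.one.mul_assoc, Δ.one.mul_inv, tgt_ver_src,
        ← tgt_ver_tgt, Δ.one.unit_mul]
      · rw [Δ.one.tgt_inv]
      · rw [Δ.one.src_inv, tgt_ver_src, tgt_ver_tgt]
    · rwa [f.gComp_hor e, f.gComp_unit, one_mul, Δ.ver.src_unit, f.aut_inv]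

end Lie2Groupoid.Hom

theorem LieGrp.AutLieGroup.ad_mul_act {G : LieGrp.{u}} (𝒜 : G.AutLieGroup) (g : G) (a : 𝒜.A)
    (x : G) : 𝒜.act (𝒜.ad g * a) x = g * 𝒜.act a x * g⁻¹ := by
  rw [𝒜.mul_act]
  simp [act, ad, Ad_apply]

namespace Lie2Groupoid

variable {M A : Mfd.{u}} {Γ : LieGroupoid M A} {G : LieGrp.{u}} {𝒜 : G.AutLieGroup}
  {Δ : Lie2Groupoid.{u}} {φ : Hom Δ (.ofGroupoid Γ)} (hφ : φ.IsMorita) (f : Hom Δ 𝒜.twoGroup)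

namespace Hom

/-- Two 1-arrows with the same image and the same ends. -/
structure Parallel (φ : Hom Δ (.ofGroupoid Γ)) (a b : Δ.X₁) : Prop where
  map : φ.f₁ a = φ.f₁ b
  tgt : Δ.one.tgt a = Δ.one.tgt b
  src : Δ.one.src a = Δ.one.src b

theorem parallel_iff {a b : Δ.X₁} : φ.Parallel a b ↔ φ.arrowFrame a = φ.arrowFrame b :=
  ⟨fun h => Prod.ext h.tgt (Prod.ext h.map h.src), fun h =>
    ⟨congrArg (fun p : Δ.X₀ × A × Δ.X₀ => p.2.1) h, congrArg (fun p : Δ.X₀ × A × Δ.X₀ => p.1) h,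
      congrArg (fun p : Δ.X₀ × A × Δ.X₀ => p.2.2) h⟩⟩

theorem Parallel.refl (φ : Hom Δ (.ofGroupoid Γ)) (a : Δ.X₁) : φ.Parallel a a := ⟨rfl, rfl, rfl⟩

theorem Parallel.symm {a b : Δ.X₁} (h : φ.Parallel a b) : φ.Parallel b a :=
  ⟨h.map.symm, h.tgt.symm, h.src.symm⟩

theorem Parallel.trans {a b c : Δ.X₁} (h : φ.Parallel a b) (h' : φ.Parallel b c) :
    φ.Parallel a c :=
  ⟨h.map.trans h'.map, h.tgt.trans h'.tgt, h.src.trans h'.src⟩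

theorem Parallel.mul {a a' b b' : Δ.X₁} (h : φ.Parallel a a') (h' : φ.Parallel b b')
    (hab : Δ.one.src a = Δ.one.tgt b) : φ.Parallel (Δ.one.mul a b) (Δ.one.mul a' b') := by
  have hab' : Δ.one.src a' = Δ.one.tgt b' := by rw [← h.src, ← h'.tgt, hab]
  refine ⟨?_, ?_, ?_⟩
  · rw [φ.one.mul _ _ hab, φ.one.mul _ _ hab', h.map, h'.map]
  · rw [Δ.one.tgt_mul _ _ hab, Δ.one.tgt_mul _ _ hab', h.tgt]
  · rw [Δ.one.src_mul _ _ hab, Δ.one.src_mul _ _ hab', h'.src]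

theorem parallel_of_cell (φ : Hom Δ (.ofGroupoid Γ)) (x : Δ.X₂) :
    φ.Parallel (Δ.ver.tgt x) (Δ.ver.src x) :=
  ⟨(φ.ver.tgt x).symm.trans (φ.ver.src x), by rw [tgt_ver_tgt, tgt_ver_src],
    by rw [src_ver_tgt, src_ver_src]⟩

namespace IsMorita

/-- The 2-arrow between parallel 1-arrows. -/
def between (a b : Δ.X₁) : Δ.X₂ := hφ.cell a (φ.f₁ a) b

/-- Since `Γ` has only identity 2-arrows, the boundary conditions on the image reduce to equality of
the images of `a` and `b`; the Morita condition then supplies the 2-arrow, unique by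
`between_tgt_src`. -/
theorem between_spec {a b : Δ.X₁} (h : φ.Parallel a b) :
    Δ.ver.tgt (hφ.between a b) = a ∧ Δ.ver.src (hφ.between a b) = b := by
  obtain ⟨h1, -, h2⟩ := hφ.cell_spec (a := a) (y := φ.f₁ a) (b := b) rfl h.map h.tgt h.src
  exact ⟨h1, h2⟩

theorem between_tgt_src (x : Δ.X₂) : hφ.between (Δ.ver.tgt x) (Δ.ver.src x) = x := by
  have hp := parallel_of_cell φ x
  obtain ⟨h1, h2, h3⟩ := hφ.cell_spec (a := Δ.ver.tgt x) (y := φ.f₁ (Δ.ver.tgt x))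
    (b := Δ.ver.src x) rfl hp.map hp.tgt hp.src
  exact hφ.cell_ext h1 (h2.trans (φ.ver.tgt x).symm) h3

theorem between_near {K : Mfd.{u}} {S : Set K} {k : K} {a b : K → Δ.X₁} (ha : SmoothNear a S k)
    (hb : SmoothNear b S k) (h : ∀ᶠ x in 𝓝[S] k, φ.Parallel (a x) (b x)) :
    SmoothNear (fun x => hφ.between (a x) (b x)) S k :=
  hφ.cell_near ha (Smooth.comp_near φ.one.smooth₁ ha) hb
    (h.mono fun _ h => ⟨rfl, h.map, h.tgt, h.src⟩)

/-- The element of `G` that relates two parallel 1-arrows. -/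
def trans (a b : Δ.X₁) : G := f.gComp (hφ.between a b)

theorem trans_tgt_src (x : Δ.X₂) : hφ.trans f (Δ.ver.tgt x) (Δ.ver.src x) = f.gComp x := by
  rw [trans, between_tgt_src]

theorem trans_near {K : Mfd.{u}} {S : Set K} {k : K} {a b : K → Δ.X₁} (ha : SmoothNear a S k)
    (hb : SmoothNear b S k) (h : ∀ᶠ x in 𝓝[S] k, φ.Parallel (a x) (b x)) :
    SmoothNear (M := G.toMfd) (fun x => hφ.trans f (a x) (b x)) S k :=
  Smooth.comp_near f.gComp_smooth (hφ.between_near ha hb h)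

theorem trans_self (a : Δ.X₁) : hφ.trans f a a = 1 := by
  have h := hφ.trans_tgt_src f (Δ.ver.unit a)
  rwa [Δ.ver.tgt_unit, Δ.ver.src_unit, f.gComp_unit] at h

theorem aut_eq {a b : Δ.X₁} (h : φ.Parallel a b) :
    f.aut a = 𝒜.ad (hφ.trans f a b) * f.aut b := by
  have h1 := f.aut_tgt (hφ.between a b)
  rwa [(hφ.between_spec h).1, (hφ.between_spec h).2] at h1

/-- The vertical composite has the boundary of the 2-arrow between `a` and `c`, hence equals it by
uniqueness. This cocycle identity makes the relation on `Δ₁ × G` an equivalence. -/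
theorem trans_mul_trans {a b c : Δ.X₁} (h : φ.Parallel a b) (h' : φ.Parallel b c) :
    hφ.trans f a b * hφ.trans f b c = hφ.trans f a c := by
  have e : Δ.ver.src (hφ.between a b) = Δ.ver.tgt (hφ.between b c) := by
    rw [(hφ.between_spec h).2, (hφ.between_spec h').1]
  have h1 := hφ.trans_tgt_src f (Δ.ver.mul (hφ.between a b) (hφ.between b c))
  rw [f.gComp_ver e, Δ.ver.tgt_mul _ _ e, Δ.ver.src_mul _ _ e, (hφ.between_spec h).1,
    (hφ.between_spec h').2] at h1
  exact h1.symm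

/-- Uniqueness again, for the horizontal composite; the action comes from the semidirect product. It
is what makes the relation on `Δ₁ × G` a congruence. -/
theorem trans_hor {a a' b b' : Δ.X₁} (h : φ.Parallel a a') (h' : φ.Parallel b b')
    (hab : Δ.one.src a = Δ.one.tgt b) :
    hφ.trans f (Δ.one.mul a b) (Δ.one.mul a' b') =
      hφ.trans f a a' * 𝒜.act (f.aut a') (hφ.trans f b b') := by
  have e : Δ.hor.src (hφ.between a a') = Δ.hor.tgt (hφ.between b b') := by
    rw [← src_ver_tgt, ← tgt_ver_tgt, (hφ.between_spec h).1, (hφ.between_spec h').1, hab]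
  have h1 := hφ.trans_tgt_src f (Δ.hor.mul (hφ.between a a') (hφ.between b b'))
  rw [f.gComp_hor e, ver_tgt_hor e, ver_src_hor e, (hφ.between_spec h).1,
    (hφ.between_spec h').1, (hφ.between_spec h).2, (hφ.between_spec h').2] at h1
  exact h1

theorem exists_loop_iff {a a' : Δ.X₁} {P : G → Prop} :
    (∃ l, Δ.ver.src l = Δ.one.unit (Δ.one.src a') ∧ a = Δ.one.mul a' (Δ.ver.tgt l) ∧
      P (f.gComp l)) ↔ φ.Parallel a a' ∧ P (𝒜.act (f.aut a')⁻¹ (hφ.trans f a a')) := by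
  rw [f.exists_loop_iff_exists_cell]
  constructor
  · rintro ⟨x, rfl, rfl, h⟩
    rw [← hφ.trans_tgt_src f x] at h
    exact ⟨parallel_of_cell φ x, h⟩
  · rintro ⟨h1, h2⟩
    exact ⟨_, (hφ.between_spec h1).2, (hφ.between_spec h1).1, h2⟩

/-- The equivalence relation `(a j(l), g) ~ (a, f(l) g)` on `Δ₁ × G`. -/
def setoid : Setoid (Δ.X₁.prod G.toMfd) where
  -- The group element is moved after the arrow, where it reads `f(a)(g)`; the relation is then
  -- right multiplication by the cocycle `trans`.
  r x y := φ.Parallel x.1 y.1 ∧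
    𝒜.act (f.aut y.1) y.2 = 𝒜.act (f.aut x.1) x.2 * hφ.trans f x.1 y.1
  iseqv :=
    { refl := fun x => ⟨.refl φ _, by rw [trans_self, mul_one]⟩
      symm := fun {x y} h => ⟨h.1.symm, by
        rw [h.2, mul_assoc, trans_mul_trans hφ f h.1 h.1.symm, trans_self, mul_one]⟩
      trans := fun {x y z} h h' => ⟨h.1.trans h'.1, by
        rw [h'.2, h.2, mul_assoc, trans_mul_trans hφ f h.1 h'.1]⟩ }

/-- As `f(a)` is conjugation by `t = trans a a'` after `f(a')`, one has `f(a)(g) t = t f(a')(g)`.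
Applying `f(a')⁻¹` turns `t` into the `G`-component of the loop `l`. -/
theorem setoid_iff {a a' : Δ.X₁} {g g' : G} :
    hφ.setoid f ((a, g) : Δ.X₁ × G) ((a', g') : Δ.X₁ × G) ↔
      ∃ l : Δ.X₂, Δ.ver.src l = Δ.one.unit (Δ.one.src a') ∧ a = Δ.one.mul a' (Δ.ver.tgt l) ∧
        g' = f.gComp l * g := by
  rw [hφ.exists_loop_iff f (P := fun x => g' = x * g)]
  change φ.Parallel a a' ∧ 𝒜.act (f.aut a') g' = 𝒜.act (f.aut a) g * hφ.trans f a a' ↔ _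
  refine and_congr_right fun h => ?_
  rw [hφ.aut_eq f h, 𝒜.ad_mul_act, inv_mul_cancel_right]
  constructor
  · intro e
    rw [← 𝒜.inv_act_act (f.aut a') g', e, 𝒜.act_mul, 𝒜.inv_act_act]
  · intro e
    rw [e, 𝒜.act_mul, 𝒜.act_inv_act]

variable {Q : Mfd.{u}} {q : Δ.X₁ → Q} (hq : SurjSubmersion q)
  (hqp : ∀ a b, q a = q b ↔ φ.Parallel a b)
include hq hqp

/-- Over the domain of a local section `s` of `q`, each class has exactly one representative whose
arrow lies on `s`. Its group element, written after the arrow, is `f(a)(g) · trans a (s (q a))`, so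
the quotient is locally a product of an open subset of `Q` with `G`. Taking `s` through `a₀` makes
the slice pass through the given point. -/
theorem exists_chart (x : Δ.X₁.prod G.toMfd) :
    ∃ d : QuotientChart (Δ.X₁.prod G.toMfd) (hφ.setoid f) (Q.prod G.toMfd).model,
      x ∈ d.U ∧ d.σ (d.χ x) = x := by
  obtain ⟨a₀, g₀⟩ := x
  obtain ⟨s, h1, h2, h3⟩ := hq.lift (K := Q) (S := Set.univ) (k := q a₀) trivial
    (Smooth.near contMDiff_id) a₀ rfl
  obtain ⟨U₀, hU, hU', hU''⟩ := eventually_nhds_iff.1 (by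
    have := h2.and h3
    rwa [nhdsWithin_univ] at this)
  let U : Set (Δ.X₁.prod G.toMfd) := {x | q x.1 ∈ U₀}
  let W : Set (Q.prod G.toMfd) := {b | b.1 ∈ U₀}
  have hs : SmoothOn s U₀ := fun y hy => ContMDiffWithinAt.mono (hU y hy).1 (Set.subset_univ _)
  let χ : Δ.X₁.prod G.toMfd → Q.prod G.toMfd := fun x =>
    ((q x.1, 𝒜.act (f.aut x.1) x.2 * hφ.trans f x.1 (s (q x.1))) : Q × G)
  let σ : Q.prod G.toMfd → Δ.X₁.prod G.toMfd := fun b =>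
    ((s b.1, 𝒜.act (f.aut (s b.1))⁻¹ b.2) : Δ.X₁ × G)
  have hp : ∀ a, q a ∈ U₀ → φ.Parallel a (s (q a)) := fun a ha =>
    (hqp _ _).1 (hU _ ha).2.symm
  have hq1 : Smooth (fun x : Δ.X₁.prod G.toMfd => q x.1) := hq.smooth.comp smooth_fst
  have hχ : SmoothOn χ U := by
    refine SmoothOn.pair (ContMDiff.contMDiffOn hq1) (LieGrp.smoothOn_mul
      (𝒜.smoothOn_act (f.aut_smooth.comp_contMDiffOn smoothOn_fst) smoothOn_snd) ?_)
    refine smoothOn_of_near fun k hk => hφ.trans_near f (Smooth.near smooth_fst)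
      (SmoothOn.comp_near hs (Smooth.near hq1) eventually_mem_nhdsWithin) ?_
    exact eventually_mem_nhdsWithin.mono fun x hx => hp _ hx
  have hσ : SmoothOn σ W := by
    have h4 : SmoothOn (M := Q.prod G.toMfd) (fun b => s b.1) W := hs.comp smoothOn_fst fun _ h => h
    exact SmoothOn.pair h4 (𝒜.smoothOn_act
      (LieGrp.smoothOn_inv (f.aut_smooth.comp_contMDiffOn h4)) smoothOn_snd)
  refine ⟨.ofSlice χ σ U W (hU'.preimage hq1.continuous)
    (hU'.preimage smooth_fst.continuous) hχ hσ ?_ ?_ ?_ (χ ((a₀, g₀) : Δ.X₁ × G)), ?_, ?_⟩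
  · rintro ⟨a, g⟩ ⟨a', g'⟩ ⟨h4, h5⟩ h6
    have e := (hqp _ _).2 h4
    have h6' : q a' ∈ U₀ := e ▸ h6
    refine ⟨h6', Prod.ext e ?_⟩
    change 𝒜.act (f.aut a) g * hφ.trans f a (s (q a)) =
      𝒜.act (f.aut a') g' * hφ.trans f a' (s (q a'))
    dsimp only at e h4 h5
    rw [h5, mul_assoc, hφ.trans_mul_trans f h4 (hp _ h6'), e]
  · rintro ⟨a, g⟩ h4
    refine ⟨h4, (hp a h4).symm, ?_⟩
    change 𝒜.act (f.aut a) g = 𝒜.act (f.aut (s (q a))) (𝒜.act (f.aut (s (q a)))⁻¹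
      (𝒜.act (f.aut a) g * hφ.trans f a (s (q a)))) * hφ.trans f (s (q a)) a
    rw [𝒜.act_inv_act, mul_assoc, hφ.trans_mul_trans f (hp a h4) (hp a h4).symm, trans_self,
      mul_one]
  · rintro ⟨h, g⟩ h4
    have e : q (s h) = h := (hU h h4).2
    refine ⟨?_, Prod.ext e ?_⟩
    · change q (s h) ∈ U₀
      rw [e]; exact h4
    · change 𝒜.act (f.aut (s h)) (𝒜.act (f.aut (s h))⁻¹ g) * hφ.trans f (s h) (s (q (s h))) = g
      rw [e, trans_self, 𝒜.act_inv_act, mul_one]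
  · exact ⟨hU'', mem_chart_source (Q.prod G.toMfd).model (χ ((a₀, g₀) : Δ.X₁ × G))⟩
  · change σ ((chartAt _ _).symm (chartAt _ (χ ((a₀, g₀) : Δ.X₁ × G))
      (χ ((a₀, g₀) : Δ.X₁ × G)))) = _
    rw [(chartAt _ _).left_inv (mem_chart_source _ _)]
    refine Prod.ext h1 ?_
    change 𝒜.act (f.aut (s (q a₀)))⁻¹ (𝒜.act (f.aut a₀) g₀ * hφ.trans f a₀ (s (q a₀))) = g₀
    rw [h1, trans_self, mul_one, 𝒜.inv_act_act]

/-- Pairs with equal image in the Hausdorff manifold `Q` form a closed set. On it the cocycle is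
continuous, and the remaining condition equates two continuous maps to the Hausdorff group `G`. -/
theorem isClosed_setoid :
    IsClosed {p : Δ.X₁.prod G.toMfd × Δ.X₁.prod G.toMfd | hφ.setoid f p.1 p.2} := by
  let K := (Δ.X₁.prod G.toMfd).prod (Δ.X₁.prod G.toMfd)
  have h1 : Smooth (M := K) (fun p => p.1.1) := smooth_fst.comp smooth_fst
  have h2 : Smooth (M := K) (fun p => p.2.1) := smooth_fst.comp smooth_snd
  let C : Set K := {p | q p.1.1 = q p.2.1}
  have hC : IsClosed C :=
    isClosed_eq (hq.smooth.comp h1).continuous (hq.smooth.comp h2).continuous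
  have h3 : SmoothOn (M := K) (N := G.toMfd.prod G.toMfd) (fun p =>
      ((𝒜.act (f.aut p.2.1) p.2.2, 𝒜.act (f.aut p.1.1) p.1.2 * hφ.trans f p.1.1 p.2.1) :
        G × G)) C := by
    refine SmoothOn.pair (𝒜.smoothOn_act (ContMDiff.contMDiffOn (f.aut_smooth.comp h2))
      (ContMDiff.contMDiffOn (smooth_snd.comp smooth_snd))) (LieGrp.smoothOn_mul
        (𝒜.smoothOn_act (ContMDiff.contMDiffOn (f.aut_smooth.comp h1))
          (ContMDiff.contMDiffOn (smooth_snd.comp smooth_fst))) ?_)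
    exact smoothOn_of_near fun k hk => hφ.trans_near f (Smooth.near h1) (Smooth.near h2)
      (eventually_mem_nhdsWithin.mono fun p hp => (hqp _ _).1 hp)
  have h4 := h3.continuousOn.preimage_isClosed_of_isClosed hC
    (isClosed_diagonal (X := G))
  have h5 : {p : Δ.X₁.prod G.toMfd × Δ.X₁.prod G.toMfd | hφ.setoid f p.1 p.2} = C ∩ _ :=
    Set.ext fun p => and_congr_left fun _ => (hqp _ _).symm
  rw [h5]
  exact h4

theorem exists_total : ∃ (R : Mfd.{u}) (π : Δ.X₁.prod G.toMfd → R), SurjSubmersion π ∧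
    ∀ x y, π x = π y ↔ hφ.setoid f x y := by
  choose c h1 h2 using hφ.exists_chart f hq hqp
  exact exists_quotient c h1 h2 (hφ.isClosed_setoid f hq hqp)

end IsMorita

end Hom

end Lie2Groupoid

/-! ### Construction of the induced extension -/

namespace Lie2Groupoid.Hom.IsMorita

variable {M A : Mfd.{u}} {Γ : LieGroupoid M A} {G : LieGrp.{u}} {𝒜 : G.AutLieGroup}
  {Δ : Lie2Groupoid.{u}} {φ : Hom Δ (.ofGroupoid Γ)} (hφ : φ.IsMorita) (f : Hom Δ 𝒜.twoGroup)
  {Q R : Mfd.{u}} {q : Δ.X₁ → Q} {π : Δ.X₁.prod G.toMfd → R}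

theorem quo_congruence (hq : SurjSubmersion q) (hqp : ∀ a b, q a = q b ↔ φ.Parallel a b) :
    Δ.one.Congruence q where
  submersion := hq
  src a b h := ((hqp a b).1 h).src
  tgt a b h := ((hqp a b).1 h).tgt
  mul _ _ _ _ h h' hab := (hqp _ _).2 (((hqp _ _).1 h).mul ((hqp _ _).1 h') hab)

/-- Written after the arrow, the element of a product is `f(a)(g) · f(a)(f(b)(k))`. A change of
representatives multiplies it by `trans_hor`, and the conjugation relating `f(a)` to `f(a')` absorbs
the factor `trans a a'`. -/
theorem tot_congruence (hπ : SurjSubmersion π) (hπr : ∀ x y, π x = π y ↔ hφ.setoid f x y) :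
    (trivialExtension f).tot.Congruence π where
  submersion := hπ
  src a b h := ((hπr a b).1 h).1.src
  tgt a b h := ((hπr a b).1 h).1.tgt
  mul := by
    rintro ⟨a, g⟩ ⟨a', g'⟩ ⟨b, k⟩ ⟨b', k'⟩ h h' (hab : Δ.one.src a = Δ.one.tgt b)
    obtain ⟨h1, h2⟩ := (hπr _ _).1 h
    obtain ⟨h3, h4⟩ := (hπr _ _).1 h'
    dsimp only at h1 h2 h3 h4
    have hab' : Δ.one.src a' = Δ.one.tgt b' := by rw [← h1.src, ← h3.tgt, hab]
    refine (hπr _ _).2 ⟨h1.mul h3 hab, ?_⟩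
    change 𝒜.act (f.aut (Δ.one.mul a' b')) (𝒜.act (f.aut b')⁻¹ g' * k') =
      𝒜.act (f.aut (Δ.one.mul a b)) (𝒜.act (f.aut b)⁻¹ g * k) *
        hφ.trans f (Δ.one.mul a b) (Δ.one.mul a' b')
    have e : ∀ (x y : 𝒜.A) (z w : G), 𝒜.act (x * y) (𝒜.act y⁻¹ z * w) =
        𝒜.act x z * 𝒜.act x (𝒜.act y w) := fun x y z w => by
      rw [𝒜.mul_act, 𝒜.act_mul, 𝒜.act_inv_act, 𝒜.act_mul]
    rw [f.aut_mul hab, f.aut_mul hab', hφ.trans_hor f h1 h3 hab, e, e, h2, h4, 𝒜.act_mul,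
      hφ.aut_eq f h1, 𝒜.ad_mul_act _ _ (𝒜.act (f.aut b) k)]
    group

include hφ in
/-- The extension induced by a morphism to `[G → Aut(G)]`. -/
theorem exists_inducedExtension : ∃ (X : InducedExtension f) (ψ : X.ext.quoArr → A),
    LieGroupoid.IsMorita X.ext.quo Γ φ.f₀ ψ ∧ ∀ a, ψ (X.quot.quo a) = φ.f₁ a := by
  -- `H` needs no quotient construction: its arrows are the submanifold of arrows of `Γ[Δ₀]`
  -- supplied by the Morita condition, and the fibres of `q` are the classes of parallel arrows.
  obtain ⟨Q, ι, q, hι, hq, hιq⟩ := hφ.arrows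
  have hqp : ∀ a b, q a = q b ↔ φ.Parallel a b := fun a b => by
    rw [parallel_iff, ← hι.injective.eq_iff]
    exact ⟨fun h => (hιq a).symm.trans (h.trans (hιq b)),
      fun h => (hιq a).trans (h.trans (hιq b).symm)⟩
  obtain ⟨R, π, hπ, hπr⟩ := hφ.exists_total f hq hqp
  have cq := quo_congruence hq hqp
  have cπ := hφ.tot_congruence f hπ hπr
  let T := trivialExtension f
  have hqf : ∀ x y, π x = π y → q (T.proj x) = q (T.proj y) := fun x y h =>
    (hqp _ _).2 ((hπr _ _).1 h).1
  let proj : R → Q := fun r => q (T.proj (cπ.rep r))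
  have hproj : ∀ x, proj (π x) = q (T.proj x) := fun x => hqf _ _ (cπ.apply_rep _)
  have hpc : (fun x => proj (π x)) = q ∘ T.proj := funext hproj
  let H := LieGroupoid.descend cq
  let E : GExtension G Δ.X₀ :=
    { totArr := R
      quoArr := Q
      tot := LieGroupoid.descend cπ
      quo := H
      incl := π ∘ T.incl
      proj := proj
      incl_hom := (LieGroupoid.descend_isHom cπ).comp T.incl_hom
      proj_hom := LieGroupoid.IsHom.of_descend cπ ((congrArg (LieGroupoid.IsHom T.tot H _root_.id)
        hpc).mpr ((LieGroupoid.descend_isHom cq).comp T.proj_hom))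
      incl_injective := by
        rintro ⟨m, g⟩ ⟨m', g'⟩ h
        obtain ⟨h1, h2⟩ := (hπr _ _).1 h
        have h3 : m = m' := (Δ.one.src_unit m).symm.trans (h1.src.trans (Δ.one.src_unit m'))
        subst h3
        change 𝒜.act (f.aut (Δ.one.unit m)) g' = 𝒜.act (f.aut (Δ.one.unit m)) g *
          hφ.trans f (Δ.one.unit m) (Δ.one.unit m) at h2
        rw [trans_self, mul_one, f.aut_unit, 𝒜.one_act, 𝒜.one_act] at h2
        rw [h2]
      proj_submersion := hπ.of_comp (by
        rw [hpc]
        exact hq.comp T.proj_submersion)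
      exact := by
        intro r
        constructor
        · rintro ⟨m, hm⟩
          obtain ⟨⟨a, g⟩, rfl⟩ := hπ.1 r
          have hp : φ.Parallel a (Δ.one.unit m) := (hqp _ _).1 ((hproj _).symm.trans hm)
          -- Transport of `(a, g)` to the unit at `m`, which acts trivially; the group element is
          -- therefore the one written after the arrow, corrected by the cocycle.
          refine ⟨((m, 𝒜.act (f.aut a) g * hφ.trans f a (Δ.one.unit m)) : Δ.X₀ × G),
            ((hπr _ _).2 ⟨hp, ?_⟩).symm⟩
          change 𝒜.act (f.aut (Δ.one.unit m)) _ = _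
          rw [f.aut_unit, 𝒜.one_act]
          rfl
        · rintro ⟨p, rfl⟩
          exact ⟨p.1, hproj _⟩ }
  let quot : GExtension.Hom T E :=
    { f₀ := _root_.id
      tot := π
      quo := q
      tot_hom := LieGroupoid.descend_isHom cπ
      quo_hom := LieGroupoid.descend_isHom cq
      comm := hproj }
  let X : InducedExtension f :=
    { ext := E
      quot := quot
      base := fun _ => rfl
      incl := fun _ => rfl
      tot_submersion := hπ
      quo_submersion := hq
      tot_fibre := fun a a' g g' => (hπr _ _).trans (hφ.setoid_iff f)
      quo_fibre := fun a a' => (hqp a a').trans <| by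
        have h := hφ.exists_loop_iff f (a := a) (a' := a') (P := fun _ => True)
        simpa only [and_true] using h.symm }
  have hψ : ∀ a, φ.f₁ (cq.rep (q a)) = φ.f₁ a := fun a => ((hqp _ _).1 (cq.apply_rep _)).map
  refine ⟨X, fun p => φ.f₁ (cq.rep p), ⟨?_, hφ.base, ?_⟩, hψ⟩
  · refine LieGroupoid.IsHom.of_descend cq ?_
    simp only [hψ]
    exact φ.one
  -- The inclusion `ι` already identifies `H` with the pullback of `Γ`, so the diffeomorphism
  -- required of a Morita morphism is `hι`.
  · have e : ι = fun p => ((H.tgt p, φ.f₁ (cq.rep p), H.src p) : Δ.X₀ × A × Δ.X₀) := by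
      funext p
      obtain ⟨a, rfl⟩ := hq.1 p
      exact (hιq a).trans
        (Prod.ext (cq.tgt_rep a) (Prod.ext (hψ a) (cq.src_rep a))).symm
    rw [e] at hι
    exact hι

end Lie2Groupoid.Hom.IsMorita

/-! ### Morita morphisms between quotients of Lie groupoids -/

/-- A morphism of Lie groupoids that covers a morphism whose arrows are locally those of a pullback
is a Morita morphism if it is injective between given objects. -/
theorem LieGroupoid.exists_isMorita_of_cover {M A Q M' A' Q' : Mfd.{u}} {X : LieGroupoid M A}
    {Y : LieGroupoid M Q} {X' : LieGroupoid M' A'} {Y' : LieGroupoid M' Q'} {p : A → Q}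
    {p' : A' → Q'} (hp : IsHom X Y id p) (hp' : IsHom X' Y' id p') (sp : SurjSubmersion p)
    (sp' : SurjSubmersion p') {f₀ : M' → M} {f₁ : A' → A} (hf : IsHom X' X f₀ f₁)
    (h₀ : SurjSubmersion f₀)
    (h₁ : SubmOnto (M := A') (N := M'.prod (A.prod M'))
      (fun a => ((X'.tgt a, f₁ a, X'.src a) : M' × A × M')) (pullbackArrows X f₀))
    (hr : ∀ a b, X'.tgt a = X'.tgt b → X'.src a = X'.src b →
      (p (f₁ a) = p (f₁ b) ↔ p' a = p' b)) :
    ∃ k : Q' → Q, IsMorita Y' Y f₀ k ∧ ∀ a, k (p' a) = p (f₁ a) := by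
  have ht : ∀ a b, p' a = p' b → X'.tgt a = X'.tgt b := fun a b h => by
    rw [← _root_.id_eq (X'.tgt a)]
    exact (hp'.tgt a).symm.trans (h ▸ hp'.tgt b)
  have hs : ∀ a b, p' a = p' b → X'.src a = X'.src b := fun a b h => by
    rw [← _root_.id_eq (X'.src a)]
    exact (hp'.src a).symm.trans (h ▸ hp'.src b)
  -- Two representatives of `q` have the same ends, so `hr` makes the choice immaterial.
  let k : Q' → Q := fun q => p (f₁ (Function.surjInv sp'.1 q))
  have hk : ∀ a, k (p' a) = p (f₁ a) := fun a => by
    have e := Function.surjInv_eq sp'.1 (p' a)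
    exact (hr _ _ (ht _ _ e) (hs _ _ e)).2 e
  have hkh : IsHom Y' Y f₀ k :=
    { smooth₀ := h₀.smooth
      smooth₁ := sp'.smooth_of_comp (by simp only [hk]; exact hp.smooth₁.comp hf.smooth₁)
      src := fun q => by
        obtain ⟨a, rfl⟩ := sp'.1 q
        rw [hk, hp.src, hp'.src, hf.src]; rfl
      tgt := fun q => by
        obtain ⟨a, rfl⟩ := sp'.1 q
        rw [hk, hp.tgt, hp'.tgt, hf.tgt]; rfl
      unit := fun m => by
        have e := hp'.unit m
        simp only [_root_.id] at e
        rw [← e, hk, hf.unit, hp.unit]; rfl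
      mul := fun q r hqr => by
        obtain ⟨a, rfl⟩ := sp'.1 q
        obtain ⟨b, rfl⟩ := sp'.1 r
        have hab : X'.src a = X'.tgt b := by
          have e1 := hp'.src a
          have e2 := hp'.tgt b
          simp only [_root_.id] at e1 e2
          rw [← e1, hqr, e2]
        have hab' : X.src (f₁ a) = X.tgt (f₁ b) := by rw [hf.src, hf.tgt, hab]
        rw [← hp'.mul _ _ hab, hk, hk, hk, hf.mul _ _ hab, hp.mul _ _ hab'] }
  refine ⟨k, ⟨hkh, h₀, SubmOnto.diffeoOnto ⟨?_, fun q => ⟨hkh.tgt q, hkh.src q⟩, ?_, ?_⟩ ?_ ?_⟩, hk⟩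
  · exact Smooth.pair Y'.tgt_smooth (Smooth.pair hkh.smooth₁ Y'.src_smooth)
  · rintro ⟨m, q, n⟩ ⟨h1, h2⟩
    obtain ⟨a, rfl⟩ := sp.1 q
    have h3 : X.tgt a = f₀ m := (hp.tgt a).symm.trans h1
    have h4 : X.src a = f₀ n := (hp.src a).symm.trans h2
    obtain ⟨b, hb⟩ := h₁.surj ((m, a, n) : M' × A × M') ⟨h3, h4⟩
    refine ⟨p' b, Prod.ext ((hp'.tgt b).trans (congrArg (fun x : M' × A × M' => x.1) hb))
      (Prod.ext ?_ ((hp'.src b).trans (congrArg (fun x : M' × A × M' => x.2.2) hb)))⟩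
    exact (hk b).trans (congrArg (fun x : M' × A × M' => p x.2.1) hb)
  · intro q
    obtain ⟨b, rfl⟩ := sp'.1 q
    have hm := @eventually_mem_nhdsWithin _ _
      ((Y'.tgt (p' b), k (p' b), Y'.src (p' b)) : M'.prod (Q.prod M')) (pullbackArrows Y f₀)
    -- To get a local section, lift the arrow of `Y` to `X` through `p`, then lift it to `X'` with
    -- the given ends, and project by `p'`.
    obtain ⟨l, e1, e2, e3⟩ := sp.lift (K := M'.prod (Q.prod M')) (S := pullbackArrows Y f₀)
      (k := ((Y'.tgt (p' b), k (p' b), Y'.src (p' b)) : M' × Q × M'))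
      ⟨hkh.tgt _, hkh.src _⟩ (Smooth.near (smooth_fst.comp smooth_snd)) (f₁ b) (hk b).symm
    obtain ⟨l', e1', e2', e3'⟩ := h₁.lift (K := M'.prod (Q.prod M')) (S := pullbackArrows Y f₀)
      (k := ((Y'.tgt (p' b), k (p' b), Y'.src (p' b)) : M' × Q × M'))
      (h := fun x => ((x.1, l x, x.2.2) : M' × A × M')) ⟨hkh.tgt _, hkh.src _⟩
      (SmoothNear.pair (Smooth.near smooth_fst)
        (e2.pair (Smooth.near (smooth_snd.comp smooth_snd)))) (by
        filter_upwards [e3, hm] with x h1 h2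
        refine ⟨(hp.tgt (l x)).symm.trans ?_, (hp.src (l x)).symm.trans ?_⟩
        · rw [h1]; exact h2.1
        · rw [h1]; exact h2.2) b
      (Prod.ext (hp'.tgt b).symm (Prod.ext e1.symm (hp'.src b).symm))
    refine ⟨fun x => p' (l' x), congrArg p' e1', Eventually.and (Smooth.comp_near sp'.smooth e2') ?_⟩
    filter_upwards [e3, e3'] with x h1 h2
    refine Prod.ext ((hp'.tgt _).trans (congrArg (fun x : M' × A × M' => x.1) h2))
      (Prod.ext ?_ ((hp'.src _).trans (congrArg (fun x : M' × A × M' => x.2.2) h2)))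
    exact (hk _).trans ((congrArg (fun x : M' × A × M' => p x.2.1) h2).trans h1)
  · intro q r h
    obtain ⟨a, rfl⟩ := sp'.1 q
    obtain ⟨b, rfl⟩ := sp'.1 r
    refine (hr a b ?_ ?_).1 ?_
    · exact (hp'.tgt a).symm.trans
        ((congrArg (fun x : M' × Q × M' => x.1) h).trans (hp'.tgt b))
    · exact (hp'.src a).symm.trans
        ((congrArg (fun x : M' × Q × M' => x.2.2) h).trans (hp'.src b))
    · exact (hk a).symm.trans
        ((congrArg (fun x : M' × Q × M' => x.2.1) h).trans (hk b))
  · rintro ⟨m, -, -⟩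
    exact ⟨Y'.unit m⟩

/-! ### The twist of `Δ₁ × G` by a transformation -/

namespace Lie2Groupoid.Hom.NatTrans

variable {G : LieGrp.{u}} {𝒜 : G.AutLieGroup} {Δ : Lie2Groupoid.{u}} {e e' : Hom Δ 𝒜.twoGroup}
  (α : NatTrans e e')

/-- The components in `Aut(G)` of a transformation. -/
def aut (m : Δ.X₀) : 𝒜.A := α.φ m

/-- The components in `G` of a transformation. -/
def elt (a : Δ.X₁) : G := (show G × 𝒜.A from α.ψ a).1

theorem aut_smooth : Smooth (N := 𝒜.A.toMfd) α.aut := α.smooth_φ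

theorem elt_smooth : Smooth (N := G.toMfd) α.elt := smooth_fst.comp α.smooth_ψ

theorem ψ_eq (a : Δ.X₁) :
    α.ψ a = ((α.elt a, α.aut (Δ.one.tgt a) * e.aut a) : G × 𝒜.A) := Prod.ext rfl (α.src_ψ a)

theorem ad_elt_mul (a : Δ.X₁) : 𝒜.ad (α.elt a) * (α.aut (Δ.one.tgt a) * e.aut a) =
    e'.aut a * α.aut (Δ.one.src a) := by
  have h := α.tgt_ψ a
  rw [ψ_eq] at h
  exact h

theorem elt_mul {a b : Δ.X₁} (h : Δ.one.src a = Δ.one.tgt b) :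
    α.elt (Δ.one.mul a b) = 𝒜.act (e'.aut a) (α.elt b) * α.elt a := by
  have h1 : α.elt (Δ.one.mul a b) = (1 * 𝒜.act (e'.aut a) (α.elt b)) *
      (α.elt a * 𝒜.act (show G × 𝒜.A from α.ψ a).2 1) :=
    congrArg (fun p : G × 𝒜.A => p.1) (α.map_mul a b h)
  rwa [one_mul, 𝒜.act_one, mul_one] at h1

theorem elt_unit (m : Δ.X₀) : α.elt (Δ.one.unit m) = 1 := by
  have h := α.elt_mul (a := Δ.one.unit m) (b := Δ.one.unit m)
    (by rw [Δ.one.src_unit, Δ.one.tgt_unit])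
  have h1 := Δ.one.mul_unit (Δ.one.unit m)
  rw [Δ.one.src_unit] at h1
  rw [h1, e'.aut_unit, 𝒜.one_act] at h
  exact left_eq_mul.1 h

/-- The `G`-component of the naturality square; whiskering by identity 2-arrows contributes only the
action of `α.aut`. -/
theorem gComp_mul_elt (x : Δ.X₂) : e'.gComp x * α.elt (Δ.ver.src x) =
    α.elt (Δ.ver.tgt x) * 𝒜.act (α.aut (Δ.hor.tgt x)) (e.gComp x) := by
  have h1 : (e'.gComp x * 𝒜.act (show G × 𝒜.A from e'.f₂ x).2 1) * α.elt (Δ.ver.src x) =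
      α.elt (Δ.ver.tgt x) * (1 * 𝒜.act (α.aut (Δ.hor.tgt x)) (e.gComp x)) :=
    congrArg (fun p : G × 𝒜.A => p.1) (α.naturality x)
  rwa [one_mul, 𝒜.act_one, mul_one] at h1

/-- The action of a transformation on the element of `G` that precedes a 1-arrow, the result being
written after the 1-arrow. -/
def twist (a : Δ.X₁) (g : G) : G :=
  𝒜.act (α.aut (Δ.one.tgt a)) (𝒜.act (e.aut a) g) * (α.elt a)⁻¹

/-- The inverse of `twist`. -/
def untwist (a : Δ.X₁) (g : G) : G :=
  𝒜.act (e.aut a)⁻¹ (𝒜.act (α.aut (Δ.one.tgt a))⁻¹ (g * α.elt a))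

theorem twist_untwist (a : Δ.X₁) (g : G) : α.twist a (α.untwist a g) = g := by
  rw [twist, untwist, 𝒜.act_inv_act, 𝒜.act_inv_act, mul_inv_cancel_right]

theorem untwist_twist (a : Δ.X₁) (g : G) : α.untwist a (α.twist a g) = g := by
  rw [twist, untwist, inv_mul_cancel_right, 𝒜.inv_act_act, 𝒜.inv_act_act]

theorem twist_unit_one (m : Δ.X₀) : α.twist (Δ.one.unit m) 1 = 1 := by
  rw [twist, 𝒜.act_one, 𝒜.act_one, elt_unit, inv_one, mul_one]

/-- With elements written after the arrow, the semidirect law becomes `x · e'(a)(y)`. The identity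
`h1` holds because conjugation by `elt a` measures the failure of `α.aut` to intertwine `e` and `e'`
on `a`; multiplicativity of `elt` does the rest. -/
theorem twist_mul {a b : Δ.X₁} (h : Δ.one.src a = Δ.one.tgt b) (g k : G) :
    α.twist (Δ.one.mul a b) (𝒜.act (e.aut b)⁻¹ g * k) =
      α.twist a g * 𝒜.act (e'.aut a) (α.twist b k) := by
  have h1 : ∀ y, α.elt a * 𝒜.act (α.aut (Δ.one.tgt a)) (𝒜.act (e.aut a) y) * (α.elt a)⁻¹ =
      𝒜.act (e'.aut a) (𝒜.act (α.aut (Δ.one.src a)) y) := fun y => by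
    rw [← 𝒜.mul_act, ← 𝒜.mul_act, ← 𝒜.ad_mul_act, α.ad_elt_mul]
  rw [twist, twist, twist, Δ.one.tgt_mul _ _ h, e.aut_mul h, α.elt_mul h, 𝒜.act_mul (e'.aut a), ← h,
    ← h1, 𝒜.mul_act, 𝒜.act_mul (e.aut b), 𝒜.act_inv_act, 𝒜.act_mul, 𝒜.act_mul, 𝒜.act_inv]
  group

/-- Shows that twisting matches the classes on both sides. By naturality the factor `elt` at the
target of `x` is exchanged for the one at its source, and the injective action of `α.aut` at the
common target cancels. -/
theorem twist_cell (x : Δ.X₂) (g g' : G) :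
    α.twist (Δ.ver.src x) g' = α.twist (Δ.ver.tgt x) g * e'.gComp x ↔
      𝒜.act (e.aut (Δ.ver.src x)) g' = 𝒜.act (e.aut (Δ.ver.tgt x)) g * e.gComp x := by
  have h := α.gComp_mul_elt x
  rw [← eq_mul_inv_iff_mul_eq] at h
  have hi : Function.Injective (𝒜.act (α.aut (Δ.hor.tgt x))) :=
    Function.LeftInverse.injective (𝒜.inv_act_act _)
  rw [twist, twist, h, tgt_ver_src, tgt_ver_tgt, 
    ← hi.eq_iff (a := 𝒜.act (e.aut (Δ.ver.src x)) g'), 𝒜.act_mul _ _ (e.gComp x),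
    ← mul_left_inj (α.elt (Δ.ver.src x))⁻¹ (b := 𝒜.act _ (𝒜.act _ g'))]
  simp only [mul_assoc, inv_mul_cancel_left]

end Lie2Groupoid.Hom.NatTrans

/-! ### Morita equivalence of induced extensions -/

namespace InducedExtension

variable {G : LieGrp.{u}} {𝒜 : G.AutLieGroup} {Δ : Lie2Groupoid.{u}}
  {f : Lie2Groupoid.Hom Δ 𝒜.twoGroup} (X : InducedExtension f)

theorem quot_f₀ : X.quot.f₀ = id := funext X.base

theorem quo_eq_iff {a a' : Δ.X₁} : X.quot.quo a = X.quot.quo a' ↔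
    ∃ x, Δ.ver.src x = a' ∧ Δ.ver.tgt x = a := by
  have h := f.exists_loop_iff_exists_cell (a := a) (a' := a') (P := fun _ => True)
  simp only [and_true] at h
  rw [X.quo_fibre, h]

/-- The fibres in terms of 2-arrows rather than loops. It holds for any induced extension, not only
the one constructed above, so the comparison below involves no choice of model. -/
theorem tot_eq_iff {a a' : Δ.X₁} {g g' : G} :
    X.quot.tot ((a, g) : Δ.X₁ × G) = X.quot.tot ((a', g') : Δ.X₁ × G) ↔
      ∃ x, Δ.ver.src x = a' ∧ Δ.ver.tgt x = a ∧
        𝒜.act (f.aut a') g' = 𝒜.act (f.aut a) g * f.gComp x := by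
  refine (X.tot_fibre a a' g g').trans
    ((f.exists_loop_iff_exists_cell (P := fun y => g' = y * g)).trans ?_)
  refine exists_congr fun x => and_congr_right ?_
  rintro rfl
  refine and_congr_right ?_
  rintro rfl
  rw [f.aut_tgt, 𝒜.ad_mul_act, inv_mul_cancel_right]
  constructor
  · intro e
    rw [e, 𝒜.act_mul, 𝒜.act_inv_act]
  · intro e
    rw [← 𝒜.inv_act_act (f.aut (Δ.ver.src x)) g', e, 𝒜.act_mul, 𝒜.inv_act_act]

end InducedExtension

open Lie2Groupoid

variable {G : LieGrp.{u}} {𝒜 : G.AutLieGroup} {Δ Δ' : Lie2Groupoid.{u}}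
  {f : Hom Δ 𝒜.twoGroup} {f' : Hom Δ' 𝒜.twoGroup} {h : Hom Δ' Δ} (hh : h.IsMorita)
  (α : Hom.NatTrans f' (f.comp h))

/-- The map of trivial extensions defined by a transformation. -/
def Lie2Groupoid.Hom.NatTrans.extMap (x : Δ'.X₁.prod G.toMfd) : Δ.X₁.prod G.toMfd :=
  -- `twist` yields the element after the arrow; the inverse action of `f(h a)` puts it back before
  -- the arrow.
  ((h.f₁ x.1, 𝒜.act (f.aut (h.f₁ x.1))⁻¹ (α.twist x.1 x.2)) : Δ.X₁ × G)

theorem Lie2Groupoid.Hom.NatTrans.extMap_isHom :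
    LieGroupoid.IsHom (trivialExtension f').tot (trivialExtension f).tot h.f₀ α.extMap where
  smooth₀ := h.one.smooth₀
  smooth₁ := by
    have h1 : Smooth (M := Δ'.X₁.prod G.toMfd) (fun x => h.f₁ x.1) := h.one.smooth₁.comp smooth_fst
    refine Smooth.pair h1 (contMDiffOn_univ.1 ?_)
    refine 𝒜.smoothOn_act (LieGrp.smoothOn_inv (ContMDiff.contMDiffOn (f.aut_smooth.comp h1)))
      (LieGrp.smoothOn_mul (𝒜.smoothOn_act
        (ContMDiff.contMDiffOn (α.aut_smooth.comp (Δ'.one.tgt_smooth.comp smooth_fst)))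
        (𝒜.smoothOn_act (ContMDiff.contMDiffOn (f'.aut_smooth.comp smooth_fst)) smoothOn_snd))
        (LieGrp.smoothOn_inv (ContMDiff.contMDiffOn (α.elt_smooth.comp smooth_fst))))
  src x := h.one.src x.1
  tgt x := h.one.tgt x.1
  unit m := by
    refine Prod.ext (h.one.unit m) ?_
    change 𝒜.act _ (α.twist (Δ'.one.unit m) 1) = 1
    rw [α.twist_unit_one, 𝒜.act_one]
  mul := by
    rintro ⟨a, g⟩ ⟨b, k⟩ (hab : Δ'.one.src a = Δ'.one.tgt b)
    have hab' : Δ.one.src (h.f₁ a) = Δ.one.tgt (h.f₁ b) := by rw [h.one.src, h.one.tgt, hab]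
    refine Prod.ext (h.one.mul a b hab) ?_
    change 𝒜.act (f.aut (h.f₁ (Δ'.one.mul a b)))⁻¹
        (α.twist (Δ'.one.mul a b) (𝒜.act (f'.aut b)⁻¹ g * k)) =
      𝒜.act (f.aut (h.f₁ b))⁻¹ (𝒜.act (f.aut (h.f₁ a))⁻¹ (α.twist a g)) *
        𝒜.act (f.aut (h.f₁ b))⁻¹ (α.twist b k)
    rw [α.twist_mul hab, h.one.mul _ _ hab, f.aut_mul hab', mul_inv_rev, 𝒜.mul_act, 𝒜.act_mul]
    change 𝒜.act _ (_ * 𝒜.act (f.aut (h.f₁ a))⁻¹ (𝒜.act (f.aut (h.f₁ a)) _)) = _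
    rw [𝒜.inv_act_act, 𝒜.act_mul]

-- The 1-arrow lifts because `h` is Morita; for a fixed 1-arrow the twist is a bijection of `G` with
-- smooth inverse, so the group element lifts uniquely.
include hh in
theorem Lie2Groupoid.Hom.NatTrans.extMap_submOnto :
    SubmOnto (M := Δ'.X₁.prod G.toMfd) (N := Δ'.X₀.prod ((Δ.X₁.prod G.toMfd).prod Δ'.X₀))
      (fun a => (((trivialExtension f').tot.tgt a, α.extMap a, (trivialExtension f').tot.src a) :
        Δ'.X₀ × (Δ.X₁.prod G.toMfd) × Δ'.X₀))
      ((trivialExtension f).tot.pullbackArrows h.f₀) := by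
  have hF := α.extMap_isHom
  have hu : ∀ (a : Δ'.X₁) (b : Δ.X₁) (y : G), h.f₁ a = b →
      α.extMap ((a, α.untwist a (𝒜.act (f.aut b) y)) : Δ'.X₁ × G) = ((b, y) : Δ.X₁ × G) := by
    rintro a _ y rfl
    refine Prod.ext rfl ?_
    change 𝒜.act (f.aut (h.f₁ a))⁻¹ (α.twist a (α.untwist a (𝒜.act (f.aut (h.f₁ a)) y))) = y
    rw [α.twist_untwist, 𝒜.inv_act_act]
  refine ⟨?_, fun x => ⟨h.one.tgt x.1, h.one.src x.1⟩, ?_, ?_⟩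
  · exact Smooth.pair (LieGroupoid.tgt_smooth _)
      (Smooth.pair hF.smooth₁ (LieGroupoid.src_smooth _))
  · rintro ⟨m, ⟨b, y⟩, n⟩ ⟨h1, h2⟩
    obtain ⟨a, rfl, rfl, rfl⟩ := hh.exists_arrow (m := m) (n := n) (y := b) h1 h2
    exact ⟨((a, α.untwist a (𝒜.act (f.aut (h.f₁ a)) y)) : Δ'.X₁ × G),
      Prod.ext rfl (Prod.ext (hu a _ y rfl) rfl)⟩
  · rintro ⟨a₀, g₀⟩
    let K := Δ'.X₀.prod ((Δ.X₁.prod G.toMfd).prod Δ'.X₀)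
    let S : Set K := (trivialExtension f).tot.pullbackArrows h.f₀
    let k₀ : K := ((Δ'.one.tgt a₀, α.extMap ((a₀, g₀) : Δ'.X₁ × G), Δ'.one.src a₀) :
        Δ'.X₀ × (Δ.X₁.prod G.toMfd) × Δ'.X₀)
    have hb : Smooth (M := K) (fun x => x.2.1.1) := smooth_fst.comp (smooth_fst.comp smooth_snd)
    have hy : Smooth (M := K) (N := G.toMfd) (fun x => x.2.1.2) :=
      smooth_snd.comp (smooth_fst.comp smooth_snd)
    have hm := @eventually_mem_nhdsWithin _ _ k₀ S
    obtain ⟨l, e1, e2, e3⟩ := hh.lift_arrow (K := K) (S := S) (k := k₀) (m := fun x => x.1)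
      (y := fun x => x.2.1.1) (n := fun x => x.2.2) ⟨h.one.tgt a₀, h.one.src a₀⟩
      (Smooth.near smooth_fst) (Smooth.near hb) (Smooth.near (smooth_snd.comp smooth_snd))
      (hm.mono fun x hx => hx.1) (hm.mono fun x hx => hx.2) a₀ rfl rfl rfl
    refine ⟨fun x => ((l x, α.untwist (l x) (𝒜.act (f.aut x.2.1.1) x.2.1.2)) : Δ'.X₁ × G), ?_, ?_⟩
    · change ((l k₀, α.untwist (l k₀) (𝒜.act (f.aut (h.f₁ a₀)) (𝒜.act (f.aut (h.f₁ a₀))⁻¹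
        (α.twist a₀ g₀)))) : Δ'.X₁ × G) = (a₀, g₀)
      rw [e1, 𝒜.act_inv_act, α.untwist_twist]
    · refine Eventually.and (SmoothNear.pair e2 ?_) ?_
      · have hA : ∀ {u : K → 𝒜.A} {v : K → G}, SmoothNear (M := 𝒜.A.toMfd) u S k₀ →
            SmoothNear (M := G.toMfd) v S k₀ →
            SmoothNear (M := G.toMfd) (fun x => 𝒜.act (u x) (v x)) S k₀ := fun hu hv =>
          Smooth.comp_near 𝒜.smooth_act (hu.pair hv)
        have hI : ∀ {u : K → 𝒜.A}, SmoothNear (M := 𝒜.A.toMfd) u S k₀ →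
            SmoothNear (M := 𝒜.A.toMfd) (fun x => (u x)⁻¹) S k₀ := fun hu =>
          Smooth.comp_near (M := 𝒜.A.toMfd) (N := 𝒜.A.toMfd)
            (contMDiffOn_univ.1 (LieGrp.smoothOn_inv (ContMDiff.contMDiffOn contMDiff_id))) hu
        refine hA (hI (Smooth.comp_near f'.aut_smooth e2)) (hA (hI (Smooth.comp_near
          (α.aut_smooth.comp Δ'.one.tgt_smooth) e2)) ?_)
        exact Smooth.comp_near (M := G.toMfd.prod G.toMfd) (N := G.toMfd)
          (g := fun p => p.1 * p.2)
          (contMDiffOn_univ.1 (LieGrp.smoothOn_mul smoothOn_fst smoothOn_snd))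
          ((hA (Smooth.near (f.aut_smooth.comp hb)) (Smooth.near hy)).pair
            (Smooth.comp_near α.elt_smooth e2))
      · filter_upwards [e3] with x hx
        exact Prod.ext hx.1 (Prod.ext (hu _ _ _ hx.2.1) hx.2.2)

include hh α in
/-- A Morita morphism `h : Δ' → Δ` and a transformation `f' → f ∘ h` define a Morita morphism
between the induced extensions. -/
theorem InducedExtension.exists_isMorita (X' : InducedExtension f') (X : InducedExtension f) :
    ∃ F : GExtension.Hom X'.ext X.ext, F.IsMorita := by
  have hq := X.quot.quo_hom
  have hq' := X'.quot.quo_hom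
  have ht := X.quot.tot_hom
  have ht' := X'.quot.tot_hom
  rw [quot_f₀] at hq hq' ht ht'
  -- 2-arrows lift uniquely with prescribed boundary, so between 1-arrows with the same ends the
  -- classes in `Δ'` are exactly those seen in `Δ`.
  have hcell : ∀ a b : Δ'.X₁, Δ'.one.tgt a = Δ'.one.tgt b → Δ'.one.src a = Δ'.one.src b →
      ∀ x, Δ.ver.src x = h.f₁ b → Δ.ver.tgt x = h.f₁ a →
        ∃ x', Δ'.ver.src x' = b ∧ Δ'.ver.tgt x' = a ∧ h.f₂ x' = x := by
    intro a b h1 h2 x h3 h4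
    obtain ⟨x', h5, h6, h7⟩ := hh.exists_cell h4 h3 h1 h2
    exact ⟨x', h7, h5, h6⟩
  obtain ⟨kq, hkq, eq⟩ := LieGroupoid.exists_isMorita_of_cover hq hq' X.quo_submersion
    X'.quo_submersion h.one hh.base hh.arrows_submOnto (by
      intro a b h1 h2
      refine X.quo_eq_iff.trans (Iff.trans ?_ X'.quo_eq_iff.symm)
      constructor
      · rintro ⟨x, h3, h4⟩
        obtain ⟨x', h5, h6, -⟩ := hcell a b h1 h2 x h3 h4
        exact ⟨x', h5, h6⟩
      · rintro ⟨x, rfl, rfl⟩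
        exact ⟨h.f₂ x, h.ver.src x, h.ver.tgt x⟩)
  obtain ⟨kt, hkt, et⟩ := LieGroupoid.exists_isMorita_of_cover ht ht' X.tot_submersion
    X'.tot_submersion α.extMap_isHom hh.base (α.extMap_submOnto hh) (by
      rintro ⟨a, g⟩ ⟨b, g'⟩ h1 h2
      refine X.tot_eq_iff.trans (Iff.trans ?_ X'.tot_eq_iff.symm)
      change (∃ x, Δ.ver.src x = h.f₁ b ∧ Δ.ver.tgt x = h.f₁ a ∧
        𝒜.act (f.aut (h.f₁ b)) (𝒜.act (f.aut (h.f₁ b))⁻¹ (α.twist b g')) =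
          𝒜.act (f.aut (h.f₁ a)) (𝒜.act (f.aut (h.f₁ a))⁻¹ (α.twist a g)) * f.gComp x) ↔ _
      simp only [𝒜.act_inv_act]
      constructor
      · rintro ⟨x, h3, h4, h5⟩
        obtain ⟨x', rfl, rfl, rfl⟩ := hcell a b h1 h2 x h3 h4
        exact ⟨x', rfl, rfl, (α.twist_cell x' g g').1 h5⟩
      · rintro ⟨x, rfl, rfl, h5⟩
        exact ⟨h.f₂ x, h.ver.src x, h.ver.tgt x, (α.twist_cell x g g').2 h5⟩)
  refine ⟨⟨h.f₀, kt, kq, hkt.isHom, hkq.isHom, fun z => ?_⟩, hh.base, hkq, hkt⟩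
  obtain ⟨x, rfl⟩ := X'.tot_submersion.1 z
  exact (congrArg X.ext.proj (et x)).trans ((X.quot.comm _).trans
    ((eq x.1).symm.trans (congrArg kq (X'.quot.comm x).symm)))

/-- The extensions induced by equivalent refinements are Morita equivalent. -/
theorem InducedExtension.moritaEquiv_of_eqv {M A : Mfd.{u}} {Γ : LieGroupoid M A}
    {r r' : Refinement (.ofGroupoid Γ) 𝒜.twoGroup} (hr : Refinement.Eqv r r') :
    ∀ (X : InducedExtension r.c) (X' : InducedExtension r'.c), X.ext.MoritaEquiv X'.ext := by
  induction hr with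
  | rel r r' hr =>
    intro X X'
    cases hr with
    | refine _ h hh =>
      exact .rel _ _ (InducedExtension.exists_isMorita hh (.refl _) X X')
    | natTrans _ c' α =>
      exact .rel _ _ (InducedExtension.exists_isMorita (h := Hom.id r.E) (Hom.isMorita_id _) α X X')
  | refl r =>
    exact fun X X' => .rel _ _
      (InducedExtension.exists_isMorita (h := Hom.id r.E) (Hom.isMorita_id _) (.refl r.c) X X')
  | symm _ _ _ ih => exact fun X X' => .symm _ _ (ih X' X)
  | trans _ r _ _ _ ih ih' =>
    intro X X'
    -- Transitivity needs an extension induced by the middle refinement; it exists because every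
    -- refinement is Morita over `Γ`.
    obtain ⟨X'', -⟩ := r.hp.exists_inducedExtension r.c
    exact .trans _ _ _ (ih X X'') (ih' X'' X')

/-- Extensions induced by Morita equivalent bundles are Morita equivalent. -/
theorem InducedExtension.moritaEquiv {M A M' A' : Mfd.{u}} {Γ : LieGroupoid M A}
    {Γ' : LieGroupoid M' A'} {P : Bundle 𝒜 Γ} {P' : Bundle 𝒜 Γ'} (hP : P.MoritaEquiv P')
    (R : Presentation P) (R' : Presentation P') (X : InducedExtension R.f)
    (X' : InducedExtension R'.f) : X.ext.MoritaEquiv X'.ext := by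
  obtain ⟨E, hE, hEP⟩ := hP
  -- Both bundles are made to act on the identity refinement of `Γ'`, the first one after the Morita
  -- equivalence `E`.
  let r₀ : Refinement (.ofGroupoid Γ') (.ofGroupoid Γ') := ⟨_, Hom.id _, Hom.isMorita_id _, Hom.id _⟩
  have hc : (E.act r₀).c.IsMorita := hE.act (Hom.isMorita_id _)
  let r := (GenMor.span R.φ R.isMorita R.f).act (E.act r₀)
  let r' := (GenMor.span R'.φ R'.isMorita R'.f).act r₀
  have hrr : Refinement.Eqv r r' := by
    refine .trans _ _ _ (R.equiv.symm.act _) (.trans _ _ _ ?_ (R'.equiv.act r₀))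
    rw [← GenMor.act_comp]
    exact hEP.act r₀
  obtain ⟨Y, -⟩ := r.hp.exists_inducedExtension r.c
  obtain ⟨Y', -⟩ := r'.hp.exists_inducedExtension r'.c
  -- The refinement `r` is a fibre product of `R.Δ` over `Γ`. As `E` consists of Morita morphisms,
  -- its projection to `R.Δ` is Morita, and `r.c` is `R.f` composed with it, so the identity
  -- transformation suffices.
  have h1 : Y.ext.MoritaEquiv X.ext := .rel _ _ (InducedExtension.exists_isMorita
    (pullbackSnd_isMorita R.isMorita hc) (.refl _) Y X)
  have h2 : Y'.ext.MoritaEquiv X'.ext := .rel _ _ (InducedExtension.exists_isMorita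
    (pullbackSnd_isMorita R'.isMorita (Hom.isMorita_id _)) (.refl _) Y' X')
  exact .trans _ _ _ (.symm _ _ h1)
    (.trans _ _ _ (InducedExtension.moritaEquiv_of_eqv hrr Y Y') h2)

end

end TwoBundle


theorem proposition3p8 {G : TwoBundle.LieGrp.{u}} (𝒜 : G.AutLieGroup) :
    (∀ {M A : TwoBundle.Mfd.{u}} (Γ : TwoBundle.LieGroupoid M A) (P : TwoBundle.Bundle 𝒜 Γ),
      Nonempty (TwoBundle.Presentation P) ∧
      ∀ R : TwoBundle.Presentation P, ∃ X : TwoBundle.InducedExtension R.f,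
        ∃ ψ : X.ext.quoArr → A, TwoBundle.LieGroupoid.IsMorita X.ext.quo Γ R.φ.f₀ ψ ∧
          ∀ a, ψ (X.quot.quo a) = R.φ.f₁ a) ∧
    (∀ {M A M' A' : TwoBundle.Mfd.{u}} {Γ : TwoBundle.LieGroupoid M A}
      {Γ' : TwoBundle.LieGroupoid M' A'} (P : TwoBundle.Bundle 𝒜 Γ) (P' : TwoBundle.Bundle 𝒜 Γ'),
      TwoBundle.Bundle.MoritaEquiv P P' →
      ∀ (R : TwoBundle.Presentation P) (R' : TwoBundle.Presentation P')
        (X : TwoBundle.InducedExtension R.f) (X' : TwoBundle.InducedExtension R'.f),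
        X.ext.MoritaEquiv X'.ext) := by
  refine ⟨fun Γ P => ⟨?_, fun R => R.isMorita.exists_inducedExtension R.f⟩,
    fun P P' hP R R' X X' => TwoBundle.InducedExtension.moritaEquiv hP R R' X X'⟩
  obtain ⟨E, φ, hφ, f, h⟩ := TwoBundle.Lie2Groupoid.GenMor.exists_equiv_span P
  exact ⟨⟨E, φ, hφ, f, h⟩⟩
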